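/- The red-green calculus for Spekkens' toy bit theory. A toy bit has four ontic states, numbered $1,2,3,4$, which are the values $(X,Z)=(0,0),(0,1),(1,0),(1,1)$ of two bits. Diagrams are built by wiring together: green spiders with phase label $xy\in\{0,1\}^2$ and any number of legs, red spiders with phase label $xy$ and any number of legs, and the two-legged node $H$. A wire (straight wire, cup or cap) denotes equality of ontic states; $H$ denotes the permutation $(2\,3)$, i.e. the exchange of $X$ and $Z$; a green spider with phase $xy$ denotes the set of tuples of ontic states on its legs whose $X$-values all equal some $c$ and whose $Z$-values sum modulo $2$ to $x$ if $c=0$ and to $y$ if $c=1$; for red spiders $X$ and $Z$ are exchanged. A diagram $D$ denotes the relation $[\![D]\!]$ obtained by relational composition, and a state diagram on $n$ toy bits is a diagram with no inputs and $n$ outputs. Two diagrams are equal according to the rewrite rules if they are related by a finite sequence of the following rewrites, applied in either direction to any part of a diagram, also with the colours exchanged or upside-down. (Topology) Only the connectivity of the diagram matters. (Spider) Two nodes of the same colour joined by a wire merge, and their phase labels add bitwise modulo $2$. (Loop) Self-loops on a spider can be removed. (Identity) A two-legged spider with phase $00$ is a wire. (Bialgebra) Two phase-$00$ green nodes, one on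 each of two inputs, each connected to both of two phase-$00$ red nodes, one on each of two outputs, equal a phase-$00$ red node joining the two inputs, followed by a phase-$00$ green node splitting into the two outputs. (Copy) A phase-$00$ green node with one input and two outputs copies the phase-$00$ red state. (11-copy) A red phase shift (two-legged spider) with phase $11$ on the input of a phase-$00$ green node with one input and any number of outputs can be replaced by a red phase shift with phase $11$ on each of its outputs. (11-commutation) A red phase shift with phase $11$ moves past a green phase shift $xy$, turning it into $yx$. (Colour change) A green spider with $H$ on every leg is the red spider with the same phase. (Euler) $H$ equals three successive phase shifts with phase $01$, coloured green, red, green. (Scalars) A part without inputs and outputs that is disconnected from the rest can be dropped if it does not denote the empty relation. A GS-LO diagram on $n$ toy bits is given by a simple graph $G$ on $n$ vertices and a reversible single-toy-bit operator (a chain of phase shifts and copies of $H$) for each vertex: it has a green phase-$00$ node for each vertex, an $H$ for each edge, connected to the two nodes of its end vertices, and one output for each vertex, to which the operator of that vertex is applied. Theorem. Let $n\ge 0$ and let $D$ be a state diagram on $n$ toy bits with $[\![D]\!]\neq\emptyset$. Then $D$ is equal, according to the rewrite rules, to some GS-LO diagram. Moreover, every operator can be taken in normal form: read from the vertex to the output,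 either a red phase shift $cd$ followed by a green phase shift $ab$, or a red phase shift $fg$ followed by a green phase shift $e\bar e$ and then a red phase shift $01$, with all letters in $\{0,1\}$ and $\bar e=e\oplus1$. -/

import Mathlib

/-! Diagrams of the red-green calculus for Spekkens' toy bit theory.

A diagram is recorded by its nodes and by which legs are joined by a wire: every wire has a name,
and a node carries the multiset of the names of the wires at its legs. This records exactly the
connectivity of the diagram, so that bending wires and moving nodes around in the plane do not
change anything. -/

namespace ToyCalculus

/-- The ontic states of a toy bit, given by the values `(X, Z)` of the two variables. The states
numbered 1, 2, 3, 4 are `(0,0)`, `(0,1)`, `(1,0)`, `(1,1)`. -/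
abbrev Ontic : Type := ZMod 2 × ZMod 2

/-- Phase labels `xy`, added bitwise modulo 2. -/
abbrev Phase : Type := ZMod 2 × ZMod 2

/-- The bit of the phase label `xy` selected by `c`: `x` if `c = 0` and `y` if `c = 1`. -/
def Phase.bit (p : Phase) (c : ZMod 2) : ZMod 2 := if c = 0 then p.1 else p.2

inductive Colour : Type
  | green
  | red

/-- The colour swap. -/
def Colour.other : Colour → Colour
  | .green => .red
  | .red => .green

/-- What can sit at the ends of wires: phased spiders of either colour, the colour-changing
single-toy-bit operation, and a bare piece of wire, which joins two names. -/
inductive Kind : Type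
  | spider (c : Colour) (p : Phase)
  | had
  | wire

/-- A node with its legs, each leg given by the name of the wire attached to it. -/
structure Node (W : Type) where
  kind : Kind
  legs : Multiset W

section Nodes

variable {W : Type}

/-- The spider of colour `c` with phase `p`. -/
def spider (c : Colour) (p : Phase) (legs : Multiset W) : Node W := ⟨.spider c p, legs⟩

/-- The colour-changing node between `u` and `v`. -/
def had (u v : W) : Node W := ⟨.had, {u, v}⟩

/-- A bare wire between `u` and `v`; according to how its ends are used this is
a straight wire, a cup or a cap. -/
def wire (u v : W) : Node W := ⟨.wire, {u, v}⟩

/-- Renaming of wires. -/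
def Node.rename {W' : Type} (f : W → W') (a : Node W) : Node W' := ⟨a.kind, a.legs.map f⟩

/-- Spiders have any number of legs, the other nodes have two. -/
def Node.ArityOK (a : Node W) : Prop :=
  match a.kind with
  | .spider _ _ => True
  | .had => a.legs.card = 2
  | .wire => a.legs.card = 2

/-- The relation denoted by a node, as a condition on the ontic states `σ w` on the wires.
A green spider with phase `xy` relates those tuples of ontic states whose values of `X` all agree,
and whose values of `Z` sum to `x` or `y` according as the common value of `X` is 0 or 1; with one
input, two outputs and phase `00` this is
`1 ∼ {(1,1),(2,2)}`, `2 ∼ {(1,2),(2,1)}`, `3 ∼ {(3,3),(4,4)}`, `4 ∼ {(3,4),(4,3)}`.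
For red spiders `X` and `Z` are exchanged. The colour-changing node is the permutation exchanging
the ontic states 2 and 3, that is, `X` and `Z`. A wire is the identity relation. -/
def Node.Holds (σ : W → Ontic) (a : Node W) : Prop :=
  match a.kind with
  | .spider .green p =>
      ∃ c, (∀ w ∈ a.legs, (σ w).1 = c) ∧ (a.legs.map fun w => (σ w).2).sum = p.bit c
  | .spider .red p =>
      ∃ c, (∀ w ∈ a.legs, (σ w).2 = c) ∧ (a.legs.map fun w => (σ w).1).sum = p.bit c
  | .had => ∃ s : Ontic, a.legs.map σ = {s, s.swap}
  | .wire => ∃ s : Ontic, a.legs.map σ = {s, s}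

/-- All legs of a collection of nodes. -/
def allLegs (D : Multiset (Node W)) : Multiset W := D.bind Node.legs

open Classical in
/-- A collection of nodes without loose ends: every wire that is used has both of its ends in it. -/
def IsClosed (K : Multiset (Node W)) : Prop :=
  ∀ w, (allLegs K).count w = 0 ∨ (allLegs K).count w = 2

/-- The rewrite rules, each for both assignments of the colours. Since legs are unordered, inputs
and outputs are not distinguished here and each rule also covers its upside-down versions. -/
inductive Rule : Multiset (Node W) → Multiset (Node W) → Prop
  /-- Spider rule: nodes of the same colour joined by a wire merge, and their phases add. -/
  | fuse (c : Colour) (p q : Phase) (e : W) (A B : Multiset W) :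
      Rule {spider c p (e ::ₘ A), spider c q (e ::ₘ B)} {spider c (p + q) (A + B)}
  /-- Loop rule. -/
  | loop (c : Colour) (p : Phase) (e : W) (A : Multiset W) :
      Rule {spider c p (e ::ₘ e ::ₘ A)} {spider c p A}
  /-- Identity rule. -/
  | identity (c : Colour) (u v : W) :
      Rule {spider c 0 {u, v}} {wire u v}
  /-- Bialgebra rule, with inputs `i₁ i₂` and outputs `o₁ o₂`. -/
  | bialgebra (c : Colour) (i₁ i₂ o₁ o₂ e₁₁ e₁₂ e₂₁ e₂₂ e : W) :
      Rule
        {spider c 0 {i₁, e₁₁, e₁₂}, spider c 0 {i₂, e₂₁, e₂₂},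
          spider c.other 0 {e₁₁, e₂₁, o₁}, spider c.other 0 {e₁₂, e₂₂, o₂}}
        {spider c.other 0 {i₁, i₂, e}, spider c 0 {e, o₁, o₂}}
  /-- Copy rule. -/
  | copy (c : Colour) (e o₁ o₂ : W) :
      Rule {spider c.other 0 {e}, spider c 0 {e, o₁, o₂}}
        {spider c.other 0 {o₁}, spider c.other 0 {o₂}}
  /-- 11-copy rule. The outputs are the first components of `outs`, and the second components are
  the wires between the copying node and the copies of the phase shift. -/
  | copy11 (c : Colour) (i e : W) (outs : Multiset (W × W)) :
      Rule {spider c.other (1, 1) {i, e}, spider c 0 (e ::ₘ outs.map Prod.fst)}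
        (spider c 0 (i ::ₘ outs.map Prod.snd) ::ₘ
          outs.map fun o => spider c.other (1, 1) {o.2, o.1})
  /-- 11-commutation rule. -/
  | comm11 (c : Colour) (x y : ZMod 2) (i o e e' : W) :
      Rule {spider c.other (1, 1) {i, e}, spider c (x, y) {e, o}}
        {spider c (y, x) {i, e'}, spider c.other (1, 1) {e', o}}
  /-- Colour change rule: a colour-changing node at each leg. The first components of `ends` are
  the free ends, the second components are the wires at the node whose colour is swapped. -/
  | colourChange (c : Colour) (p : Phase) (ends : Multiset (W × W)) :
      Rule (spider c p (ends.map Prod.snd) ::ₘ ends.map fun o => had o.2 o.1)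
        {spider c.other p (ends.map Prod.fst)}
  /-- Euler decomposition of the colour-changing node. -/
  | euler (c : Colour) (u v e f : W) :
      Rule {had u v}
        {spider c (0, 1) {u, e}, spider c.other (0, 1) {e, f}, spider c (0, 1) {f, v}}
  /-- Scalars, that is, parts without inputs and outputs that are not connected to anything else,
  can be dropped unless they represent the empty relation. -/
  | scalar (K : Multiset (Node W)) (hK : IsClosed K)
      (h : ∃ σ : W → Ontic, ∀ a ∈ K, a.Holds σ) :
      Rule K 0

end Nodes

/-- Names of wires in a diagram with `m` inputs and `n` outputs. -/
inductive Name (m n : ℕ) : Type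
  | inp (i : Fin m)
  | out (j : Fin n)
  | int (k : ℕ)

/-- Renaming of the internal wires. -/
def Name.mapInt {m n : ℕ} (f : ℕ → ℕ) : Name m n → Name m n
  | .inp i => .inp i
  | .out j => .out j
  | .int k => .int (f k)

/-- Collections of nodes with wires from `Name m n`; see `IsDiagram`. -/
abbrev Net (m n : ℕ) : Type := Multiset (Node (Name m n))

open Classical in
/-- A diagram with `m` inputs and `n` outputs: every input and every output is attached to exactly
one leg, and every internal wire that is used joins exactly two legs. -/
structure IsDiagram {m n : ℕ} (D : Net m n) : Prop where
  arity : ∀ a ∈ D, a.ArityOK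
  inp : ∀ i, (allLegs D).count (Name.inp i) = 1
  out : ∀ j, (allLegs D).count (Name.out j) = 1
  int : ∀ k, (allLegs D).count (Name.int k) = 0 ∨ (allLegs D).count (Name.int k) = 2

/-- The relation from `m` toy bits to `n` toy bits denoted by a diagram: nodes denote relations,
and connecting legs by a wire is relational composition. -/
def interp {m n : ℕ} (D : Net m n) : Set ((Fin m → Ontic) × (Fin n → Ontic)) :=
  {st | ∃ σ : Name m n → Ontic,
    (∀ i, σ (.inp i) = st.1 i) ∧ (∀ j, σ (.out j) = st.2 j) ∧ ∀ a ∈ D, a.Holds σ}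

open Classical in
/-- One rewrite step between diagrams. -/
inductive Step {m n : ℕ} : Net m n → Net m n → Prop
  /-- A part matching one side of a rule is cut out and the other side is pasted in. -/
  | rule {L R : Net m n} (h : Rule L R) (C : Net m n)
      (hL : IsDiagram (L + C)) (hR : IsDiagram (R + C)) : Step (L + C) (R + C)
  /-- The names of the internal wires do not matter. -/
  | rename (f : ℕ ≃ ℕ) (D : Net m n) (hD : IsDiagram D) :
      Step D (D.map (Node.rename (Name.mapInt f)))
  /-- A bare piece of wire is absorbed into the wire that it prolongs. -/
  | absorb (u : Name m n) (k : ℕ) (hu : u ≠ .int k) (C : Net m n)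
      (hD : IsDiagram (wire u (.int k) ::ₘ C)) :
      Step (wire u (.int k) ::ₘ C) (C.map (Node.rename (Function.update id (.int k) u)))

/-- Equality of diagrams according to the rewrite rules (which can be used in both directions). -/
def Equal {m n : ℕ} (D D' : Net m n) : Prop := Relation.EqvGen Step D D'

/-- The building blocks of reversible single-toy-bit operators. -/
inductive LocalOp : Type
  | phase (c : Colour) (p : Phase)
  | had

def LocalOp.kind : LocalOp → Kind
  | .phase c p => .spider c p
  | .had => .had

/-- Normalised reversible single-toy-bit operators, listed from the vertex to the output. -/
inductive IsNormal : List LocalOp → Prop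
  | two (a b c d : ZMod 2) :
      IsNormal [.phase .red (c, d), .phase .green (a, b)]
  | three (e f g : ZMod 2) :
      IsNormal [.phase .red (f, g), .phase .green (e, e + 1), .phase .red (0, 1)]

section GSLO

variable {n : ℕ}

/-- The wire between vertex `i` and the colour-changing node on the edge from `i` to `j`. -/
def edgeName (i j : Fin n) : Name 0 n := .int (2 * Nat.pair i j)

/-- The wire at the lower end of the `t`-th node of the operator on output `i`. -/
def opName (i : Fin n) (t : ℕ) : Name 0 n := .int (2 * Nat.pair i t + 1)

open Classical in
/-- The graph state of `G`: one green node with an output wire `tip i` for each vertex `i`, and one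
colour-changing node for each edge, connected to the green nodes at its two ends. -/
noncomputable def graphStateWith (G : SimpleGraph (Fin n)) (tip : Fin n → Name 0 n) : Net 0 n :=
  ((Finset.univ : Finset (Fin n)).val.map fun i =>
    spider .green 0 (tip i ::ₘ (Finset.univ.filter fun j => G.Adj i j).val.map (edgeName i)))
  + ((Finset.univ : Finset (Fin n × Fin n)).filter fun e => e.1 < e.2 ∧ G.Adj e.1 e.2).val.map
      fun e => had (edgeName e.1 e.2) (edgeName e.2 e.1)

/-- The wire at which the operator starting with its `t`-th node is attached. -/
def opStart (i : Fin n) (t : ℕ) : List LocalOp → Name 0 n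
  | [] => .out i
  | _ :: _ => opName i t

/-- The chain of nodes of an operator that ends in output `i`. -/
def opNodes (i : Fin n) : ℕ → List LocalOp → Net 0 n
  | _, [] => 0
  | t, o :: l => ⟨o.kind, {opName i t, opStart i (t + 1) l}⟩ ::ₘ opNodes i (t + 1) l

/-- The GS-LO diagram of the graph `G` with the operator `ops i` on the output of vertex `i`. -/
noncomputable def gsLO (G : SimpleGraph (Fin n)) (ops : Fin n → List LocalOp) : Net 0 n :=
  graphStateWith G (fun i => opStart i 0 (ops i)) + ∑ i, opNodes i 0 (ops i)

end GSLO

end ToyCalculus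

/-!
# GS-LO normal form in the red-green calculus for Spekkens' toy bit theory

*Names as variables.* In a diagram every wire has two ends, which makes equations between diagrams
awkward to manipulate. The proof works with nets in which a name may occur any number of times: such
a name stands for a phase-free green spider, its hub, joining all its occurrences, together with the
output if the name is one. A net is realized by diagrams (`Realizes`), and all of these are equal
according to the rewrite rules (`Realizes.equal`), so that nets can be compared by `Sim`. Every rule
can be applied inside a net (`sim_rule`), and the legs of a green spider can be given the same name
(`sim_merge`), after which only its phase is left. Semantically, a name carries a value of `X`; a
green leaf `spider .green p {a}` is a phase at `a`, `had a b` is an edge of a graph, and a red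
spider with phase `xx` says that the values of its legs sum to `x`.

*Graph-like nets.* By colour change, a red spider is a phased hub with an edge to each leg
(`sim_red`). Hence every net is similar to one that consists of phases and edges only
(`exists_graphlike_add`), which is a graph state with phases on its vertices, except that some
vertices are internal names instead of outputs.

*Eliminating an internal name.* The nodes at an internal name are a phase and a star of edges
(`IsGraphlike.exists_star`), that is, they form a red spider whose legs are the neighbours.

* If its phase is `01` or `10`, it is replaced by a complete graph on the neighbours with the same
  phase at each of them (`exists_graphlike_of_mixed`). The legs are detached one by one, each time
  by a local complementation (`sim_local_complement`), which comes from the Euler decomposition.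
* If its phase is `00` or `11`, it is a linear equation for the names at its legs, and is solved for
  one of them: the bialgebra, copy and 11-copy rules duplicate the equation (`sim_split`), and each
  occurrence of the name solved for is replaced by edges to the other legs
  (`exists_graphlike_of_eliminate`). Repeated legs cancel by the Hopf rule (`sim_hopf`). The name
  solved for must be internal; if it is an output, an `H` is applied to that output first, which
  makes the name internal (`isReduced_red`).
* If there are no legs at all, the spider is a scalar. Unless its phase is `11` it is dropped.

So every net is a graph state with local operations applied to its outputs, or contains a red scalar
with phase `11` (`IsGraphlike.isReduced`). In the latter case it denotes the empty relation
(`Realizes.not_models`), and since the rules are sound (`Rule.entails`, `Equal.exists_models_iff`),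
this does not happen for a diagram that denotes a nonempty one.

*Normal forms of the operators.* It remains to normalize the chains of local operations. The
commutation rule for the phase `11` and the braid relation between green and red phase shifts `01`,
obtained by writing `H` in two ways, show that a normal form followed by any phase shift or `H` is
equivalent to a normal form (`absorbs`).
-/

namespace ToyCalculus

open scoped Classical
open Multiset

/-! ### Diagrams, hubs and realizations of nets -/

section

section Legs

variable {W W' W'' : Type}

@[simp] lemma allLegs_zero : allLegs (0 : Multiset (Node W)) = 0 := rfl

@[simp] lemma allLegs_cons (a : Node W) (D : Multiset (Node W)) :
    allLegs (a ::ₘ D) = a.legs + allLegs D := by simp [allLegs]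

@[simp] lemma allLegs_add (D D' : Multiset (Node W)) :
    allLegs (D + D') = allLegs D + allLegs D' := by simp [allLegs]

@[simp] lemma allLegs_singleton (a : Node W) : allLegs {a} = a.legs := by simp [allLegs]

@[simp] lemma allLegs_map_rename (f : W → W') (D : Multiset (Node W)) :
    allLegs (D.map (Node.rename f)) = (allLegs D).map f := by
  simp [allLegs, Multiset.bind_map, Multiset.map_bind, Node.rename]

@[simp] lemma spider_legs (c : Colour) (p : Phase) (A : Multiset W) : (spider c p A).legs = A := rfl
@[simp] lemma had_legs (u v : W) : (had u v).legs = {u, v} := rfl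
@[simp] lemma rename_legs (f : W → W') (a : Node W) : (a.rename f).legs = a.legs.map f := rfl
@[simp] lemma rename_kind (f : W → W') (a : Node W) : (a.rename f).kind = a.kind := rfl
@[simp] lemma wire_legs (u v : W) : (wire u v).legs = {u, v} := rfl
@[simp] lemma rename_spider (f : W → W') (c : Colour) (p : Phase) (A : Multiset W) :
    (spider c p A).rename f = spider c p (A.map f) := rfl
@[simp] lemma rename_had (f : W → W') (u v : W) : (had u v).rename f = had (f u) (f v) := by
  simp [had, Node.rename]
@[simp] lemma rename_wire (f : W → W') (u v : W) : (wire u v).rename f = wire (f u) (f v) := by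
  simp [wire, Node.rename]

lemma rename_rename (f : W → W') (g : W' → W'') (a : Node W) :
    (a.rename f).rename g = a.rename (g ∘ f) := by
  simp [Node.rename]

lemma map_rename_rename (f : W → W') (g : W' → W'') (D : Multiset (Node W)) :
    (D.map (Node.rename f)).map (Node.rename g) = D.map (Node.rename (g ∘ f)) := by
  rw [Multiset.map_map]
  exact Multiset.map_congr rfl fun a _ => rename_rename f g a

lemma rename_congr {f g : W → W'} {a : Node W} (h : ∀ x ∈ a.legs, f x = g x) :
    a.rename f = a.rename g := by
  simp only [Node.rename, Node.mk.injEq, true_and]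
  exact Multiset.map_congr rfl h

lemma mem_allLegs {x : W} {D : Multiset (Node W)} : x ∈ allLegs D ↔ ∃ a ∈ D, x ∈ a.legs := by
  simp [allLegs]

lemma map_rename_congr {f g : W → W'} {D : Multiset (Node W)} (h : ∀ x ∈ allLegs D, f x = g x) :
    D.map (Node.rename f) = D.map (Node.rename g) :=
  Multiset.map_congr rfl fun a ha => rename_congr fun x hx => h x (mem_allLegs.2 ⟨a, ha, hx⟩)

lemma map_rename_id {f : W → W} {D : Multiset (Node W)} (h : ∀ x ∈ allLegs D, f x = x) :
    D.map (Node.rename f) = D := by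
  rw [map_rename_congr (g := id) h]
  refine (Multiset.map_congr rfl fun a _ => ?_).trans (Multiset.map_id _)
  simp [Node.rename]

@[simp] lemma arityOK_spider (c : Colour) (p : Phase) (A : Multiset W) :
    (spider c p A).ArityOK := trivial
@[simp] lemma arityOK_had (u v : W) : (had u v).ArityOK := by simp [had, Node.ArityOK]
@[simp] lemma arityOK_wire (u v : W) : (wire u v).ArityOK := by simp [wire, Node.ArityOK]
@[simp] lemma arityOK_rename (f : W → W') (a : Node W) : (a.rename f).ArityOK ↔ a.ArityOK := by
  rcases a with ⟨k, l⟩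
  cases k <;> simp [Node.ArityOK, Node.rename]

end Legs

section Steps

variable {m n : ℕ}

lemma IsDiagram.of_legs_eq {D D' : Net m n} (h : IsDiagram D) (he : allLegs D' = allLegs D)
    (ar : ∀ a ∈ D', a.ArityOK) : IsDiagram D' :=
  ⟨ar, fun i => he ▸ h.inp i, fun j => he ▸ h.out j, fun k => he ▸ h.int k⟩

/-- Removing both ends of a wire leaves a diagram. -/
lemma IsDiagram.drop_pair {D D' : Net m n} (h : IsDiagram D) {e : Name m n}
    (he : allLegs D = e ::ₘ e ::ₘ allLegs D') (ar : ∀ a ∈ D', a.ArityOK) : IsDiagram D' := by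
  have hc : ∀ x, (allLegs D).count x = (allLegs D').count x + if x = e then 2 else 0 := by
    intro x
    rw [he, count_cons, count_cons]
    split_ifs <;> rfl
  refine ⟨ar, fun i => ?_, fun j => ?_, fun k => ?_⟩
  · have := h.inp i
    rw [hc] at this
    split_ifs at this <;> omega
  · have := h.out j
    rw [hc] at this
    split_ifs at this <;> omega
  · have := h.int k
    rw [hc] at this
    by_cases hk : Name.int k = e
    · rw [if_pos hk] at this; omega
    · rw [if_neg hk] at this; omega

lemma Equal.refl (D : Net m n) : Equal D D := Relation.EqvGen.refl _
lemma Equal.symm {D D' : Net m n} (h : Equal D D') : Equal D' D := Relation.EqvGen.symm _ _ h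
lemma Equal.trans {D D' D'' : Net m n} (h : Equal D D') (h' : Equal D' D'') : Equal D D'' :=
  Relation.EqvGen.trans _ _ _ h h'

lemma Step.equal {D D' : Net m n} (h : Step D D') : Equal D D' := Relation.EqvGen.rel _ _ h

/-- The spider rule in the context of a diagram. The result is a diagram again, as is needed to
continue. -/
lemma equal_fuse {c : Colour} {p q : Phase} {e : Name m n} {A B : Multiset (Name m n)}
    {C : Net m n} (h : IsDiagram (spider c p (e ::ₘ A) ::ₘ spider c q (e ::ₘ B) ::ₘ C)) :
    Equal (spider c p (e ::ₘ A) ::ₘ spider c q (e ::ₘ B) ::ₘ C) (spider c (p + q) (A + B) ::ₘ C) ∧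
      IsDiagram (spider c (p + q) (A + B) ::ₘ C) := by
  have h' : IsDiagram (spider c (p + q) (A + B) ::ₘ C) := by
    refine h.drop_pair (e := e) ?_ ?_
    · simp only [allLegs_cons, spider_legs, cons_add, add_cons, add_assoc]
    · intro a ha
      rcases mem_cons.1 ha with rfl | ha
      · trivial
      · exact h.arity _ (by simp [ha])
  have := Step.rule (Rule.fuse c p q e A B) C (by simpa using h) (by simpa using h')
  exact ⟨by simpa using this.equal, h'⟩

lemma equal_loop {c : Colour} {p : Phase} {e : Name m n} {A : Multiset (Name m n)}
    {C : Net m n} (h : IsDiagram (spider c p (e ::ₘ e ::ₘ A) ::ₘ C)) :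
    Equal (spider c p (e ::ₘ e ::ₘ A) ::ₘ C) (spider c p A ::ₘ C) ∧
      IsDiagram (spider c p A ::ₘ C) := by
  have h' : IsDiagram (spider c p A ::ₘ C) := by
    refine h.drop_pair (e := e) ?_ ?_
    · simp
    · intro a ha
      rcases mem_cons.1 ha with rfl | ha
      · trivial
      · exact h.arity _ (by simp [ha])
  have := Step.rule (Rule.loop c p e A) C (by simpa using h) (by simpa using h')
  exact ⟨by simpa using this.equal, h'⟩

lemma equal_identity {c : Colour} {u v : Name m n} {C : Net m n}
    (h : IsDiagram (spider c 0 {u, v} ::ₘ C)) :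
    Equal (spider c 0 {u, v} ::ₘ C) (wire u v ::ₘ C) ∧ IsDiagram (wire u v ::ₘ C) := by
  have h' : IsDiagram (wire u v ::ₘ C) := by
    refine h.of_legs_eq (by simp) ?_
    intro a ha
    rcases mem_cons.1 ha with rfl | ha
    · simp
    · exact h.arity _ (by simp [ha])
  have := Step.rule (Rule.identity c u v) C (by simpa using h) (by simpa using h')
  exact ⟨by simpa using this.equal, h'⟩

/-- Removing a two-legged phase-free spider, whose second leg is an internal wire. -/
lemma equal_remove_identity {c : Colour} {u : Name m n} {k : ℕ} (hu : u ≠ .int k) {C : Net m n}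
    (h : IsDiagram (spider c 0 {u, .int k} ::ₘ C)) :
    Equal (spider c 0 {u, .int k} ::ₘ C) (C.map (Node.rename (Function.update id (.int k) u))) :=
  (equal_identity h).1.trans (Step.absorb u k hu C (equal_identity h).2).equal

end Steps

section Realization

variable {n : ℕ}

/-- The output leg of the hub of a name: the hub of an output has one, the others have none. -/
def outLeg : Name 0 n → Multiset (Name 0 n)
  | .out j => {.out j}
  | _ => 0

/-- The hub of the label `v`: a phase-free green spider joining all the legs labelled `v`, and the
output itself if `v` is an output. -/
noncomputable def hub (K : Net 0 n) (ℓ : Name 0 n → Name 0 n) (v : Name 0 n) : Node (Name 0 n) :=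
  spider .green 0 (outLeg v + (allLegs K).filter (fun x => ℓ x = v))

/-- The nodes of `K` together with the hubs of the labels in `V`. -/
noncomputable def withHubs (K : Net 0 n) (ℓ : Name 0 n → Name 0 n) (V : Finset (Name 0 n)) :
    Net 0 n :=
  K + V.val.map (hub K ℓ)

/-- The conditions under which `withHubs K ℓ V` is a diagram realizing the net `K.map (rename ℓ)`:
every leg labelled in `V` has a name of its own, and the other legs are labelled by their names and
are wired directly. -/
structure IsSkeleton (K : Net 0 n) (ℓ : Name 0 n → Name 0 n) (V : Finset (Name 0 n)) : Prop where
  arity : ∀ a ∈ K, a.ArityOK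
  hubInt : ∀ x ∈ allLegs K, ℓ x ∈ V → ∃ k, x = .int k
  hubOne : ∀ x, ℓ x ∈ V → (allLegs K).count x ≤ 1
  free : ∀ x ∈ allLegs K, ℓ x ∉ V → ℓ x = x
  freeInt : ∀ k, .int k ∈ allLegs K → ℓ (.int k) ∉ V → (allLegs K).count (.int k) = 2
  out : ∀ j, .out j ∉ V → (allLegs K).count (.out j) = 1

/-- A net in which names may occur any number of times is realized by the diagrams in which every
name is replaced by a green hub joining its occurrences; a name that occurs as in a diagram may be
left as a wire. With this freedom, a diagram realizes itself, and the inner wires of a rule need no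
hubs. -/
def Realizes (F D : Net 0 n) : Prop :=
  ∃ K ℓ V, IsSkeleton K ℓ V ∧ K.map (Node.rename ℓ) = F ∧ withHubs K ℓ V = D

lemma count_allLegs_withHubs (K : Net 0 n) (ℓ : Name 0 n → Name 0 n) (V : Finset (Name 0 n))
    (x : Name 0 n) :
    (allLegs (withHubs K ℓ V)).count x = (allLegs K).count x + (∑ v ∈ V, (outLeg v).count x) +
      if ℓ x ∈ V then (allLegs K).count x else 0 := by
  have key : ∀ s : Finset (Name 0 n), (allLegs (s.val.map (hub K ℓ))).count x =
      (∑ v ∈ s, (outLeg v).count x) + if ℓ x ∈ s then (allLegs K).count x else 0 := by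
    intro s
    induction s using Finset.induction_on with
    | empty => simp
    | insert v s hv ih =>
      rw [Finset.insert_val_of_notMem hv, map_cons, allLegs_cons, count_add, ih,
        Finset.sum_insert hv]
      simp only [hub, spider_legs, count_add, count_filter, Finset.mem_insert]
      by_cases h1 : ℓ x = v
      · subst h1; simp [hv]; ring
      · simp [h1]; ring
  rw [withHubs, allLegs_add, count_add, key, add_assoc]

lemma sum_outLeg_int (V : Finset (Name 0 n)) (k : ℕ) :
    ∑ v ∈ V, (outLeg v).count (.int k) = 0 := by
  refine Finset.sum_eq_zero fun v _ => ?_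
  cases v <;> simp [outLeg]

lemma sum_outLeg_out (V : Finset (Name 0 n)) (j : Fin n) :
    ∑ v ∈ V, (outLeg v).count (.out j) = if .out j ∈ V then 1 else 0 := by
  have : ∀ v : Name 0 n, (outLeg v).count (.out j) = if .out j = v then 1 else 0 := by
    intro v
    cases v <;> simp [outLeg, count_singleton]
  simp [this]

lemma IsSkeleton.isDiagram {K : Net 0 n} {ℓ : Name 0 n → Name 0 n} {V : Finset (Name 0 n)}
    (h : IsSkeleton K ℓ V) : IsDiagram (withHubs K ℓ V) := by
  refine ⟨?_, fun i => i.elim0, fun j => ?_, fun k => ?_⟩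
  · intro a ha
    rcases mem_add.1 ha with ha | ha
    · exact h.arity a ha
    · obtain ⟨v, -, rfl⟩ := mem_map.1 ha
      trivial
  · rw [count_allLegs_withHubs, sum_outLeg_out]
    have h1 : ℓ (.out j) ∈ V → (allLegs K).count (.out j) = 0 := by
      intro hV
      by_contra hc
      obtain ⟨k, hk⟩ := h.hubInt _ (count_pos.1 (Nat.pos_of_ne_zero hc)) hV
      cases hk
    have h2 : .out j ∈ V → (allLegs K).count (.out j) = 0 := by
      intro hV
      by_contra hc
      have hm := count_pos.1 (Nat.pos_of_ne_zero hc)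
      by_cases hV' : ℓ (.out j) ∈ V
      · exact hc (h1 hV')
      · rw [h.free _ hm hV'] at hV'
        exact hV' hV
    by_cases hV : .out j ∈ V
    · simp [hV, h2 hV]
    · have h3 := h.out j hV
      have h4 : ℓ (.out j) ∉ V := fun h4 => by rw [h1 h4] at h3; omega
      simp [hV, h3, h4]
  · rw [count_allLegs_withHubs, sum_outLeg_int]
    by_cases hV : ℓ (.int k) ∈ V
    · have := h.hubOne _ hV
      simp only [hV, if_true]
      omega
    · by_cases hm : Name.int k ∈ allLegs K
      · right
        simp [hV, h.freeInt k hm hV]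
      · left
        simp [hm]

lemma Realizes.isDiagram {F D : Net 0 n} (h : Realizes F D) : IsDiagram D := by
  obtain ⟨K, ℓ, V, hK, -, rfl⟩ := h
  exact hK.isDiagram

lemma IsDiagram.realizes_self {D : Net 0 n} (h : IsDiagram D) : Realizes D D := by
  refine ⟨D, id, ∅, ⟨h.arity, by simp, by simp, by simp, fun k hk _ => ?_, fun j _ => h.out j⟩,
    map_rename_id (by simp), by simp [withHubs]⟩
  rcases h.int k with h | h
  · exact absurd (count_pos.2 hk) (by omega)
  · exact h

end Realization

end

/-! ### Uniqueness of realizations, and similarity of nets -/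

section

lemma exists_perm_extending {S : Finset ℕ} {f : ℕ → ℕ} (hf : Set.InjOn f S) :
    ∃ σ : ℕ ≃ ℕ, ∀ k ∈ S, σ k = f k := by
  induction S using Finset.induction_on with
  | empty => exact ⟨Equiv.refl _, by simp⟩
  | insert a S ha ih =>
    obtain ⟨σ, hσ⟩ := ih (hf.mono (by simp))
    refine ⟨σ.trans (Equiv.swap (σ a) (f a)), fun k hk => ?_⟩
    rcases Finset.mem_insert.1 hk with rfl | hk'
    · simp
    · have hka : k ≠ a := fun h => ha (h ▸ hk')
      have h1 : σ k ≠ σ a := σ.injective.ne hka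
      have h2 : σ k ≠ f a := by
        rw [hσ k hk']
        exact fun h => hka (hf (by simp [hk']) (by simp) h)
      simp only [Equiv.trans_apply]
      rw [Equiv.swap_apply_of_ne_of_ne h1 h2, hσ k hk']

lemma exists_map_eq_of_map_eq {α β : Type} {s t : Multiset α} {f g : α → β} (hs : s.Nodup)
    (h : s.map f = t.map g) : ∃ π : α → α, t = s.map π ∧ ∀ x ∈ s, g (π x) = f x := by
  induction s using Multiset.induction_on generalizing t with
  | empty => exact ⟨id, by simpa using h.symm, by simp⟩
  | cons a s ih =>
    rw [map_cons] at h
    obtain ⟨b, hb, hgb, ht⟩ := (map_eq_cons g t (s.map f) (f a)).2 h.symm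
    rw [nodup_cons] at hs
    obtain ⟨π, hπ, hπ'⟩ := ih hs.2 ht.symm
    have hne : ∀ x ∈ s, x ≠ a := fun x hx h => hs.1 (h ▸ hx)
    refine ⟨Function.update π a b, ?_, ?_⟩
    · rw [map_cons, Function.update_self, Multiset.map_congr rfl
        (fun x hx => Function.update_of_ne (hne x hx) b π), ← hπ, cons_erase hb]
    · intro x hx
      rcases mem_cons.1 hx with rfl | hx
      · simpa using hgb
      · rw [Function.update_of_ne (hne x hx), hπ' x hx]

/-- Two nets that become equal under renamings are related by a renaming, if the legs of the first
have distinct names. -/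
lemma exists_rename_eq_of_rename_eq {W W' : Type} {K L : Multiset (Node W)} {f g : W → W'}
    (hK : (allLegs K).Nodup) (h : K.map (Node.rename f) = L.map (Node.rename g)) :
    ∃ π : W → W, L = K.map (Node.rename π) ∧ ∀ x ∈ allLegs K, g (π x) = f x := by
  induction K using Multiset.induction_on generalizing L with
  | empty => exact ⟨id, by simpa using h.symm, by simp⟩
  | cons a K ih =>
    rw [map_cons] at h
    obtain ⟨b, hb, hab, hL⟩ := (map_eq_cons _ _ _ _).2 h.symm
    rw [allLegs_cons, nodup_add] at hK
    obtain ⟨π, hπ, hπ'⟩ := ih hK.2.1 hL.symm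
    obtain ⟨ρ, hρ, hρ'⟩ := exists_map_eq_of_map_eq (f := f) (g := g) (t := b.legs) hK.1
      (congrArg Node.legs hab).symm
    have hne : ∀ x ∈ allLegs K, x ∉ a.legs := fun x hx hx' =>
      (Multiset.disjoint_left.1 hK.2.2) hx' hx
    refine ⟨fun x => if x ∈ a.legs then ρ x else π x, ?_, ?_⟩
    · have h1 : K.map (Node.rename fun x => if x ∈ a.legs then ρ x else π x) =
          K.map (Node.rename π) := map_rename_congr fun x hx => by rw [if_neg (hne x hx)]
      have h2 : (a.rename fun x => if x ∈ a.legs then ρ x else π x) = b := by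
        rw [rename_congr (g := ρ) fun x hx => by rw [if_pos hx]]
        have hk := congrArg Node.kind hab
        rcases b with ⟨kb, lb⟩
        simp only [Node.rename] at hk ⊢
        simp_all
      rw [map_cons, h1, h2, ← hπ, cons_erase hb]
    · intro x hx
      rw [allLegs_cons, mem_add] at hx
      by_cases hxa : x ∈ a.legs
      · simp [hxa, hρ' x hxa]
      · simp [hxa, hπ' x (hx.resolve_left hxa)]

variable {n : ℕ}

lemma int_injective {m : ℕ} : Function.Injective (Name.int : ℕ → Name m n) :=
  fun a b h => by cases h; rfl

/-- The internal wires among the given names. -/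
noncomputable def intNames (s : Multiset (Name 0 n)) : Finset ℕ :=
  s.toFinset.preimage Name.int int_injective.injOn

@[simp] lemma mem_intNames {s : Multiset (Name 0 n)} {k : ℕ} : k ∈ intNames s ↔ .int k ∈ s :=
  Finset.mem_preimage.trans mem_toFinset

lemma exists_fresh (s : Multiset (Name 0 n)) : ∃ k, .int k ∉ s := by
  obtain ⟨k, hk⟩ := Infinite.exists_notMem_finset (intNames s)
  exact ⟨k, by simpa using hk⟩

/-- A wire without a hub can be given one: a phase-free spider is inserted next to one of its legs,
which gets a fresh name. -/
lemma IsSkeleton.exposeLeg {K : Net 0 n} {ℓ : Name 0 n → Name 0 n} {V : Finset (Name 0 n)}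
    (h : IsSkeleton K ℓ V) {x : Name 0 n} (hx : x ∈ allLegs K) (hxV : ℓ x ∉ V) :
    ∃ K₁ ℓ₁, IsSkeleton K₁ ℓ₁ (insert x V) ∧
      K₁.map (Node.rename ℓ₁) = K.map (Node.rename ℓ) ∧
      Equal (withHubs K ℓ V) (withHubs K₁ ℓ₁ (insert x V)) := by
  obtain ⟨a, ha, hxa⟩ := mem_allLegs.1 hx
  obtain ⟨K₀, rfl⟩ := exists_cons_of_mem ha
  obtain ⟨l, hl⟩ := exists_cons_of_mem hxa
  obtain ⟨k, hk⟩ := exists_fresh (allLegs (a ::ₘ K₀) + V.val)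
  set z : Name 0 n := .int k with hz
  have hx1 : ℓ x = x := h.free x hx hxV
  have hxV' : x ∉ V := hx1 ▸ hxV
  set T := l + allLegs K₀ with hT
  have hK : allLegs (a ::ₘ K₀) = x ::ₘ T := by simp [hl, hT]
  set K₁ : Net 0 n := ⟨a.kind, z ::ₘ l⟩ ::ₘ K₀ with hK₁
  have hKT : allLegs K₁ = z ::ₘ T := by simp [hK₁, hT]
  set ℓ₁ := Function.update ℓ z x with hℓ₁
  rw [mem_add, hK, mem_cons, not_or, not_or] at hk
  obtain ⟨⟨hzx, hzT⟩, hzV⟩ := hk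
  have hzV : z ∉ V := hzV
  have hℓz : ℓ₁ z = x := by simp [hℓ₁]
  have hℓ₁' : ∀ y, y ≠ z → ℓ₁ y = ℓ y := fun y hy => Function.update_of_ne hy _ _
  have hneT : ∀ y ∈ T, y ≠ z := fun y hy h => hzT (h ▸ hy)
  have hTx : ∀ y ∈ T, ℓ y = x → y = x := fun y hy he => by
    rw [← h.free y (by rw [hK]; simp [hy]) (he ▸ hxV'), he]
  have hTcount : ∀ k, x = .int k → T.count x = 1 := by
    rintro k rfl
    have := h.freeInt k hx hxV
    rw [hK, count_cons_self] at this
    omega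
  have hTcount' : ∀ j, x = .out j → T.count x = 0 := by
    rintro j rfl
    have := h.out j hxV'
    rw [hK, count_cons_self] at this
    omega
  have hubx : hub K₁ ℓ₁ x = spider .green 0 {x, z} := by
    have h1 : T.filter (fun y => ℓ₁ y = x) = replicate (T.count x) x := by
      rw [← filter_eq']
      refine filter_congr fun y hy => ?_
      rw [hℓ₁' y (hneT y hy)]
      exact ⟨hTx y hy, fun h => h ▸ hx1⟩
    rw [hub, hKT, filter_cons_of_pos (p := fun y => ℓ₁ y = x) _ hℓz, h1]
    cases x with
    | inp i => exact i.elim0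
    | out j => rw [hTcount' j rfl]; rfl
    | int k => rw [hTcount k rfl, pair_comm]; rfl
  have hubv : ∀ v ∈ V, hub K₁ ℓ₁ v = hub (a ::ₘ K₀) ℓ v := by
    intro v hv
    have h1 : ℓ₁ z ≠ v := fun h => hxV' (hℓz ▸ h ▸ hv)
    have h2 : ℓ x ≠ v := fun h => hxV (h ▸ hv)
    rw [hub, hub, hKT, hK, filter_cons_of_neg (p := fun y => ℓ₁ y = v) _ h1,
      filter_cons_of_neg (p := fun y => ℓ y = v) _ h2]
    congr 2
    exact filter_congr fun y hy => by rw [hℓ₁' y (hneT y hy)]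
  have skel : IsSkeleton K₁ ℓ₁ (insert x V) := by
    refine ⟨?_, ?_, ?_, ?_, ?_, ?_⟩
    · intro b hb
      rcases mem_cons.1 hb with rfl | hb
      · have := h.arity a (by simp)
        have hc : (z ::ₘ l).card = a.legs.card := by simp [hl]
        rcases a with ⟨ka, la⟩
        cases ka <;> simp_all [Node.ArityOK]
      · exact h.arity b (by simp [hb])
    · intro y hy hyV
      rw [hKT, mem_cons] at hy
      rcases hy with rfl | hy
      · exact ⟨k, rfl⟩
      · rw [hℓ₁' y (hneT y hy), Finset.mem_insert] at hyV
        rcases hyV with hyx | hyV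
        · obtain rfl := hTx y hy hyx
          cases y with
          | inp i => exact i.elim0
          | out j => exact absurd (count_pos.2 hy) (by rw [hTcount' j rfl]; simp)
          | int k => exact ⟨k, rfl⟩
        · exact h.hubInt y (by rw [hK]; simp [hy]) hyV
    · intro y hyV
      rw [hKT]
      by_cases hyz : y = z
      · subst hyz
        simp [count_eq_zero.2 hzT]
      · rw [count_cons_of_ne hyz]
        by_cases hyT : y ∈ T
        · rw [hℓ₁' y hyz, Finset.mem_insert] at hyV
          rcases hyV with hyx | hyV
          · obtain rfl := hTx y hyT hyx
            cases y with
            | inp i => exact i.elim0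
            | out j => rw [hTcount' j rfl]; simp
            | int k => rw [hTcount k rfl]
          · have := h.hubOne y hyV
            rw [hK] at this
            exact (count_le_count_cons y x T).trans this
        · simp [count_eq_zero.2 hyT]
    · intro y hy hyV
      rw [hKT, mem_cons] at hy
      rcases hy with rfl | hy
      · simp [hℓz] at hyV
      · rw [hℓ₁' y (hneT y hy)] at hyV ⊢
        exact h.free y (by rw [hK]; simp [hy]) fun h => hyV (by simp [h])
    · intro i hy hyV
      rw [hKT, mem_cons] at hy
      rcases hy with hy | hy
      · simp [hy, hℓz] at hyV
      · rw [hℓ₁' _ (hneT _ hy)] at hyV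
        have hyx : Name.int i ≠ x := fun h => hyV (by rw [h, hx1]; simp)
        have := h.freeInt i (by rw [hK]; simp [hy]) fun h => hyV (by simp [h])
        rw [hK, count_cons_of_ne hyx] at this
        rw [hKT, count_cons_of_ne (hneT _ hy), this]
    · intro j hj
      rw [Finset.mem_insert, not_or] at hj
      have := h.out j hj.2
      rw [hK, count_cons_of_ne hj.1] at this
      rw [hKT, count_cons_of_ne (by simp [hz]), this]
  refine ⟨K₁, ℓ₁, skel, ?_, ?_⟩
  · rw [hK₁, map_cons, map_cons]
    congr 1
    · simp only [Node.rename, map_cons, hl, hℓz, hx1, Node.mk.injEq, true_and]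
      congr 1
      exact Multiset.map_congr rfl fun y hy => hℓ₁' y (hneT y (by simp [hT, hy]))
    · exact map_rename_congr fun y hy => hℓ₁' y (hneT y (by simp [hT, hy]))
  · have h1 : withHubs K₁ ℓ₁ (insert x V) =
        spider .green 0 {x, z} ::ₘ (K₁ + V.val.map (hub (a ::ₘ K₀) ℓ)) := by
      rw [withHubs, Finset.insert_val_of_notMem hxV', map_cons, hubx, add_cons,
        Multiset.map_congr rfl hubv]
    have h2 := skel.isDiagram
    rw [h1] at h2 ⊢
    have h3 : (K₁ + V.val.map (hub (a ::ₘ K₀) ℓ)).map (Node.rename (Function.update id z x)) =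
        withHubs (a ::ₘ K₀) ℓ V := by
      rw [withHubs, Multiset.map_add]
      congr 1
      · rw [hK₁, map_cons]
        congr 1
        · rcases a with ⟨ka, la⟩
          simp only [Node.rename, map_cons, Function.update_self, Node.mk.injEq, true_and] at hl ⊢
          rw [hl, Multiset.map_congr rfl fun y hy =>
            Function.update_of_ne (hneT y (mem_add.2 (Or.inl hy))) x id, Multiset.map_id]
        · exact map_rename_id fun y hy => by
            rw [Function.update_of_ne (hneT y (mem_add.2 (Or.inr hy))), id]
      · refine map_rename_id fun y hy => by
          rw [Function.update_of_ne, id]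
          rintro rfl
          obtain ⟨b, hb, hyb⟩ := mem_allLegs.1 hy
          obtain ⟨v, hv, rfl⟩ := mem_map.1 hb
          simp only [hub, spider_legs, mem_add, mem_filter] at hyb
          rcases hyb with hyb | hyb
          · cases v <;> simp [outLeg, hz] at hyb
          · rw [hK] at hyb
            simp [hzx, hzT] at hyb
    rw [← h3]
    exact (equal_remove_identity (Ne.symm hzx) h2).symm

/-- Every realization is equal to one in which all legs are attached to hubs. -/
lemma IsSkeleton.exists_full {K : Net 0 n} {ℓ : Name 0 n → Name 0 n} {V : Finset (Name 0 n)}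
    (h : IsSkeleton K ℓ V) :
    ∃ K₁ ℓ₁ V₁, IsSkeleton K₁ ℓ₁ V₁ ∧ (∀ x ∈ allLegs K₁, ℓ₁ x ∈ V₁) ∧
      K₁.map (Node.rename ℓ₁) = K.map (Node.rename ℓ) ∧
      Equal (withHubs K ℓ V) (withHubs K₁ ℓ₁ V₁) := by
  induction hN : ((allLegs (K.map (Node.rename ℓ))).toFinset \ V).card using Nat.strong_induction_on
    generalizing K ℓ V with
  | _ N ih =>
    by_cases hfull : ∀ x ∈ allLegs K, ℓ x ∈ V
    · exact ⟨K, ℓ, V, h, hfull, rfl, Equal.refl _⟩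
    · push Not at hfull
      obtain ⟨x, hx, hxV⟩ := hfull
      obtain ⟨K₁, ℓ₁, h₁, hF, hE⟩ := h.exposeLeg hx hxV
      have hx1 := h.free x hx hxV
      obtain ⟨K₂, ℓ₂, V₂, h₂, hf, hF₂, hE₂⟩ := ih _ (by
        rw [← hN, hF]
        refine Finset.card_lt_card ⟨fun y hy => ?_, fun hs => ?_⟩
        · simp only [Finset.mem_sdiff, Finset.mem_insert, not_or] at hy ⊢
          exact ⟨hy.1, hy.2.2⟩
        · have := @hs x (by
            simp only [Finset.mem_sdiff, mem_toFinset, allLegs_map_rename]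
            exact ⟨mem_map.2 ⟨x, hx, hx1⟩, hx1 ▸ hxV⟩)
          simp at this) h₁ rfl
      exact ⟨K₂, ℓ₂, V₂, h₂, hf, hF₂.trans hF, hE.trans hE₂⟩

/-- The labels for which a full realization of `F` needs a hub. -/
noncomputable def hubLabels (F : Net 0 n) : Finset (Name 0 n) :=
  (allLegs F).toFinset ∪ Finset.univ.image Name.out

lemma IsSkeleton.of_full {K : Net 0 n} {ℓ : Name 0 n → Name 0 n} {V : Finset (Name 0 n)}
    (arity : ∀ a ∈ K, a.ArityOK) (nodup : (allLegs K).Nodup)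
    (int : ∀ x ∈ allLegs K, ∃ k, x = .int k) (full : ∀ x ∈ allLegs K, ℓ x ∈ V)
    (out : ∀ j, .out j ∈ V) : IsSkeleton K ℓ V :=
  ⟨arity, fun x hx _ => int x hx, fun x _ => nodup_iff_count_le_one.1 nodup x,
    fun x hx h => absurd (full x hx) h, fun _ hk h => absurd (full _ hk) h,
    fun j hj => absurd (out j) hj⟩

lemma equal_drop_closed {m : ℕ} {K C : Net m n} (hK : allLegs K = 0)
    (hs : ∃ σ, ∀ a ∈ K, Node.Holds σ a) (h : IsDiagram (K + C)) : Equal (K + C) C := by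
  have := Step.rule (Rule.scalar K (fun w => by simp [hK]) hs) C h
    (h.of_legs_eq (by simp [hK]) fun a ha => h.arity a (by simp at ha; simp [ha]))
  simpa using this.equal

/-- The hubs without legs are closed scalars, which can be dropped. -/
lemma IsSkeleton.hubLabels_equal {K : Net 0 n} {ℓ : Name 0 n → Name 0 n} {V : Finset (Name 0 n)}
    (h : IsSkeleton K ℓ V) (hf : ∀ x ∈ allLegs K, ℓ x ∈ V) :
    IsSkeleton K ℓ (hubLabels (K.map (Node.rename ℓ))) ∧
    Equal (withHubs K ℓ V) (withHubs K ℓ (hubLabels (K.map (Node.rename ℓ)))) := by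
  set U := hubLabels (K.map (Node.rename ℓ)) with hU
  have hUl : ∀ x ∈ allLegs K, ℓ x ∈ U := fun x hx => by
    simp only [hU, hubLabels, allLegs_map_rename, Finset.mem_union, mem_toFinset]
    exact Or.inl (mem_map_of_mem _ hx)
  have hUo : ∀ j, .out j ∈ U := fun j => by simp [hU, hubLabels]
  have hout : ∀ j, .out j ∈ V := by
    intro j
    by_contra hj
    have h1 : Name.out j ∈ allLegs K := count_pos.1 (by rw [h.out j hj]; simp)
    obtain ⟨k, hk⟩ := h.hubInt _ h1 (hf _ h1)
    cases hk
  have hUV : U ⊆ V := by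
    intro v hv
    simp only [hU, hubLabels, allLegs_map_rename, Finset.mem_union, mem_toFinset] at hv
    rcases hv with hv | hv
    · obtain ⟨x, hx, rfl⟩ := mem_map.1 hv
      exact hf x hx
    · obtain ⟨j, -, rfl⟩ := Finset.mem_image.1 hv
      exact hout j
  have skel : IsSkeleton K ℓ U := by
    refine ⟨h.arity, fun x hx _ => h.hubInt x hx (hf x hx), fun x hx => h.hubOne x (hUV hx),
      fun x hx h => absurd (hUl x hx) h, fun k hk h => absurd (hUl _ hk) h,
      fun j hj => absurd (hUo j) hj⟩
  refine ⟨skel, ?_⟩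
  have hempty : ∀ v ∈ V \ U, hub K ℓ v = spider .green 0 0 := by
    intro v hv
    rw [Finset.mem_sdiff] at hv
    rw [hub]
    congr 1
    rw [filter_eq_nil.2 fun x hx (hxv : ℓ x = v) => hv.2 (hxv ▸ hUl x hx), add_zero]
    cases v with
    | inp i => exact i.elim0
    | out j => exact absurd (hUo j) hv.2
    | int k => rfl
  have hV : V.val = (V \ U).val + U.val := by
    have := Finset.disjUnion_val (V \ U) U Finset.sdiff_disjoint
    rw [← this, Finset.disjUnion_eq_union, Finset.sdiff_union_of_subset hUV]
  have h1 : withHubs K ℓ V = (V \ U).val.map (hub K ℓ) + withHubs K ℓ U := by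
    rw [withHubs, withHubs, hV, Multiset.map_add]
    abel
  rw [h1]
  refine equal_drop_closed ?_ ?_ (h1 ▸ h.isDiagram)
  · refine eq_zero_of_forall_notMem fun x hx => ?_
    obtain ⟨a, ha, hxa⟩ := mem_allLegs.1 hx
    obtain ⟨v, hv, rfl⟩ := mem_map.1 ha
    rw [hempty v hv] at hxa
    simp at hxa
  · refine ⟨fun _ => 0, fun a ha => ?_⟩
    obtain ⟨v, hv, rfl⟩ := mem_map.1 ha
    rw [hempty v hv]
    exact ⟨0, by simp, by simp [Phase.bit]⟩

@[simp] lemma mapInt_out {m : ℕ} (f : ℕ → ℕ) (j : Fin n) :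
    (Name.out j : Name m n).mapInt f = .out j := rfl
@[simp] lemma mapInt_int {m : ℕ} (f : ℕ → ℕ) (k : ℕ) :
    (Name.int k : Name m n).mapInt f = .int (f k) := rfl

/-- Full realizations of the same net with the same hubs differ by the names of their wires only. -/
lemma IsSkeleton.equal_of_full {K L : Net 0 n} {ℓ ℓ' : Name 0 n → Name 0 n}
    {V : Finset (Name 0 n)} (hK : IsSkeleton K ℓ V) (hL : IsSkeleton L ℓ' V)
    (fK : ∀ x ∈ allLegs K, ℓ x ∈ V) (fL : ∀ x ∈ allLegs L, ℓ' x ∈ V)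
    (h : K.map (Node.rename ℓ) = L.map (Node.rename ℓ')) :
    Equal (withHubs K ℓ V) (withHubs L ℓ' V) := by
  have nodup : ∀ {K : Net 0 n} {ℓ : Name 0 n → Name 0 n}, IsSkeleton K ℓ V →
      (∀ x ∈ allLegs K, ℓ x ∈ V) → (allLegs K).Nodup := by
    intro K ℓ h f
    refine nodup_iff_count_le_one.2 fun x => ?_
    by_cases hx : x ∈ allLegs K
    · exact h.hubOne x (f x hx)
    · simp [count_eq_zero.2 hx]
  obtain ⟨π, rfl, hπ⟩ := exists_rename_eq_of_rename_eq (nodup hK fK) h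
  have nL := nodup hL fL
  rw [allLegs_map_rename] at nL
  have inj : ∀ x ∈ allLegs K, ∀ y ∈ allLegs K, π x = π y → x = y :=
    fun x hx y hy hxy => Multiset.inj_on_of_nodup_map nL x hx y hy hxy
  have hint : ∀ k, Name.int k ∈ allLegs K → ∃ i, π (.int k) = .int i := fun k hk =>
    hL.hubInt _ (by rw [allLegs_map_rename]; exact mem_map_of_mem _ hk)
      (by rw [hπ _ hk]; exact fK _ hk)
  choose! f hf using hint
  have hS : ∀ k, k ∈ intNames (allLegs K) ↔ Name.int k ∈ allLegs K := fun k => mem_intNames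
  obtain ⟨σ, hσ⟩ := exists_perm_extending (S := intNames (allLegs K)) (f := f) (by
    intro a ha b hb hab
    have ha := (hS a).1 ha
    have hb := (hS b).1 hb
    have := inj _ ha _ hb (by rw [hf a ha, hf b hb, hab])
    cases this; rfl)
  have hσπ : ∀ x ∈ allLegs K, x.mapInt σ = π x := by
    intro x hx
    obtain ⟨k, rfl⟩ := hK.hubInt x hx (fK x hx)
    rw [mapInt_int, hσ k ((hS k).2 hx), hf k hx]
  have hmap : (withHubs K ℓ V).map (Node.rename (Name.mapInt σ)) =
      withHubs (K.map (Node.rename π)) ℓ' V := by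
    rw [withHubs, withHubs, Multiset.map_add, map_rename_congr hσπ, Multiset.map_map]
    congr 1
    refine Multiset.map_congr rfl fun v _ => ?_
    simp only [Function.comp, hub, rename_spider, Multiset.map_add, allLegs_map_rename]
    congr 2
    · cases v with
      | inp i => exact i.elim0
      | out j => rfl
      | int k => rfl
    · rw [filter_map, Multiset.map_congr rfl fun x hx => hσπ x (mem_of_mem_filter hx)]
      congr 1
      exact filter_congr fun x hx => by simp [hπ x hx]
  rw [← hmap]
  exact (Step.rename σ _ hK.isDiagram).equal

/-- All diagrams realizing a net are equal according to the rewrite rules: hubs are added at all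
wires, the superfluous ones are dropped, and the wires are renamed. -/
theorem Realizes.equal {F D D' : Net 0 n} (h : Realizes F D) (h' : Realizes F D') :
    Equal D D' := by
  obtain ⟨K, ℓ, V, hK, hF, rfl⟩ := h
  obtain ⟨L, ℓ', V', hL, hF', rfl⟩ := h'
  obtain ⟨K₁, ℓ₁, V₁, hK₁, fK, hF₁, hE⟩ := hK.exists_full
  obtain ⟨L₁, ℓ₁', V₁', hL₁, fL, hF₁', hE'⟩ := hL.exists_full
  obtain ⟨sK, eK⟩ := hK₁.hubLabels_equal fK
  obtain ⟨sL, eL⟩ := hL₁.hubLabels_equal fL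
  rw [hF₁, hF] at sK eK
  rw [hF₁', hF'] at sL eL
  have full : ∀ {K : Net 0 n} {ℓ}, K.map (Node.rename ℓ) = F → ∀ x ∈ allLegs K,
      ℓ x ∈ hubLabels F := by
    rintro K ℓ rfl x hx
    simp only [hubLabels, allLegs_map_rename, Finset.mem_union, mem_toFinset]
    exact Or.inl (mem_map_of_mem _ hx)
  have e := sK.equal_of_full sL (full (hF₁.trans hF)) (full (hF₁'.trans hF'))
    ((hF₁.trans hF).trans (hF₁'.trans hF').symm)
  exact (hE.trans eK).trans (e.trans (hE'.trans eL).symm)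

/-- Two nets are similar if they are realized by the same diagrams, up to equality according to the
rewrite rules. A net with a node of the wrong arity has no realizations, so that any two such nets
are similar. -/
def Sim (F G : Net 0 n) : Prop :=
  ∀ D, (∃ D₀, Realizes F D₀ ∧ Equal D₀ D) ↔ (∃ D₀, Realizes G D₀ ∧ Equal D₀ D)

@[refl] lemma Sim.refl (F : Net 0 n) : Sim F F := fun _ => Iff.rfl
@[symm] lemma Sim.symm {F G : Net 0 n} (h : Sim F G) : Sim G F := fun D => (h D).symm
@[trans] lemma Sim.trans {F G H : Net 0 n} (h : Sim F G) (h' : Sim G H) : Sim F H :=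
  fun D => (h D).trans (h' D)

lemma Realizes.sim {F G D E : Net 0 n} (hF : Realizes F D) (hG : Realizes G E) (h : Equal D E) :
    Sim F G := by
  refine fun D' => ⟨?_, ?_⟩
  · rintro ⟨D₀, h₀, h₁⟩
    exact ⟨E, hG, h.symm.trans ((hF.equal h₀).trans h₁)⟩
  · rintro ⟨D₀, h₀, h₁⟩
    exact ⟨D, hF, h.trans ((hG.equal h₀).trans h₁)⟩

lemma Realizes.arity {F D : Net 0 n} (h : Realizes F D) : ∀ a ∈ F, a.ArityOK := by
  obtain ⟨K, ℓ, V, hK, rfl, -⟩ := h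
  intro a ha
  obtain ⟨b, hb, rfl⟩ := mem_map.1 ha
  simpa using hK.arity b hb

lemma Sim.of_arity {F G : Net 0 n} (h : (∀ a ∈ F, a.ArityOK) ↔ (∀ a ∈ G, a.ArityOK))
    (h' : (∀ a ∈ F, a.ArityOK) → Sim F G) : Sim F G := by
  by_cases hF : ∀ a ∈ F, a.ArityOK
  · exact h' hF
  · refine fun D => ⟨?_, ?_⟩
    · rintro ⟨D₀, h₀, -⟩
      exact absurd h₀.arity hF
    · rintro ⟨D₀, h₀, -⟩
      exact absurd (h.2 h₀.arity) hF

lemma IsDiagram.equal_of_sim {D E : Net 0 n} (hD : IsDiagram D) (hE : IsDiagram E)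
    (h : Sim D E) : Equal D E := by
  obtain ⟨D₀, h₀, h₁⟩ := (h D).1 ⟨D, hD.realizes_self, Equal.refl _⟩
  exact h₁.symm.trans (h₀.equal hE.realizes_self)

end

/-! ### Renaming names, and merging hubs -/

section

section Linear

variable {W : Type} [Nonempty W]

lemma exists_nodup_map_eq (A : Multiset W) (S : Finset ℕ) :
    ∃ (A' : Multiset ℕ) (ℓ : ℕ → W), A'.map ℓ = A ∧ A'.Nodup ∧ ∀ k ∈ A', k ∉ S := by
  induction A using Multiset.induction_on with
  | empty => exact ⟨0, fun _ => Classical.arbitrary W, by simp⟩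
  | cons a A ih =>
    obtain ⟨A', ℓ, rfl, h, hS⟩ := ih
    obtain ⟨k, hk⟩ := Infinite.exists_notMem_finset (S ∪ A'.toFinset)
    rw [Finset.mem_union, mem_toFinset, not_or] at hk
    refine ⟨k ::ₘ A', Function.update ℓ k a, ?_, nodup_cons.2 ⟨hk.2, h⟩, ?_⟩
    · rw [map_cons, Function.update_self]
      congr 1
      exact Multiset.map_congr rfl fun x hx =>
        Function.update_of_ne (fun (h : x = k) => hk.2 (h ▸ hx)) _ _
    · intro i hi
      rcases mem_cons.1 hi with rfl | hi
      exacts [hk.1, hS i hi]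

/-- Every net arises by renaming from one in which all legs have names of their own, avoiding a
given set. -/
lemma exists_linear (C : Multiset (Node W)) (S : Finset ℕ) :
    ∃ (C' : Multiset (Node ℕ)) (ℓ : ℕ → W), C'.map (Node.rename ℓ) = C ∧ (allLegs C').Nodup ∧
      ∀ k ∈ allLegs C', k ∉ S := by
  induction C using Multiset.induction_on with
  | empty => exact ⟨0, fun _ => Classical.arbitrary W, by simp⟩
  | cons a C ih =>
    obtain ⟨C', ℓ, rfl, h, hS⟩ := ih
    obtain ⟨A, ℓA, hA, nA, sA⟩ := exists_nodup_map_eq a.legs (S ∪ (allLegs C').toFinset)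
    have hd : ∀ k ∈ A, k ∉ allLegs C' := fun k hk => by
      have := sA k hk
      rw [Finset.mem_union, mem_toFinset, not_or] at this
      exact this.2
    refine ⟨⟨a.kind, A⟩ ::ₘ C', fun k => if k ∈ A then ℓA k else ℓ k, ?_, ?_, ?_⟩
    · rw [map_cons]
      congr 1
      · rcases a with ⟨ka, la⟩
        simp only [Node.rename, Node.mk.injEq, true_and]
        exact (Multiset.map_congr rfl fun x hx => by rw [if_pos hx]).trans hA
      · exact map_rename_congr fun x hx => by rw [if_neg fun h => hd x h hx]
    · rw [allLegs_cons, nodup_add]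
      exact ⟨nA, h, Multiset.disjoint_left.2 fun {x} hx => hd x hx⟩
    · intro k hk
      rw [allLegs_cons, mem_add] at hk
      rcases hk with hk | hk
      · exact fun h => sA k hk (Finset.mem_union_left _ h)
      · exact hS k hk

end Linear

variable {n : ℕ}

instance {m : ℕ} : Nonempty (Name m n) := ⟨.int 0⟩

/-- Every net arises by renaming from one in which all legs have internal names of their own; these
are the wires between the nodes and the hubs in a full realization. -/
lemma exists_exploded (F : Net 0 n) :
    ∃ (K : Net 0 n) (ℓ : Name 0 n → Name 0 n), K.map (Node.rename ℓ) = F ∧ (allLegs K).Nodup ∧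
      ∀ x ∈ allLegs K, ∃ k, x = .int k := by
  obtain ⟨C, ℓ, rfl, h, -⟩ := exists_linear F ∅
  refine ⟨C.map (Node.rename Name.int), fun | .int k => ℓ k | x => x, ?_, ?_, ?_⟩
  · rw [map_rename_rename]
    rfl
  · rw [allLegs_map_rename]
    exact h.map int_injective
  · intro x hx
    rw [allLegs_map_rename] at hx
    obtain ⟨k, -, rfl⟩ := mem_map.1 hx
    exact ⟨k, rfl⟩

lemma out_mem_hubLabels (F : Net 0 n) (j : Fin n) : .out j ∈ hubLabels F := by
  simp [hubLabels]

lemma mem_hubLabels {F : Net 0 n} {x : Name 0 n} (h : x ∈ allLegs F) : x ∈ hubLabels F := by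
  simp only [hubLabels, Finset.mem_union, mem_toFinset]
  exact Or.inl h

lemma isSkeleton_of_exploded {K : Net 0 n} {ℓ : Name 0 n → Name 0 n} {V : Finset (Name 0 n)}
    (arity : ∀ a ∈ K.map (Node.rename ℓ), a.ArityOK) (nodup : (allLegs K).Nodup)
    (int : ∀ x ∈ allLegs K, ∃ k, x = .int k) (hV : hubLabels (K.map (Node.rename ℓ)) ⊆ V) :
    IsSkeleton K ℓ V :=
  .of_full (fun a ha => by simpa using arity _ (mem_map_of_mem _ ha)) nodup int
    (fun x hx => hV (mem_hubLabels (by rw [allLegs_map_rename]; exact mem_map_of_mem _ hx)))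
    fun j => hV (out_mem_hubLabels _ j)

/-- Renaming the internal names of a net injectively does not change what it stands for. -/
lemma sim_rename (F : Net 0 n) {f : ℕ → ℕ} (hf : Set.InjOn f (intNames (allLegs F))) :
    Sim F (F.map (Node.rename (Name.mapInt f))) := by
  refine .of_arity (by simp) fun har => ?_
  obtain ⟨K, ℓ, rfl, nd, int⟩ := exists_exploded F
  set F := K.map (Node.rename ℓ) with hF
  have inj : Set.InjOn (Name.mapInt f) (hubLabels F : Set (Name 0 n)) := by
    have hi : ∀ k, (.int k : Name 0 n) ∈ hubLabels F → k ∈ (intNames (allLegs F) : Set ℕ) := by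
      intro k hk
      simp only [hubLabels, Finset.mem_union, mem_toFinset] at hk
      simpa using hk
    intro x hx y hy hxy
    rcases x with i | i | k <;> rcases y with i' | i' | k' <;> try exact i.elim0
    all_goals first | exact i'.elim0 | skip
    · exact hxy
    · cases hxy
    · cases hxy
    · simp only [mapInt_int, Name.int.injEq] at hxy
      rw [hf (hi k hx) (hi k' hy) hxy]
  have hsub : hubLabels (K.map (Node.rename (Name.mapInt f ∘ ℓ))) ⊆
      (hubLabels F).image (Name.mapInt f) := by
    intro x hx
    simp only [hubLabels, Finset.mem_union, mem_toFinset, allLegs_map_rename] at hx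
    rcases hx with hx | hx
    · obtain ⟨y, hy, rfl⟩ := mem_map.1 hx
      refine Finset.mem_image_of_mem _ (mem_hubLabels ?_)
      rw [hF, allLegs_map_rename]
      exact mem_map_of_mem _ hy
    · obtain ⟨j, -, rfl⟩ := Finset.mem_image.1 hx
      exact Finset.mem_image.2 ⟨.out j, out_mem_hubLabels _ j, rfl⟩
  have s1 : IsSkeleton K ℓ (hubLabels F) := isSkeleton_of_exploded har nd int subset_rfl
  have s2 : IsSkeleton K (Name.mapInt f ∘ ℓ) ((hubLabels F).image (Name.mapInt f)) :=
    isSkeleton_of_exploded (by rw [← map_rename_rename]; simpa [hF] using har) nd int hsub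
  have he : withHubs K ℓ (hubLabels F) =
      withHubs K (Name.mapInt f ∘ ℓ) ((hubLabels F).image (Name.mapInt f)) := by
    rw [withHubs, withHubs, Finset.image_val_of_injOn inj, Multiset.map_map]
    congr 1
    refine Multiset.map_congr rfl fun v hv => ?_
    simp only [hub, Function.comp]
    congr 2
    · cases v <;> rfl
    · refine filter_congr fun x hx => ⟨fun h => by rw [h], fun h => inj ?_ hv h⟩
      exact mem_hubLabels (by rw [hF, allLegs_map_rename]; exact mem_map_of_mem _ hx)
  refine Realizes.sim ⟨K, ℓ, _, s1, rfl, rfl⟩ ⟨K, _, _, s2, ?_, rfl⟩ (he ▸ Equal.refl _)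
  rw [hF, map_rename_rename]

/-- Identifying the internal name `k` with `a`. -/
noncomputable def Name.subst (k : ℕ) (a : Name 0 n) : Name 0 n → Name 0 n :=
  Function.update id (.int k) a

@[simp] lemma subst_self (k : ℕ) (a : Name 0 n) : Name.subst k a (.int k) = a := by
  simp [Name.subst]
lemma subst_of_ne {k : ℕ} (a : Name 0 n) {x : Name 0 n} (h : x ≠ .int k) :
    Name.subst k a x = x := by
  simp [Name.subst, Function.update_of_ne h]
@[simp] lemma subst_out (k : ℕ) (a : Name 0 n) (j : Fin n) :
    Name.subst k a (.out j) = .out j := subst_of_ne a (by simp)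
lemma subst_id (k : ℕ) (x : Name 0 n) : Name.subst k (.int k) x = x := by
  by_cases h : x = .int k
  · simp [h]
  · exact subst_of_ne _ h

lemma exploded_spider {K C : Net 0 n} {ℓ : Name 0 n → Name 0 n} {c : Colour} {p : Phase}
    {A : Multiset (Name 0 n)} (h : K.map (Node.rename ℓ) = spider c p A ::ₘ C) :
    ∃ A' K', A'.map ℓ = A ∧ K'.map (Node.rename ℓ) = C ∧ K = spider c p A' ::ₘ K' := by
  obtain ⟨⟨ka, A'⟩, hb, hab, hC⟩ := (map_eq_cons _ _ _ _).2 h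
  simp only [Node.rename, spider, Node.mk.injEq] at hab
  refine ⟨A', K.erase ⟨ka, A'⟩, hab.2, hC, ?_⟩
  rw [spider, ← hab.1, cons_erase hb]

/-- A one-legged green spider without a phase contributes nothing to the hub it is attached to. -/
lemma sim_green_zero (a : Name 0 n) (C : Net 0 n) : Sim (spider .green 0 {a} ::ₘ C) C := by
  refine .of_arity (by simp) fun har => ?_
  obtain ⟨K, ℓ, hK, nd, int⟩ := exists_exploded (spider .green 0 {a} ::ₘ C)
  obtain ⟨A, K', hA, rfl, rfl⟩ := exploded_spider hK
  obtain ⟨x, rfl, rfl⟩ := map_eq_singleton.1 hA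
  set F := spider .green 0 {ℓ x} ::ₘ K'.map (Node.rename ℓ) with hF
  have hsub : hubLabels (K'.map (Node.rename ℓ)) ⊆ hubLabels F := by
    intro y hy
    simp only [hF, hubLabels, Finset.mem_union, mem_toFinset, allLegs_cons, mem_add] at hy ⊢
    tauto
  have s1 : IsSkeleton (spider .green 0 {x} ::ₘ K') ℓ (hubLabels F) :=
    isSkeleton_of_exploded (hK ▸ har) nd int (hK ▸ subset_rfl)
  have s2 : IsSkeleton K' ℓ (hubLabels F) := by
    rw [allLegs_cons] at nd int
    exact isSkeleton_of_exploded (fun a ha => har a (by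
        simp [hF]; exact Or.inr (by simpa using ha)))
      (nodup_add.1 nd).2.1 (fun y hy => int y (by simp [hy])) hsub
  refine Realizes.sim ⟨_, _, _, s1, hK, rfl⟩ ⟨_, _, _, s2, rfl, rfl⟩ ?_
  have hx : ℓ x ∈ hubLabels F := mem_hubLabels (by simp [hF])
  have h1 : ∀ v, v ≠ ℓ x → hub (spider .green 0 {x} ::ₘ K') ℓ v = hub K' ℓ v := by
    intro v hv
    simp only [hub, allLegs_cons, spider_legs, singleton_add]
    rw [filter_cons_of_neg (p := fun y => ℓ y = v) _ (Ne.symm hv)]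
  have h2 : hub (spider .green 0 {x} ::ₘ K') ℓ (ℓ x) =
      spider .green 0 (x ::ₘ (outLeg (ℓ x) + (allLegs K').filter fun y => ℓ y = ℓ x)) := by
    simp only [hub, allLegs_cons, spider_legs, singleton_add]
    rw [filter_cons_of_pos (p := fun y => ℓ y = ℓ x) _ rfl, add_cons]
  have h3 : (hubLabels F).val = ℓ x ::ₘ ((hubLabels F).erase (ℓ x)).val := by
    rw [Finset.erase_val, cons_erase hx]
  have h4 : withHubs (spider .green 0 {x} ::ₘ K') ℓ (hubLabels F) =
      spider .green 0 (x ::ₘ 0) ::ₘ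
        spider .green 0 (x ::ₘ (outLeg (ℓ x) + (allLegs K').filter fun y => ℓ y = ℓ x)) ::ₘ
        (K' + ((hubLabels F).erase (ℓ x)).val.map (hub K' ℓ)) := by
    rw [withHubs, h3, map_cons, h2, Multiset.map_congr rfl fun v hv =>
      h1 v (Finset.ne_of_mem_erase hv)]
    simp only [add_cons, cons_add, cons_zero]
    rw [cons_swap]
  have h5 : withHubs K' ℓ (hubLabels F) =
      spider .green 0 (outLeg (ℓ x) + (allLegs K').filter fun y => ℓ y = ℓ x) ::ₘ
        (K' + ((hubLabels F).erase (ℓ x)).val.map (hub K' ℓ)) := by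
    rw [withHubs, h3, map_cons, hub]
    simp
  have := equal_fuse (h4 ▸ s1.isDiagram)
  rw [← h4] at this
  simpa [h5] using this.1

/-- A green spider joins its legs in the same way as a hub does, so that the names of two of its
legs can be identified. -/
lemma sim_merge (p : Phase) (a : Name 0 n) (k : ℕ) (A : Multiset (Name 0 n)) (C : Net 0 n) :
    Sim (spider .green p (a ::ₘ .int k ::ₘ A) ::ₘ C)
      ((spider .green p (a ::ₘ A) ::ₘ C).map (Node.rename (Name.subst k a))) := by
  refine .of_arity (by simp) fun har => ?_
  obtain ⟨K, ℓ, hK, nd, int⟩ := exists_exploded (spider .green p (a ::ₘ .int k ::ₘ A) ::ₘ C)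
  obtain ⟨A', K', hA, rfl, rfl⟩ := exploded_spider hK
  obtain ⟨x, hx, rfl, hB⟩ := (map_eq_cons _ _ _ _).2 hA
  obtain ⟨B, rfl⟩ := exists_cons_of_mem hx
  rw [erase_cons_head] at hB
  obtain ⟨y, hy, hyk, hZ⟩ := (map_eq_cons _ _ _ _).2 hB
  obtain ⟨Z, rfl⟩ := exists_cons_of_mem hy
  rw [erase_cons_head] at hZ
  subst hZ
  set F := spider .green p (ℓ x ::ₘ .int k ::ₘ Z.map ℓ) ::ₘ K'.map (Node.rename ℓ) with hF
  set T := Z + allLegs K' with hT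
  have s1 : IsSkeleton (spider .green p (x ::ₘ y ::ₘ Z) ::ₘ K') ℓ (hubLabels F) :=
    isSkeleton_of_exploded (hK ▸ har) nd int (hK ▸ subset_rfl)
  have hxF : ℓ x ∈ hubLabels F := mem_hubLabels (by simp [hF])
  have hyF : ℓ y ∈ hubLabels F := mem_hubLabels (by simp [hF, hyk])
  have legs2 : allLegs (spider .green p (x ::ₘ Z) ::ₘ K') = x ::ₘ T := by simp [hT]
  have legs1 : allLegs (spider .green p (x ::ₘ y ::ₘ Z) ::ₘ K') = x ::ₘ y ::ₘ T := by simp [hT]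
  rw [legs1] at nd int
  have nd2 : (x ::ₘ T).Nodup := by
    refine nodup_of_le ?_ nd
    rw [cons_le_cons_iff]
    exact le_cons_self _ _
  have int2 : ∀ z ∈ x ::ₘ T, ∃ k, z = .int k := fun z hz => int z (by
    rw [mem_cons] at hz ⊢
    rw [mem_cons]
    tauto)
  set ℓ' := Name.subst k (ℓ x) ∘ ℓ with hℓ'
  have hR : (spider .green p (x ::ₘ Z) ::ₘ K').map (Node.rename ℓ') =
      (spider .green p (ℓ x ::ₘ Z.map ℓ) ::ₘ K'.map (Node.rename ℓ)).map
        (Node.rename (Name.subst k (ℓ x))) := by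
    rw [map_cons, map_cons, map_rename_rename]
    simp [hℓ', Multiset.map_map]
  have ar2 : ∀ b ∈ (spider .green p (x ::ₘ Z) ::ₘ K').map (Node.rename ℓ'), b.ArityOK := by
    intro b hb
    rw [hR] at hb
    obtain ⟨b, hb', rfl⟩ := mem_map.1 hb
    rw [arityOK_rename]
    rcases mem_cons.1 hb' with rfl | hb'
    · trivial
    · exact har _ (mem_cons_of_mem hb')
  have hub1 : ∀ v, hub (spider .green p (x ::ₘ y ::ₘ Z) ::ₘ K') ℓ v =
      spider .green 0 (outLeg v + (x ::ₘ y ::ₘ T).filter fun z => ℓ z = v) := fun v => by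
    rw [hub, legs1]
  have hub2 : ∀ v, hub (spider .green p (x ::ₘ Z) ::ₘ K') ℓ' v =
      spider .green 0 (outLeg v + (x ::ₘ T).filter fun z => ℓ' z = v) := fun v => by
    rw [hub, legs2]
  have hxV : (hubLabels F).val = ℓ x ::ₘ ((hubLabels F).erase (ℓ x)).val := by
    rw [Finset.erase_val, cons_erase hxF]
  by_cases hab : ℓ x = .int k
  · -- Both legs are attached to the same hub: fusing it makes one of them a loop.
    have hℓℓ : ℓ' = ℓ := by
      funext z
      simp [hℓ', hab, subst_id]
    have s2 : IsSkeleton (spider .green p (x ::ₘ Z) ::ₘ K') ℓ' (hubLabels F) := by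
      refine isSkeleton_of_exploded ar2 (legs2 ▸ nd2) (legs2 ▸ int2) ?_
      intro z hz
      rw [hR, hab] at hz
      rw [map_rename_id fun z _ => subst_id k z] at hz
      simp only [hab, hF, hubLabels, Finset.mem_union, mem_toFinset,
        allLegs_cons, spider_legs, mem_cons, mem_add] at hz ⊢
      tauto
    refine Realizes.sim ⟨_, _, _, s1, hK, rfl⟩ ⟨_, _, _, s2, hR, rfl⟩ ?_
    have hother : ∀ v ∈ (hubLabels F).erase (ℓ x),
        hub (spider .green p (x ::ₘ y ::ₘ Z) ::ₘ K') ℓ v =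
          hub (spider .green p (x ::ₘ Z) ::ₘ K') ℓ' v := by
      intro v hv
      have hv1 : ℓ x ≠ v := (Finset.ne_of_mem_erase hv).symm
      have hv2 : ℓ y ≠ v := by rw [hyk, ← hab]; exact hv1
      rw [hub1, hub2, hℓℓ, filter_cons_of_neg (p := fun z => ℓ z = v) _ hv1,
        filter_cons_of_neg (p := fun z => ℓ z = v) _ hv2,
        filter_cons_of_neg (p := fun z => ℓ z = v) _ hv1]
    set R := K' + ((hubLabels F).erase (ℓ x)).val.map
      (hub (spider .green p (x ::ₘ Z) ::ₘ K') ℓ') with hRR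
    set P := outLeg (ℓ x) + T.filter fun z => ℓ z = ℓ x with hP
    have e1 : withHubs (spider .green p (x ::ₘ y ::ₘ Z) ::ₘ K') ℓ (hubLabels F) =
        spider .green p (x ::ₘ y ::ₘ Z) ::ₘ spider .green 0 (x ::ₘ y ::ₘ P) ::ₘ R := by
      rw [withHubs, hxV, map_cons, Multiset.map_congr rfl hother, hub1,
        filter_cons_of_pos (p := fun z => ℓ z = ℓ x) _ rfl,
        filter_cons_of_pos (p := fun z => ℓ z = ℓ x) _ (hyk.trans hab.symm), hRR, hP]
      simp only [cons_add, add_cons]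
      rw [cons_swap]
    have e2 : withHubs (spider .green p (x ::ₘ Z) ::ₘ K') ℓ' (hubLabels F) =
        spider .green p (x ::ₘ Z) ::ₘ spider .green 0 (x ::ₘ P) ::ₘ R := by
      rw [withHubs, hxV, map_cons, hub2, hℓℓ,
        filter_cons_of_pos (p := fun z => ℓ z = ℓ x) _ rfl, hRR, hP, hℓℓ]
      simp only [cons_add, add_cons]
      rw [cons_swap]
    obtain ⟨f1, d1⟩ := equal_fuse (e1 ▸ s1.isDiagram)
    rw [cons_add, add_cons] at f1 d1
    obtain ⟨f2, -⟩ := equal_loop d1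
    obtain ⟨f3, -⟩ := equal_fuse (e2 ▸ s2.isDiagram)
    rw [e1, e2]
    exact (f1.trans f2).trans f3.symm
  · -- The spider is fused with both hubs.
    have hyx : ℓ x ≠ ℓ y := by rwa [hyk]
    have s2 : IsSkeleton (spider .green p (x ::ₘ Z) ::ₘ K') ℓ' ((hubLabels F).erase (ℓ y)) := by
      refine isSkeleton_of_exploded ar2 (legs2 ▸ nd2) (legs2 ▸ int2) ?_
      intro z hz
      rw [Finset.mem_erase, hyk]
      simp only [hubLabels, allLegs_map_rename, legs2, Finset.mem_union, mem_toFinset] at hz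
      rcases hz with hz | hz
      · obtain ⟨w, hw, rfl⟩ := mem_map.1 hz
        simp only [hℓ', Function.comp]
        by_cases hwk : ℓ w = .int k
        · rw [hwk, subst_self]
          exact ⟨hab, hxF⟩
        · rw [subst_of_ne _ hwk]
          refine ⟨hwk, mem_hubLabels ?_⟩
          simp only [hF, allLegs_cons, spider_legs, allLegs_map_rename, mem_add, mem_cons]
          rw [mem_cons, hT, mem_add] at hw
          rcases hw with rfl | hw | hw
          · simp
          · exact Or.inl (Or.inr (Or.inr (mem_map_of_mem _ hw)))
          · exact Or.inr (mem_map_of_mem _ hw)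
      · obtain ⟨j, -, rfl⟩ := Finset.mem_image.1 hz
        exact ⟨by simp, out_mem_hubLabels _ j⟩
    refine Realizes.sim ⟨_, _, _, s1, hK, rfl⟩ ⟨_, _, _, s2, hR, rfl⟩ ?_
    set V₀ := ((hubLabels F).erase (ℓ y)).erase (ℓ x) with hV₀
    have hV1 : ((hubLabels F).erase (ℓ y)).val = ℓ x ::ₘ V₀.val := by
      rw [hV₀, Finset.erase_val (_ : Finset _) (ℓ x), cons_erase]
      exact Finset.mem_erase.2 ⟨hyx, hxF⟩
    have hV2 : (hubLabels F).val = ℓ x ::ₘ ℓ y ::ₘ V₀.val := by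
      rw [cons_swap, ← hV1, Finset.erase_val, cons_erase hyF]
    have hother : ∀ v ∈ V₀,
        hub (spider .green p (x ::ₘ y ::ₘ Z) ::ₘ K') ℓ v =
          hub (spider .green p (x ::ₘ Z) ::ₘ K') ℓ' v := by
      intro v hv
      have hv1 : ℓ x ≠ v := (Finset.ne_of_mem_erase hv).symm
      have hv2 : ℓ y ≠ v := (Finset.ne_of_mem_erase (Finset.mem_of_mem_erase hv)).symm
      have hx' : ℓ' x = ℓ x := subst_of_ne _ hab
      rw [hub1, hub2, filter_cons_of_neg (p := fun z => ℓ z = v) _ hv1,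
        filter_cons_of_neg (p := fun z => ℓ z = v) _ hv2,
        filter_cons_of_neg (p := fun z => ℓ' z = v) _ (by rwa [hx'])]
      congr 2
      refine filter_congr fun z _ => ?_
      simp only [hℓ', Function.comp]
      by_cases hz : ℓ z = .int k
      · rw [hz, subst_self, ← hyk]
        simp [hv1, hv2]
      · rw [subst_of_ne _ hz]
    set R := K' + V₀.val.map (hub (spider .green p (x ::ₘ Z) ::ₘ K') ℓ') with hRR
    set P := outLeg (ℓ x) + T.filter fun z => ℓ z = ℓ x with hP
    set Q := T.filter fun z => ℓ z = ℓ y with hQ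
    have e1 : withHubs (spider .green p (x ::ₘ y ::ₘ Z) ::ₘ K') ℓ (hubLabels F) =
        spider .green p (x ::ₘ y ::ₘ Z) ::ₘ spider .green 0 (x ::ₘ P) ::ₘ
          spider .green 0 (y ::ₘ Q) ::ₘ R := by
      rw [withHubs, hV2, map_cons, map_cons, Multiset.map_congr rfl hother, hub1, hub1,
        filter_cons_of_pos (p := fun z => ℓ z = ℓ x) _ rfl,
        filter_cons_of_neg (p := fun z => ℓ z = ℓ x) _ (Ne.symm hyx),
        filter_cons_of_neg (p := fun z => ℓ z = ℓ y) _ hyx,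
        filter_cons_of_pos (p := fun z => ℓ z = ℓ y) _ rfl, hRR, hP, hQ]
      have : outLeg (ℓ y) = 0 := by rw [hyk]; rfl
      simp only [this, cons_add, add_cons, zero_add]
      rw [cons_swap (spider .green p _), cons_swap (spider .green p _)]
    have hPQ : (T.filter fun z => ℓ' z = ℓ x) = (T.filter fun z => ℓ z = ℓ x) + Q := by
      rw [hQ, ← filter_add_not (fun z => ℓ z = ℓ x) (T.filter fun z => ℓ' z = ℓ x),
        filter_filter, filter_filter]
      congr 1
      · refine filter_congr fun z _ => ⟨fun h => h.1, fun h => ⟨h, ?_⟩⟩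
        simp only [hℓ', Function.comp, h, subst_of_ne _ hab]
      · refine filter_congr fun z _ => ?_
        simp only [hℓ', Function.comp]
        by_cases hz : ℓ z = .int k
        · rw [hz, subst_self, ← hyk]
          simp [Ne.symm hyx]
        · rw [subst_of_ne _ hz, hyk]
          simp [hz]
    have e2 : withHubs (spider .green p (x ::ₘ Z) ::ₘ K') ℓ' ((hubLabels F).erase (ℓ y)) =
        spider .green p (x ::ₘ Z) ::ₘ spider .green 0 (x ::ₘ (P + Q)) ::ₘ R := by
      rw [withHubs, hV1, map_cons, hub2,
        filter_cons_of_pos (p := fun z => ℓ' z = ℓ x) _ (subst_of_ne _ hab), hRR, hP, hPQ]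
      simp only [cons_add, add_cons, add_assoc]
      rw [cons_swap]
    obtain ⟨f1, d1⟩ := equal_fuse (e1 ▸ s1.isDiagram)
    rw [cons_add] at f1 d1
    obtain ⟨f2, -⟩ := equal_fuse d1
    obtain ⟨f3, -⟩ := equal_fuse (e2 ▸ s2.isDiagram)
    rw [e1, e2]
    simp only [add_zero, add_assoc] at f1 f2 f3 ⊢
    exact (f1.trans f2).trans f3.symm

end

/-! ### Applying a rule to a net -/

section

variable {n : ℕ}

/-- A skeleton in which the wires in `I` are joined directly, while those in `Y` lead to hubs. -/
lemma isSkeleton_of_parts {K : Net 0 n} {ℓ : Name 0 n → Name 0 n} {V : Finset (Name 0 n)}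
    {Y I : Multiset (Name 0 n)} (arity : ∀ a ∈ K, a.ArityOK) (legs : allLegs K = Y + (I + I))
    (nY : Y.Nodup) (intY : ∀ x ∈ Y, ∃ k, x = .int k) (hubY : ∀ x ∈ Y, ℓ x ∈ V)
    (nI : I.Nodup) (freeI : ∀ x ∈ I, ℓ x = x ∧ x ∉ V)
    (out : ∀ j, .out j ∈ V) : IsSkeleton K ℓ V := by
  have hI : ∀ x, ℓ x ∈ V → x ∉ I := fun x hx hxI => (freeI x hxI).2 ((freeI x hxI).1 ▸ hx)
  have hY : ∀ x, ℓ x ∉ V → x ∉ Y := fun x hx hxY => hx (hubY x hxY)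
  refine ⟨arity, fun x hx hxV => ?_, fun x hxV => ?_, fun x hx hxV => ?_, fun k hk hkV => ?_,
    fun j hj => absurd (out j) hj⟩
  · rw [legs, mem_add, mem_add] at hx
    have := hI x hxV
    exact intY x (by tauto)
  · rw [legs, count_add, count_add, count_eq_zero.2 (hI x hxV)]
    exact nodup_iff_count_le_one.1 nY x
  · rw [legs, mem_add, mem_add] at hx
    have := hY x hxV
    exact (freeI x (by tauto)).1
  · have := hY _ hkV
    rw [legs, mem_add, mem_add] at hk
    rw [legs, count_add, count_add, count_eq_zero.2 this, count_eq_one_of_mem nI (by tauto)]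

/-- A rule can be applied inside a net. The names in `X` are those of the outer wires of the rule,
`I` and `J` are the inner wires of its left and its right side; the rule is used for the names
given by `ℓ`, where the outer names need not be distinct, while the inner ones are fresh. -/
theorem sim_rule {L R : Multiset (Node ℕ)}
    (h : ∀ θ : ℕ → Name 0 n, Rule (L.map (Node.rename θ)) (R.map (Node.rename θ)))
    (aL : ∀ a ∈ L, a.ArityOK) (aR : ∀ a ∈ R, a.ArityOK) (X I J : Multiset ℕ)
    (hL : allLegs L = X + (I + I)) (hR : allLegs R = X + (J + J))
    (nX : X.Nodup) (ℓ : ℕ → Name 0 n) (C : Net 0 n)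
    (hI : ∀ i ∈ I, (∃ k, ℓ i = .int k) ∧ ℓ i ∉ X.map ℓ ∧ ℓ i ∉ allLegs C) (hI' : (I.map ℓ).Nodup)
    (hJ : ∀ i ∈ J, (∃ k, ℓ i = .int k) ∧ ℓ i ∉ X.map ℓ ∧ ℓ i ∉ allLegs C)
    (hJ' : (J.map ℓ).Nodup) :
    Sim (L.map (Node.rename ℓ) + C) (R.map (Node.rename ℓ) + C) := by
  have hLR : ∀ a : Multiset (Node ℕ), (∀ b ∈ a, b.ArityOK) →
      ∀ b ∈ a.map (Node.rename ℓ), b.ArityOK := fun a ha b hb => by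
    obtain ⟨c, hc, rfl⟩ := mem_map.1 hb
    simpa using ha c hc
  refine .of_arity ⟨fun h a ha => ?_, fun h a ha => ?_⟩ fun har => ?_
  · rcases mem_add.1 ha with ha | ha
    exacts [hLR R aR a ha, h a (mem_add.2 (.inr ha))]
  · rcases mem_add.1 ha with ha | ha
    exacts [hLR L aL a ha, h a (mem_add.2 (.inr ha))]
  -- In the realizations, the outer wire `i` is named `i + N`, which differs from the inner wires,
  -- and the wires of `C` avoid both; `lab` gives back the names of the net.
  set used := intNames (I.map ℓ + J.map ℓ) with hused
  obtain ⟨N, hN⟩ : ∃ N, ∀ k ∈ used, k < N :=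
    ⟨used.sup id + 1, fun k hk => Nat.lt_succ_of_le (Finset.le_sup (f := id) hk)⟩
  obtain ⟨C', ℓC, hC, nC, sC⟩ := exists_linear C (used ∪ (X.map (· + N)).toFinset)
  set θ : ℕ → Name 0 n := fun i => if i ∈ X then .int (i + N) else ℓ i with hθ
  set lab : Name 0 n → Name 0 n := fun x => match x with
    | .int k => if k ∈ allLegs C' then ℓC k else if k < N then .int k else ℓ (k - N)
    | x => x with hlab
  set V : Finset (Name 0 n) :=
    (X.map ℓ + allLegs C).toFinset ∪ Finset.univ.image Name.out with hV
  have labC : ∀ k ∈ allLegs C', lab (.int k) = ℓC k := fun k hk => by simp only [hlab, if_pos hk]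
  have labX : ∀ i ∈ X, lab (θ i) = ℓ i := fun i hi => by
    have h1 : i + N ∉ allLegs C' := fun h => sC _ h (by
      rw [Finset.mem_union, mem_toFinset]
      exact Or.inr (mem_map_of_mem (· + N) hi))
    simp only [hθ, if_pos hi, hlab, if_neg h1]
    simp
  have labI : ∀ i ∈ I + J, i ∉ X ∧ lab (ℓ i) = ℓ i ∧ ℓ i ∉ V ∧ ∃ k, ℓ i = .int k := by
    intro i hi
    obtain ⟨⟨k, hk⟩, h1, h2⟩ : (∃ k, ℓ i = .int k) ∧ ℓ i ∉ X.map ℓ ∧ ℓ i ∉ allLegs C := by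
      rcases mem_add.1 hi with hi | hi
      exacts [hI i hi, hJ i hi]
    have hku : k ∈ used := by
      rw [hused, mem_intNames, ← hk, ← Multiset.map_add]
      exact mem_map_of_mem _ hi
    refine ⟨fun h => h1 (mem_map_of_mem _ h), ?_, ?_, k, hk⟩
    · have h3 : k ∉ allLegs C' := fun h => sC _ h (Finset.mem_union_left _ hku)
      simp only [hk, hlab, if_neg h3, if_pos (hN k hku)]
    · simp only [hV, Finset.mem_union, mem_toFinset, mem_add, not_or]
      exact ⟨⟨h1, h2⟩, by simp [hk]⟩
  have θI : ∀ i ∈ I + J, θ i = ℓ i := fun i hi => by simp only [hθ, if_neg (labI i hi).1]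
  set Y : Multiset (Name 0 n) := X.map θ + (allLegs C').map Name.int with hY
  have θX : ∀ i ∈ X, θ i = .int (i + N) := fun i hi => by simp only [hθ, if_pos hi]
  have nY : Y.Nodup := by
    refine nodup_add.2 ⟨?_, nC.map int_injective, Multiset.disjoint_left.2 fun {x} hx hx' => ?_⟩
    · rw [Multiset.map_congr rfl θX]
      exact nX.map fun a b hab => by simpa using hab
    · obtain ⟨i, hi, rfl⟩ := mem_map.1 hx
      obtain ⟨k, hk, hki⟩ := mem_map.1 hx'
      rw [θX i hi] at hki
      cases hki
      exact sC _ hk (by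
        rw [Finset.mem_union, mem_toFinset]
        exact Or.inr (mem_map_of_mem (· + N) hi))
  have intY : ∀ x ∈ Y, ∃ k, x = .int k := by
    intro x hx
    rcases mem_add.1 hx with hx | hx
    · obtain ⟨i, hi, rfl⟩ := mem_map.1 hx
      exact ⟨_, θX i hi⟩
    · obtain ⟨k, -, rfl⟩ := mem_map.1 hx
      exact ⟨k, rfl⟩
  have hubY : ∀ x ∈ Y, lab x ∈ V := by
    intro x hx
    simp only [hV, Finset.mem_union, mem_toFinset, mem_add]
    rcases mem_add.1 hx with hx | hx
    · obtain ⟨i, hi, rfl⟩ := mem_map.1 hx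
      rw [labX i hi]
      exact Or.inl (Or.inl (mem_map_of_mem _ hi))
    · obtain ⟨k, hk, rfl⟩ := mem_map.1 hx
      rw [labC k hk, ← hC, allLegs_map_rename]
      exact Or.inl (Or.inr (mem_map_of_mem _ hk))
  have outV : ∀ j, .out j ∈ V := fun j => by simp [hV]
  set K := C'.map (Node.rename (Name.int (m := 0) (n := n))) with hK
  -- With either side of the rule inserted, the hubs are the same, since the outer wires are.
  have side : ∀ (S : Multiset (Node ℕ)) (I₁ : Multiset ℕ), (∀ a ∈ S, a.ArityOK) →
      allLegs S = X + (I₁ + I₁) → (∀ i ∈ I₁, i ∈ I + J) → (I₁.map ℓ).Nodup →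
      IsSkeleton (S.map (Node.rename θ) + K) lab V ∧
      (S.map (Node.rename θ) + K).map (Node.rename lab) = S.map (Node.rename ℓ) + C ∧
      ∀ v ∈ V, hub (S.map (Node.rename θ) + K) lab v =
        spider .green 0 (outLeg v + Y.filter fun x => lab x = v) := by
    intro S I₁ aS hS hIJ nI₁
    have hmap : I₁.map θ = I₁.map ℓ := Multiset.map_congr rfl fun i hi => θI i (hIJ i hi)
    have hlegs : allLegs (S.map (Node.rename θ) + K) = Y + (I₁.map ℓ + I₁.map ℓ) := by
      rw [allLegs_add, hK, allLegs_map_rename, allLegs_map_rename, hS, Multiset.map_add,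
        Multiset.map_add, hmap, hY]
      abel
    have free : ∀ x ∈ I₁.map ℓ, lab x = x ∧ x ∉ V := fun x hx => by
      obtain ⟨i, hi, rfl⟩ := mem_map.1 hx
      exact ⟨(labI i (hIJ i hi)).2.1, (labI i (hIJ i hi)).2.2.1⟩
    refine ⟨isSkeleton_of_parts (fun a ha => ?_) hlegs nY intY hubY nI₁ free outV, ?_, ?_⟩
    · rcases mem_add.1 ha with ha | ha
      · obtain ⟨b, hb, rfl⟩ := mem_map.1 ha
        simpa using aS b hb
      · obtain ⟨b, hb, rfl⟩ := mem_map.1 ha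
        have := har (b.rename ℓC) (mem_add.2 (.inr (hC ▸ mem_map_of_mem _ hb)))
        simpa using this
    · rw [Multiset.map_add, map_rename_rename, hK, map_rename_rename, ← hC]
      congr 1
      · refine map_rename_congr fun i hi => ?_
        rw [hS, mem_add, mem_add, or_self] at hi
        rcases hi with hi | hi
        · exact labX i hi
        · rw [Function.comp, θI i (hIJ i hi), (labI i (hIJ i hi)).2.1]
      · exact map_rename_congr labC
    · intro v hv
      have hnil : ((I₁.map ℓ + I₁.map ℓ).filter fun x => lab x = v) = 0 := by
        refine filter_eq_nil.2 fun x hx hxv => ?_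
        rw [mem_add, or_self] at hx
        rw [(free x hx).1] at hxv
        exact (free x hx).2 (hxv ▸ hv)
      rw [hub, hlegs, filter_add, hnil, add_zero]
  obtain ⟨sL, mL, hubL⟩ := side L I aL hL (fun i hi => mem_add.2 (.inl hi)) hI'
  obtain ⟨sR, mR, hubR⟩ := side R J aR hR (fun i hi => mem_add.2 (.inr hi)) hJ'
  refine Realizes.sim ⟨_, _, _, sL, mL, rfl⟩ ⟨_, _, _, sR, mR, rfl⟩ ?_
  have eL := sL.isDiagram
  have eR := sR.isDiagram
  rw [withHubs, Multiset.map_congr rfl hubL, add_assoc] at eL ⊢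
  rw [withHubs, Multiset.map_congr rfl hubR, add_assoc] at eR ⊢
  exact (Step.rule (h θ) _ eL eR).equal

end

/-! ### The rules as similarities -/

section

section PairLegs

variable {α W W' : Type}

lemma allLegs_map_pair (s : Multiset α) (f : α → Node W) (g h : α → W)
    (hf : ∀ a, (f a).legs = {g a, h a}) : allLegs (s.map f) = s.map g + s.map h := by
  induction s using Multiset.induction_on with
  | empty => simp
  | cons a s ih =>
    simp only [map_cons, allLegs_cons, ih, hf, insert_eq_cons]
    simp only [← singleton_add]
    abel

@[simp] lemma allLegs_map_had (s : Multiset α) (g h : α → W) :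
    allLegs (s.map fun a => had (g a) (h a)) = s.map g + s.map h :=
  allLegs_map_pair _ _ _ _ fun _ => rfl

@[simp] lemma allLegs_map_spider_pair (s : Multiset α) (c : Colour) (p : Phase) (g h : α → W) :
    allLegs (s.map fun a => spider c p {g a, h a}) = s.map g + s.map h :=
  allLegs_map_pair _ _ _ _ fun _ => rfl

end PairLegs

variable {n : ℕ}

@[simp] lemma other_green : Colour.green.other = .red := rfl
@[simp] lemma other_red : Colour.red.other = .green := rfl

/-- The name `k` on the left-hand side occurs nowhere else, so that it stands for a wire. This is
also assumed of the inner wires in the versions below of the other rules. -/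
lemma sim_fuse (c : Colour) (p q : Phase) (k : ℕ) (A B : Multiset (Name 0 n)) (C : Net 0 n)
    (hA : .int k ∉ A) (hB : .int k ∉ B) (hC : .int k ∉ allLegs C) :
    Sim (spider c p (.int k ::ₘ A) ::ₘ spider c q (.int k ::ₘ B) ::ₘ C)
      (spider c (p + q) (A + B) ::ₘ C) := by
  obtain ⟨K, ℓ, hK, nd, h0⟩ := exists_linear ({spider c p A, spider c q B} : Net 0 n) {0}
  obtain ⟨⟨ka, A'⟩, hb, hab, hK'⟩ := (map_eq_cons _ _ _ _).2 hK
  obtain ⟨K, rfl⟩ := exists_cons_of_mem hb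
  rw [erase_cons_head] at hK'
  obtain ⟨⟨kb, B'⟩, hK'', hB⟩ := map_eq_singleton.1 hK'
  subst hK''
  have hA' : A'.map ℓ = A := congrArg Node.legs hab
  have hB' : B'.map ℓ = B := congrArg Node.legs hB
  subst hA' hB'
  simp only [allLegs_cons, allLegs_singleton, mem_add, Finset.mem_singleton] at nd h0
  have h0A : 0 ∉ A' := fun h => h0 0 (.inl h) rfl
  have h0B : 0 ∉ B' := fun h => h0 0 (.inr h) rfl
  set ℓ' := Function.update ℓ 0 (.int k) with hℓ'
  have eA : A'.map ℓ' = A'.map ℓ := Multiset.map_congr rfl fun x hx =>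
    Function.update_of_ne (fun h : x = 0 => h0A (h ▸ hx)) _ _
  have eB : B'.map ℓ' = B'.map ℓ := Multiset.map_congr rfl fun x hx =>
    Function.update_of_ne (fun h : x = 0 => h0B (h ▸ hx)) _ _
  have := sim_rule (L := {spider c p (0 ::ₘ A'), spider c q (0 ::ₘ B')})
    (R := {spider c (p + q) (A' + B')}) (fun θ => by
      simpa using Rule.fuse c p q (θ 0) (A'.map θ) (B'.map θ)) (by simp) (by simp)
    (A' + B') {0} 0 (by
      simp only [allLegs_cons, allLegs_singleton, insert_eq_cons, spider_legs]
      simp only [← singleton_add]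
      abel) (by simp) (by simpa using nd)
    ℓ' C (by simp only [mem_singleton, forall_eq]
             refine ⟨⟨k, by simp [hℓ']⟩, ?_, by simpa [hℓ'] using hC⟩
             rw [Multiset.map_add, eA, eB]
             simp only [hℓ', Function.update_self, mem_add]
             tauto) (by simp) (by simp) (by simp)
  simp only [map_singleton, rename_spider, map_cons, eA, eB, Multiset.map_add, insert_eq_cons,
    show ℓ' 0 = .int k from Function.update_self ..] at this
  simpa using this

lemma sim_loop (c : Colour) (p : Phase) (k : ℕ) (A : Multiset (Name 0 n)) (C : Net 0 n)
    (hA : .int k ∉ A) (hC : .int k ∉ allLegs C) :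
    Sim (spider c p (.int k ::ₘ .int k ::ₘ A) ::ₘ C) (spider c p A ::ₘ C) := by
  obtain ⟨A', ℓ, rfl, nd, h0⟩ := exists_nodup_map_eq A {0}
  have h0A : 0 ∉ A' := fun h => h0 0 h (by simp)
  set ℓ' := Function.update ℓ 0 (.int k) with hℓ'
  have eA : A'.map ℓ' = A'.map ℓ := Multiset.map_congr rfl fun x hx =>
    Function.update_of_ne (fun h : x = 0 => h0A (h ▸ hx)) _ _
  have := sim_rule (L := {spider c p (0 ::ₘ 0 ::ₘ A')}) (R := {spider c p A'}) (fun θ => by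
      simpa using Rule.loop c p (θ 0) (A'.map θ)) (by simp) (by simp)
    A' {0} 0 (by simp only [allLegs_singleton, spider_legs, ← singleton_add]; abel) (by simp) nd
    ℓ' C (by simp only [mem_singleton, forall_eq]
             refine ⟨⟨k, by simp [hℓ']⟩, ?_, by simpa [hℓ'] using hC⟩
             rw [eA]
             simpa only [hℓ', Function.update_self] using hA) (by simp) (by simp) (by simp)
  simp only [map_singleton, rename_spider, map_cons, eA,
    show ℓ' 0 = .int k from Function.update_self ..] at this
  simpa using this

lemma sim_identity (c : Colour) (a b : Name 0 n) (C : Net 0 n) :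
    Sim (spider c 0 {a, b} ::ₘ C) (wire a b ::ₘ C) := by
  have := sim_rule (L := {spider c 0 {0, 1}}) (R := {wire 0 1}) (fun θ => by
      simpa using Rule.identity c (θ 0) (θ 1)) (by simp) (by simp)
    {0, 1} 0 0 (by simp) (by simp) (by simp)
    (fun | 0 => a | _ => b) C (by simp) (by simp) (by simp) (by simp)
  simpa using this

lemma sim_copy (c : Colour) (k : ℕ) (a b : Name 0 n) (C : Net 0 n) (ha : a ≠ .int k)
    (hb : b ≠ .int k) (hC : .int k ∉ allLegs C) :
    Sim (spider c.other 0 {.int k} ::ₘ spider c 0 {.int k, a, b} ::ₘ C)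
      (spider c.other 0 {a} ::ₘ spider c.other 0 {b} ::ₘ C) := by
  have := sim_rule (L := {spider c.other 0 {0}, spider c 0 {0, 1, 2}})
    (R := {spider c.other 0 {1}, spider c.other 0 {2}}) (fun θ => by
      simpa using Rule.copy c (θ 0) (θ 1) (θ 2)) (by simp) (by simp)
    {1, 2} {0} 0
    (by simp only [allLegs_cons, allLegs_singleton, insert_eq_cons, spider_legs]; decide)
    (by simp only [allLegs_cons, allLegs_singleton, insert_eq_cons, spider_legs]; decide)
    (by decide)
    (fun | 0 => .int k | 1 => a | _ => b) C (by simp [ha.symm, hb.symm, hC]) (by simp) (by simp)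
    (by simp)
  simpa using this

lemma sim_comm11 (c : Colour) (x y : ZMod 2) (k k' : ℕ) (a b : Name 0 n) (C : Net 0 n)
    (ha : a ≠ .int k) (hb : b ≠ .int k) (hC : .int k ∉ allLegs C) (ha' : a ≠ .int k')
    (hb' : b ≠ .int k') (hC' : .int k' ∉ allLegs C) :
    Sim (spider c.other (1, 1) {a, .int k} ::ₘ spider c (x, y) {.int k, b} ::ₘ C)
      (spider c (y, x) {a, .int k'} ::ₘ spider c.other (1, 1) {.int k', b} ::ₘ C) := by
  have := sim_rule (L := {spider c.other (1, 1) {0, 2}, spider c (x, y) {2, 1}})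
    (R := {spider c (y, x) {0, 3}, spider c.other (1, 1) {3, 1}}) (fun θ => by
      simpa using Rule.comm11 c x y (θ 0) (θ 1) (θ 2) (θ 3)) (by simp) (by simp)
    {0, 1} {2} {3}
    (by simp only [allLegs_cons, allLegs_singleton, insert_eq_cons, spider_legs]; decide)
    (by simp only [allLegs_cons, allLegs_singleton, insert_eq_cons, spider_legs]; decide)
    (by decide)
    (fun | 0 => a | 1 => b | 2 => .int k | _ => .int k') C (by simp [ha.symm, hb.symm, hC])
    (by simp) (by simp [ha'.symm, hb'.symm, hC']) (by simp)
  simpa using this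

lemma sim_euler (c : Colour) (k k' : ℕ) (hk : k ≠ k') (a b : Name 0 n) (C : Net 0 n)
    (ha : a ≠ .int k) (hb : b ≠ .int k) (hC : .int k ∉ allLegs C) (ha' : a ≠ .int k')
    (hb' : b ≠ .int k') (hC' : .int k' ∉ allLegs C) :
    Sim (had a b ::ₘ C)
      (spider c (0, 1) {a, .int k} ::ₘ spider c.other (0, 1) {.int k, .int k'} ::ₘ
        spider c (0, 1) {.int k', b} ::ₘ C) := by
  have := sim_rule (L := {had 0 1})
    (R := {spider c (0, 1) {0, 2}, spider c.other (0, 1) {2, 3}, spider c (0, 1) {3, 1}})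
    (fun θ => by simpa using Rule.euler c (θ 0) (θ 1) (θ 2) (θ 3)) (by simp) (by simp)
    {0, 1} 0 {2, 3} (by simp only [allLegs_singleton, insert_eq_cons, had_legs]; decide)
    (by simp only [allLegs_cons, allLegs_singleton, insert_eq_cons, spider_legs]; decide)
    (by decide)
    (fun | 0 => a | 1 => b | 2 => .int k | _ => .int k') C (by simp) (by simp)
    (by simp [ha.symm, hb.symm, hC, ha'.symm, hb'.symm, hC']) (by simp [hk])
  simpa using this

/-- A red spider without legs can be dropped unless its phase is `11`. -/
lemma sim_scalar_empty (p : Phase) (hp : p ≠ (1, 1)) (C : Net 0 n) :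
    Sim (spider .red p 0 ::ₘ C) C := by
  have := sim_rule (L := {spider .red p 0}) (R := 0) (n := n) (fun θ => by
      refine Rule.scalar _ (fun w => by simp) ⟨fun _ => 0, ?_⟩
      obtain ⟨x, y⟩ := p
      have : ∃ c : ZMod 2, Phase.bit (x, y) c = 0 := by
        revert x y; decide
      obtain ⟨c, hc⟩ := this
      simpa [Node.Holds, spider] using ⟨c, hc.symm⟩) (by simp) (by simp)
    0 0 0 (by simp) (by simp) (by simp) (fun _ => .int 0) C (by simp) (by simp) (by simp)
    (by simp)
  simpa using this

lemma sim_scalar_pair (p q : Phase) (h : ∃ s : Ontic, s.1 = p.bit s.2 ∧ s.2 = q.bit s.1) (k : ℕ)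
    (C : Net 0 n) (hC : .int k ∉ allLegs C) :
    Sim (spider .red p {.int k} ::ₘ spider .green q {.int k} ::ₘ C) C := by
  have := sim_rule (L := {spider .red p {0}, spider .green q {0}}) (R := 0) (n := n) (fun θ => by
      obtain ⟨s, h1, h2⟩ := h
      refine Rule.scalar _ (fun w => ?_) ⟨fun _ => s, ?_⟩
      · by_cases hw : w = θ 0 <;> simp [hw]
      · simpa [Node.Holds, spider] using ⟨h1, h2⟩) (by simp) (by simp)
    0 {0} 0 (by simp) (by simp) (by simp) (fun _ => .int k) C (by simp [hC]) (by simp)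
    (by simp) (by simp)
  simpa using this

lemma sim_copy11 (c : Colour) (i : Name 0 n) (k : ℕ) (outs : Multiset (Name 0 n × Name 0 n))
    (C : Net 0 n) (hi : i ≠ .int k) (hk : .int k ∉ outs.map Prod.fst) (hC : .int k ∉ allLegs C)
    (nd : (outs.map Prod.snd).Nodup)
    (h : ∀ x ∈ outs.map Prod.snd, (∃ m, x = .int m) ∧ x ≠ i ∧ x ∉ outs.map Prod.fst ∧
      x ∉ allLegs C) :
    Sim (spider c.other (1, 1) {i, .int k} ::ₘ spider c 0 (.int k ::ₘ outs.map Prod.fst) ::ₘ C)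
      (spider c 0 (i ::ₘ outs.map Prod.snd) ::ₘ
        (outs.map fun o => spider c.other (1, 1) {o.2, o.1}) + C) := by
  obtain ⟨E, f, rfl, nE, h0⟩ := exists_nodup_map_eq outs {0}
  have h0 : 0 ∉ E := fun h => h0 0 h (by simp)
  simp only [Multiset.map_map, Function.comp_def] at hk nd h ⊢
  set ℓ : ℕ → Name 0 n := fun m => if m = 0 then i else if m = 1 then .int k else
    if m % 2 = 0 then (f (m / 2)).1 else (f (m / 2)).2 with hℓ
  have l0 : ℓ 0 = i := by simp [hℓ]
  have l1 : ℓ 1 = .int k := by simp [hℓ]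
  have le : ∀ m ∈ E, ℓ (2 * m) = (f m).1 := fun m hm => by
    have : m ≠ 0 := fun h => h0 (h ▸ hm)
    simp only [hℓ]
    rw [if_neg (by omega), if_neg (by omega), if_pos (by omega),
      Nat.mul_div_cancel_left _ (by simp)]
  have lo : ∀ m ∈ E, ℓ (2 * m + 1) = (f m).2 := fun m hm => by
    have : m ≠ 0 := fun h => h0 (h ▸ hm)
    simp only [hℓ]
    rw [if_neg (by omega), if_neg (by omega), if_neg (by omega),
      show (2 * m + 1) / 2 = m by omega]
  have me : E.map (fun m => ℓ (2 * m)) = E.map fun m => (f m).1 := Multiset.map_congr rfl le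
  have mo : E.map (fun m => ℓ (2 * m + 1)) = E.map fun m => (f m).2 := Multiset.map_congr rfl lo
  have key := sim_rule (n := n)
    (L := {spider c.other (1, 1) {0, 1}, spider c 0 (1 ::ₘ E.map (2 * ·))})
    (R := spider c 0 (0 ::ₘ E.map (2 * · + 1)) ::ₘ
      E.map fun m => spider c.other (1, 1) {2 * m + 1, 2 * m}) (fun θ => by
      simpa [Multiset.map_map, Function.comp_def] using
        Rule.copy11 c (θ 0) (θ 1) (E.map fun m => (θ (2 * m), θ (2 * m + 1))))
    (by simp) (by simp) (0 ::ₘ E.map (2 * ·)) {1} (E.map (2 * · + 1))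
    (by
      simp only [allLegs_cons, allLegs_singleton, insert_eq_cons, spider_legs]
      simp only [← singleton_add]
      abel)
    (by
      simp only [allLegs_cons, allLegs_map_spider_pair, spider_legs]
      simp only [← singleton_add]
      abel)
    (by
      rw [nodup_cons]
      exact ⟨by simpa using h0, nE.map fun a b h => by simpa using h⟩)
    ℓ C
    (by
      simp only [mem_singleton, forall_eq, l1, map_cons, l0, Multiset.map_map, Function.comp_def,
        me, mem_cons, not_or]
      exact ⟨⟨k, rfl⟩, ⟨hi.symm, hk⟩, hC⟩)
    (by simp)
    (by
      intro x hx
      obtain ⟨m, hm, rfl⟩ := mem_map.1 hx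
      simp only [map_cons, l0, Multiset.map_map, Function.comp_def, me, lo m hm, mem_cons, not_or]
      have := h (f m).2 (mem_map.2 ⟨m, hm, rfl⟩)
      tauto)
    (by simpa only [Multiset.map_map, Function.comp_def, mo] using nd)
  simp only [insert_eq_cons, map_cons, map_singleton, rename_spider, l0, l1, Multiset.map_map,
    Function.comp_def, me, mo] at key
  have hm : (E.map fun m => spider c.other (1, 1) (ℓ (2 * m + 1) ::ₘ {ℓ (2 * m)})) =
      E.map fun m => spider c.other (1, 1) {(f m).2, (f m).1} :=
    Multiset.map_congr rfl fun m hm => by rw [le m hm, lo m hm]; rfl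
  rw [hm] at key
  simpa using key

lemma sim_colourChange (c : Colour) (p : Phase) (ends : Multiset (Name 0 n × Name 0 n))
    (C : Net 0 n) (nd : (ends.map Prod.snd).Nodup)
    (h : ∀ x ∈ ends.map Prod.snd, (∃ m, x = .int m) ∧ x ∉ ends.map Prod.fst ∧ x ∉ allLegs C) :
    Sim (spider c p (ends.map Prod.snd) ::ₘ (ends.map fun o => had o.2 o.1) + C)
      (spider c.other p (ends.map Prod.fst) ::ₘ C) := by
  obtain ⟨E, f, rfl, nE, -⟩ := exists_nodup_map_eq ends ∅
  simp only [Multiset.map_map, Function.comp_def] at nd h ⊢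
  set ℓ : ℕ → Name 0 n := fun m =>
    if m % 2 = 0 then (f (m / 2)).1 else (f (m / 2)).2 with hℓ
  have le : ∀ m ∈ E, ℓ (2 * m) = (f m).1 := fun m hm => by
    simp only [hℓ]
    rw [if_pos (by omega), Nat.mul_div_cancel_left _ (by simp)]
  have lo : ∀ m ∈ E, ℓ (2 * m + 1) = (f m).2 := fun m hm => by
    simp only [hℓ]
    rw [if_neg (by omega), show (2 * m + 1) / 2 = m by omega]
  have me : E.map (fun m => ℓ (2 * m)) = E.map fun m => (f m).1 := Multiset.map_congr rfl le
  have mo : E.map (fun m => ℓ (2 * m + 1)) = E.map fun m => (f m).2 := Multiset.map_congr rfl lo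
  have key := sim_rule (n := n)
    (L := spider c p (E.map (2 * · + 1)) ::ₘ E.map fun m => had (2 * m + 1) (2 * m))
    (R := {spider c.other p (E.map (2 * ·))}) (fun θ => by
      simpa [Multiset.map_map, Function.comp_def] using
        Rule.colourChange c p (E.map fun m => (θ (2 * m), θ (2 * m + 1))))
    (by simp) (by simp) (E.map (2 * ·)) (E.map (2 * · + 1)) 0
    (by simp only [allLegs_cons, allLegs_map_had, spider_legs]; abel) (by simp)
    (nE.map fun a b h => by simpa using h)
    ℓ C
    (by
      intro x hx
      obtain ⟨m, hm, rfl⟩ := mem_map.1 hx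
      simp only [Multiset.map_map, Function.comp_def, me, lo m hm]
      exact h (f m).2 (mem_map.2 ⟨m, hm, rfl⟩))
    (by simpa only [Multiset.map_map, Function.comp_def, mo] using nd)
    (by simp) (by simp)
  simp only [map_cons, map_singleton, rename_spider, Multiset.map_map,
    Function.comp_def, rename_had, me, mo] at key
  have hm : (E.map fun m => had (ℓ (2 * m + 1)) (ℓ (2 * m))) = E.map fun m => had (f m).2 (f m).1 :=
    Multiset.map_congr rfl fun m hm => by rw [le m hm, lo m hm]
  rw [hm] at key
  simpa using key

end

/-! ### Wires, phases and the colour change for nets -/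

section

variable {n : ℕ}

lemma cons_pair {α : Type} (a b : α) : a ::ₘ {b} = b ::ₘ ({a} : Multiset α) := pair_comm a b

lemma exists_fresh_seq (s : Multiset (Name 0 n)) :
    ∃ e : ℕ → ℕ, Function.Injective e ∧ ∀ i, .int (e i) ∉ s := by
  refine ⟨fun i => (intNames s).sup id + 1 + i, fun i j h => by simpa using h, fun i h => ?_⟩
  have := Finset.le_sup (f := id) (mem_intNames.2 h)
  simp only [id] at this
  omega

lemma subst_target (k : ℕ) (a : Name 0 n) : Name.subst k a a = a := by
  by_cases h : a = .int k
  · rw [h, subst_self]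
  · exact subst_of_ne _ h

lemma map_subst_of_notMem {k : ℕ} (a : Name 0 n) {A : Multiset (Name 0 n)} (h : .int k ∉ A) :
    A.map (Name.subst k a) = A :=
  (Multiset.map_congr rfl fun _ hx => subst_of_ne a fun he => h (he ▸ hx)).trans
    (Multiset.map_id' A)

lemma map_rename_subst_of_notMem {k : ℕ} (a : Name 0 n) {C : Net 0 n}
    (h : .int k ∉ allLegs C) : C.map (Node.rename (Name.subst k a)) = C :=
  map_rename_id fun _ hx => subst_of_ne a fun he => h (he ▸ hx)

lemma Sim.of_eq {F G : Net 0 n} (h : F = G) : Sim F G := h ▸ Sim.refl F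

/-- A bare wire identifies the names of its ends. -/
lemma sim_wire (a : Name 0 n) (k : ℕ) (C : Net 0 n) :
    Sim (wire a (.int k) ::ₘ C) (C.map (Node.rename (Name.subst k a))) := by
  refine (sim_identity .green a (.int k) C).symm.trans ?_
  refine (sim_merge 0 a k 0 C).trans ?_
  rw [map_cons, cons_zero, rename_spider, map_singleton, subst_target]
  exact sim_green_zero _ _

lemma sim_phase_add (p q : Phase) (a : Name 0 n) (C : Net 0 n) :
    Sim (spider .green p {a} ::ₘ spider .green q {a} ::ₘ C) (spider .green (p + q) {a} ::ₘ C) := by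
  obtain ⟨k, hk⟩ := exists_fresh (a ::ₘ allLegs C)
  rw [mem_cons, not_or] at hk
  have h1 := sim_fuse .green p q k {a} 0 C (by simpa using hk.1) (by simp) hk.2
  have h2 := sim_merge p a k 0 (spider .green q {.int k} ::ₘ C)
  rw [map_cons, map_cons, map_rename_subst_of_notMem a hk.2] at h2
  simp only [rename_spider, cons_zero, map_singleton, subst_target, subst_self, add_zero] at h1 h2
  rw [cons_pair] at h1
  exact h2.symm.trans h1

/-- A leg of a green spider that is attached to nothing else can be removed. -/
lemma sim_green_drop (p : Phase) (a : Name 0 n) (k : ℕ) (A : Multiset (Name 0 n)) (C : Net 0 n)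
    (hA : .int k ∉ A) (hC : .int k ∉ allLegs C) :
    Sim (spider .green p (a ::ₘ .int k ::ₘ A) ::ₘ C) (spider .green p (a ::ₘ A) ::ₘ C) := by
  refine (sim_merge p a k A C).trans (.of_eq ?_)
  rw [map_cons, map_rename_subst_of_notMem a hC, rename_spider, map_cons, subst_target,
    map_subst_of_notMem a hA]

/-- Fresh names for the inner wires of the rules with arbitrarily many legs, where the outer wires
are named by `A`. -/
lemma exists_fresh_ends (A s : Multiset (Name 0 n)) :
    ∃ ends : Multiset (Name 0 n × Name 0 n), ends.map Prod.fst = A ∧ (ends.map Prod.snd).Nodup ∧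
      ∀ x ∈ ends.map Prod.snd, (∃ m, x = .int m) ∧ x ∉ s := by
  obtain ⟨A', ℓ, rfl, nd, h⟩ := exists_nodup_map_eq A (intNames s)
  refine ⟨A'.map fun i => (ℓ i, .int i), by simp [Multiset.map_map],
    by simpa [Multiset.map_map] using nd.map int_injective, fun x hx => ?_⟩
  simp only [Multiset.map_map, Function.comp_def] at hx
  obtain ⟨i, hi, rfl⟩ := mem_map.1 hx
  exact ⟨⟨i, rfl⟩, fun hs => h i hi (mem_intNames.2 hs)⟩

/-- The legs of a green spider are named alike, after which they need not be written down. -/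
lemma sim_merge_ends (p : Phase) (k : ℕ) (ends : Multiset (Name 0 n × Name 0 n)) (C : Net 0 n)
    (nd : (ends.map Prod.snd).Nodup)
    (h : ∀ x ∈ ends.map Prod.snd, (∃ m, x = .int m) ∧ x ≠ .int k ∧ x ∉ ends.map Prod.fst ∧
      x ∉ allLegs C) :
    Sim (spider .green p (.int k ::ₘ ends.map Prod.snd) ::ₘ (ends.map fun o => had o.2 o.1) + C)
      (spider .green p {.int k} ::ₘ (ends.map Prod.fst).map (had (.int k)) + C) := by
  induction ends using Multiset.induction_on generalizing C with
  | empty => simpa using Sim.refl _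
  | cons o ends ih =>
    obtain ⟨a, b⟩ := o
    simp only [map_cons, nodup_cons] at nd
    simp only [map_cons, mem_cons, forall_eq_or_imp, not_or] at h
    obtain ⟨⟨⟨m, rfl⟩, hbk, ⟨hba, hbf⟩, hbC⟩, h⟩ := h
    have key := sim_merge p (.int k) m (ends.map Prod.snd)
      (had (.int m) a ::ₘ ((ends.map fun o => had o.2 o.1) + C))
    rw [map_cons, map_cons, rename_spider, map_cons, subst_target,
      map_subst_of_notMem _ nd.1, rename_had, subst_self, subst_of_ne _ (Ne.symm hba),
      map_rename_subst_of_notMem] at key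
    · have e1 : ((a, Name.int m) ::ₘ ends).map (fun o => had o.2 o.1) =
        had (.int m) a ::ₘ ends.map (fun o => had o.2 o.1) := by simp
      rw [e1]
      simp only [map_cons, cons_add]
      refine key.trans ?_
      have := ih (had (.int k) a ::ₘ C) nd.2 fun x hx => by
        obtain ⟨h1, h2, ⟨h3, h4⟩, h5⟩ := h x hx
        refine ⟨h1, h2, h4, ?_⟩
        simp [h2, h3, h5]
      rw [add_cons, add_cons] at this
      simpa [cons_swap (had (Name.int k) a)] using this
    · rw [allLegs_add, allLegs_map_had, mem_add, mem_add]
      tauto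

lemma sim_green_leaf (p : Phase) (k : ℕ) (C : Net 0 n) (hC : .int k ∉ allLegs C) :
    Sim (spider .green p {.int k} ::ₘ C) (spider .green p 0 ::ₘ C) := by
  have h := sim_fuse .green p 0 k 0 0 C (by simp) (by simp) hC
  simp only [cons_zero, add_zero] at h
  refine .trans ?_ h
  rw [cons_swap]
  exact (sim_green_zero _ _).symm

/-- A red spider is a phased hub with a colour-changing node on every leg. -/
lemma sim_red (p : Phase) (k : ℕ) (A : Multiset (Name 0 n)) (C : Net 0 n) (hA : .int k ∉ A)
    (hC : .int k ∉ allLegs C) :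
    Sim (spider .red p A ::ₘ C)
      (spider .green p {.int k} ::ₘ A.map (had (.int k)) + C) := by
  obtain ⟨ends, rfl, nd, h⟩ := exists_fresh_ends A (.int k ::ₘ (A + allLegs C))
  have hc := sim_colourChange .green p ends C nd fun x hx => by
    have := h x hx
    simp only [mem_cons, mem_add, not_or] at this
    tauto
  refine hc.symm.trans ?_
  have hm := sim_merge_ends p k ends C nd fun x hx => by
    have := h x hx
    simp only [mem_cons, mem_add, not_or] at this
    tauto
  refine .trans ?_ hm
  rcases ends.empty_or_exists_mem with rfl | ⟨o, ho⟩
  · simpa using (sim_green_leaf p k C hC).symm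
  · obtain ⟨E, rfl⟩ := exists_cons_of_mem ho
    have hk : ∀ x ∈ (o ::ₘ E).map Prod.snd, x ≠ .int k := fun x hx he =>
      (h x hx).2 (by simp [he])
    have := sim_green_drop p o.2 k (E.map Prod.snd) (((o ::ₘ E).map fun o => had o.2 o.1) + C)
      (fun h => hk _ (by rw [map_cons]; exact mem_cons_of_mem h) rfl) (by
        rw [allLegs_add, allLegs_map_had, mem_add, mem_add]
        rintro ((h | h) | h)
        · exact hk _ h rfl
        · exact hA h
        · exact hC h)
    rw [map_cons Prod.snd, cons_swap (Name.int k), cons_add, cons_add]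
    exact this.symm

lemma sim_had_had (k : ℕ) (a b : Name 0 n) (C : Net 0 n) (ha : a ≠ .int k) (hb : b ≠ .int k)
    (hC : .int k ∉ allLegs C) : Sim (had (.int k) a ::ₘ had (.int k) b ::ₘ C) (wire a b ::ₘ C) := by
  refine .trans ?_ (sim_identity .red a b C)
  refine .trans ?_ (sim_red 0 k {a, b} C (by simp [ha.symm, hb.symm]) hC).symm
  simpa using (sim_green_zero (.int k) _).symm

lemma had_comm {W : Type} (a b : W) : had a b = had b a := by
  simp only [had, pair_comm]

/-- A red spider with a leg attached to nothing else can be removed. -/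
lemma sim_red_drop (p : Phase) (k : ℕ) (A : Multiset (Name 0 n)) (C : Net 0 n) (hA : .int k ∉ A)
    (hC : .int k ∉ allLegs C) : Sim (spider .red p (.int k ::ₘ A) ::ₘ C) C := by
  induction A using Multiset.induction_on generalizing k with
  | empty =>
    refine .trans ?_ (sim_scalar_pair p 0 ⟨(p.1, 0), by simp [Phase.bit]⟩ k C hC)
    rw [cons_swap]
    exact (sim_green_zero _ _).symm
  | cons a A ih =>
    rw [mem_cons, not_or] at hA
    obtain ⟨m, hm⟩ := exists_fresh (.int k ::ₘ a ::ₘ A + allLegs C)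
    simp only [cons_add, mem_cons, mem_add, not_or] at hm
    have h1 := sim_fuse .red 0 p m {.int k, a} A C (by simp; tauto) (by tauto) (by tauto)
    rw [zero_add, insert_eq_cons, cons_add, singleton_add] at h1
    refine h1.symm.trans ?_
    have h2 := sim_copy .red k (.int m) a (spider .red p (.int m ::ₘ A) ::ₘ C)
      (by simpa using hm.1) (Ne.symm hA.1) (by
        simp only [allLegs_cons, spider_legs, mem_add, mem_cons]
        have := hm.1
        have := hA.2
        tauto)
    have h3 := ih m hm.2.2.1 hm.2.2.2
    refine .trans (sim_green_zero (.int k) _).symm ?_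
    rw [cons_swap (Name.int m)]
    refine h2.trans ?_
    exact (sim_green_zero _ _).trans ((sim_green_zero _ _).trans h3)

end

/-! ### The bialgebra rule for nets -/

section

variable {n : ℕ}

lemma sim_red_unfuse (p q : Phase) (k : ℕ) (a : Name 0 n) (A : Multiset (Name 0 n)) (C : Net 0 n)
    (ha : a ≠ .int k) (hA : .int k ∉ A) (hC : .int k ∉ allLegs C) :
    Sim (spider .red (p + q) (a ::ₘ A) ::ₘ C)
      (spider .red p {a, .int k} ::ₘ spider .red q (.int k ::ₘ A) ::ₘ C) := by
  have h := sim_fuse .red p q k {a} A C (by simpa using ha.symm) hA hC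
  rw [singleton_add, cons_pair] at h
  exact h.symm

/-- A phase-free green node with three legs identifies their names. -/
lemma sim_green_three (a : Name 0 n) {k k' : ℕ} (hk : k' ≠ k) (C : Net 0 n) :
    Sim (spider .green 0 {a, .int k, .int k'} ::ₘ C)
      ((C.map (Node.rename (Name.subst k a))).map (Node.rename (Name.subst k' a))) := by
  refine (sim_merge 0 a k {.int k'} C).trans ?_
  rw [map_cons, rename_spider, map_cons, map_singleton, subst_target,
    subst_of_ne a (by simpa using hk)]
  refine (sim_merge 0 a k' 0 _).trans ?_
  rw [map_cons, rename_spider, cons_zero, map_singleton, subst_target]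
  exact sim_green_zero _ _

/-- The bialgebra rule between names; the inner wires are named by the injective sequence `e`. -/
lemma sim_bialgebra (e : ℕ → ℕ) (he : Function.Injective e) (a b o o' : Name 0 n) (C : Net 0 n)
    (h : ∀ i, .int (e i) ∉ a ::ₘ b ::ₘ o ::ₘ o' ::ₘ allLegs C) :
    Sim (spider .green 0 {a, .int (e 0), .int (e 1)} ::ₘ
        spider .green 0 {b, .int (e 2), .int (e 3)} ::ₘ
        spider .red 0 {.int (e 0), .int (e 2), o} ::ₘ
        spider .red 0 {.int (e 1), .int (e 3), o'} ::ₘ C)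
      (spider .red 0 {a, b, .int (e 4)} ::ₘ spider .green 0 {.int (e 4), o, o'} ::ₘ C) := by
  simp only [mem_cons, not_or] at h
  have := sim_rule (L := {spider .green 0 {0, 4, 5}, spider .green 0 {1, 6, 7},
      spider .red 0 {4, 6, 2}, spider .red 0 {5, 7, 3}})
    (R := {spider .red 0 {0, 1, 8}, spider .green 0 {8, 2, 3}}) (fun θ => by
      simpa using Rule.bialgebra .green (θ 0) (θ 1) (θ 2) (θ 3) (θ 4) (θ 5) (θ 6) (θ 7) (θ 8))
    (by simp) (by simp) {0, 1, 2, 3} {4, 5, 6, 7} {8}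
    (by simp only [allLegs_cons, allLegs_singleton, insert_eq_cons, spider_legs]; decide)
    (by simp only [allLegs_cons, allLegs_singleton, insert_eq_cons, spider_legs]; decide)
    (by decide)
    (fun | 0 => a | 1 => b | 2 => o | 3 => o' | m + 4 => .int (e m)) C
    (by simp [h]) (by simp [he.eq_iff])
    (by simp [h]) (by simp)
  simpa using this

/-- Two red spiders with two legs in common force the names at their third legs to agree. This is
the bialgebra rule after the legs of each green node have been given the same name. -/
lemma sim_split_two (a b o : Name 0 n) (k : ℕ) (C : Net 0 n) (ha : a ≠ .int k) (hb : b ≠ .int k) :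
    Sim (spider .red 0 {o, a, b} ::ₘ spider .red 0 {.int k, a, b} ::ₘ C)
      (spider .red 0 {o, a, b} ::ₘ C.map (Node.rename (Name.subst k o))) := by
  obtain ⟨e, he, h⟩ := exists_fresh_seq (a ::ₘ b ::ₘ o ::ₘ .int k ::ₘ allLegs C)
  have hbi := sim_bialgebra e he a b o (.int k) C h
  simp only [mem_cons, not_or, Name.int.injEq] at h
  have sC : ∀ i x, C.map (Node.rename (Name.subst (e i) x)) = C := fun i x =>
    map_rename_subst_of_notMem x (h i).2.2.2.2
  have sa : ∀ i x, Name.subst (e i) x a = a := fun i x => subst_of_ne x (Ne.symm (h i).1)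
  have sb : ∀ i x, Name.subst (e i) x b = b := fun i x => subst_of_ne x (Ne.symm (h i).2.1)
  have so : ∀ i x, Name.subst (e i) x o = o := fun i x => subst_of_ne x (Ne.symm (h i).2.2.1)
  have sk : ∀ i (x : Name 0 n), Name.subst (e i) x (.int k) = .int k := fun i x =>
    subst_of_ne x (by simpa using Ne.symm (h i).2.2.2.1)
  have se : ∀ i j (x : Name 0 n), i ≠ j → Name.subst (e i) x (.int (e j)) = .int (e j) :=
    fun i j x hij => subst_of_ne x (by simpa [he.eq_iff] using Ne.symm hij)
  -- The left-hand side of the bialgebra rule.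
  have h1 := sim_green_three a (k := e 0) (k' := e 1) (by simp [he.eq_iff])
    (spider .green 0 {b, .int (e 2), .int (e 3)} ::ₘ spider .red 0 {.int (e 0), .int (e 2), o} ::ₘ
      spider .red 0 {.int (e 1), .int (e 3), .int k} ::ₘ C)
  have h2 := sim_green_three b (k := e 2) (k' := e 3) (by simp [he.eq_iff])
    (spider .red 0 {a, .int (e 2), o} ::ₘ spider .red 0 {a, .int (e 3), .int k} ::ₘ C)
  -- The right-hand side of the bialgebra rule.
  have h3 := sim_green_three o (k := e 4) (k' := k) (by simpa using Ne.symm (h 4).2.2.2.1)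
    (spider .red 0 {a, b, .int (e 4)} ::ₘ C)
  simp only [map_cons, rename_spider, insert_eq_cons, map_singleton, sC, sa, sb, so, sk,
    subst_self, se 0 1 _ (by decide), se 0 2 _ (by decide), se 0 3 _ (by decide),
    se 1 2 _ (by decide), se 1 3 _ (by decide), se 2 3 _ (by decide), subst_of_ne o ha,
    subst_of_ne o hb, subst_target] at h1 h2 h3 hbi ⊢
  have e1 : ∀ x : Name 0 n, (a ::ₘ b ::ₘ {x} : Multiset (Name 0 n)) = x ::ₘ a ::ₘ {b} := fun x => by
    rw [cons_pair b x, cons_swap]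
  rw [cons_swap (spider .red 0 _) (spider .green 0 _), cons_swap (Name.int (e 4)) o] at hbi
  simpa only [e1] using h2.symm.trans (h1.symm.trans (hbi.trans h3))

end

/-! ### Red spiders that share their legs -/

section

variable {n : ℕ}

/-- Two red phase shifts `11` from the same name force the names at their other ends to agree. This
is the 11-copy rule with two outputs. -/
lemma sim_split_eleven (y w : Name 0 n) (k : ℕ) (C : Net 0 n) (hy : y ≠ .int k) :
    Sim (spider .red (1, 1) {y, w} ::ₘ spider .red (1, 1) {y, .int k} ::ₘ C)
      (spider .red (1, 1) {y, w} ::ₘ C.map (Node.rename (Name.subst k w))) := by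
  obtain ⟨e, he, h⟩ := exists_fresh_seq (y ::ₘ w ::ₘ .int k ::ₘ allLegs C)
  simp only [mem_cons, not_or, Name.int.injEq] at h
  have sC : ∀ i x, C.map (Node.rename (Name.subst (e i) x)) = C := fun i x =>
    map_rename_subst_of_notMem x (h i).2.2.2
  have sy : ∀ i x, Name.subst (e i) x y = y := fun i x => subst_of_ne x (Ne.symm (h i).1)
  have sw : ∀ i x, Name.subst (e i) x w = w := fun i x => subst_of_ne x (Ne.symm (h i).2.1)
  have sk : ∀ i (x : Name 0 n), Name.subst (e i) x (.int k) = .int k := fun i x =>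
    subst_of_ne x (by simpa using Ne.symm (h i).2.2.1)
  have se : ∀ i j (x : Name 0 n), i ≠ j → Name.subst (e i) x (.int (e j)) = .int (e j) :=
    fun i j x hij => subst_of_ne x (by simpa [he.eq_iff] using Ne.symm hij)
  have hc := sim_copy11 .green y (e 0) {(w, .int (e 1)), (.int k, .int (e 2))} C (Ne.symm (h 0).1)
    (by simp [h]) (h 0).2.2.2 (by simp [he.eq_iff]) (by simp [h])
  have h1 := sim_green_three y (k := e 1) (k' := e 2) (by simp [he.eq_iff])
    (spider .red (1, 1) {.int (e 1), w} ::ₘ spider .red (1, 1) {.int (e 2), .int k} ::ₘ C)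
  have h2 := sim_green_three w (k := e 0) (k' := k) (by simpa using Ne.symm (h 0).2.2.1)
    (spider .red (1, 1) {y, .int (e 0)} ::ₘ C)
  simp only [map_cons, rename_spider, insert_eq_cons, map_singleton, sC, sy, sw, sk,
    subst_self, se 1 2 _ (by decide), subst_of_ne w hy, subst_target, other_green, cons_add,
    singleton_add] at h1 h2 hc ⊢
  rw [cons_swap (spider .red _ _) (spider .green _ _), cons_swap (Name.int (e 0)) w] at hc
  exact h1.symm.trans (hc.symm.trans h2)

/-- Two red spiders with phase `00` and the same legs but for one force the names at the remaining
legs to agree. Without common legs this is the copy rule, and the common legs are taken off one by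
one. -/
lemma sim_split_zero (w : Name 0 n) (k : ℕ) (A : Multiset (Name 0 n)) (C : Net 0 n)
    (hA : .int k ∉ A) :
    Sim (spider .red 0 (w ::ₘ A) ::ₘ spider .red 0 (.int k ::ₘ A) ::ₘ C)
      (spider .red 0 (w ::ₘ A) ::ₘ C.map (Node.rename (Name.subst k w))) := by
  induction A using Multiset.induction_on generalizing w k C with
  | empty =>
    obtain ⟨e, he⟩ := exists_fresh (w ::ₘ .int k ::ₘ allLegs C)
    simp only [mem_cons, not_or, Name.int.injEq] at he
    have h1 := sim_copy .green e w (.int k) C (Ne.symm he.1) (by simpa using Ne.symm he.2.1) he.2.2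
    have h2 := sim_green_three w (k := e) (k' := k) (Ne.symm he.2.1)
      (spider .red 0 {.int e} ::ₘ C)
    simp only [map_cons, rename_spider, map_singleton, map_rename_subst_of_notMem w he.2.2,
      subst_self, subst_target, other_green, insert_eq_cons] at h1 h2
    rw [cons_swap (spider .red _ _) (spider .green _ _), cons_swap (Name.int e) w] at h1
    simpa using h1.symm.trans h2
  | cons a A ih =>
    rw [mem_cons, not_or] at hA
    obtain ⟨e, he, h⟩ := exists_fresh_seq (w ::ₘ .int k ::ₘ a ::ₘ A + allLegs C)
    simp only [mem_cons, not_or, cons_add, mem_add, Name.int.injEq] at h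
    have h1 := sim_fuse .red 0 0 (e 0) {w, a} A (spider .red 0 (.int k ::ₘ a ::ₘ A) ::ₘ C)
      (by simp [h]) (by simp [h]) (by simp [h])
    have h2 := sim_fuse .red 0 0 (e 1) {.int k, a} A
      (spider .red 0 (.int (e 0) ::ₘ A) ::ₘ spider .red 0 (.int (e 0) ::ₘ {w, a}) ::ₘ C)
      (by simp [h]) (by simp [h]) (by simp [h, he.eq_iff])
    have h3 := ih (.int (e 0)) (e 1)
      (spider .red 0 {.int (e 0), w, a} ::ₘ spider .red 0 {.int (e 1), .int k, a} ::ₘ C)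
          (by simp [h])
    have h4 := sim_split_two a (.int (e 0)) w k (spider .red 0 (.int (e 0) ::ₘ A) ::ₘ C)
        (Ne.symm hA.1)
      (by simpa using (h 0).2.1)
    have h5 := sim_fuse .red 0 0 (e 0) {w, a} A (C.map (Node.rename (Name.subst k w)))
      (by simp [h]) (by simp [h]) (by
        simp only [allLegs_map_rename, mem_map, not_exists, not_and]
        intro x hx hs
        by_cases hxk : x = .int k
        · rw [hxk, subst_self] at hs
          exact (h 0).1 hs.symm
        · rw [subst_of_ne w hxk] at hs
          exact (h 0).2.2.2.2 (hs ▸ hx))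
    have hk0 : (Name.int (e 0) : Name 0 n) ≠ .int k := by simpa using (h 0).2.1
    have s1 : ∀ (x : Name 0 n), Name.subst (e 1) x w = w := fun x => subst_of_ne x (Ne.symm (h 1).1)
    have s2 : ∀ (x : Name 0 n), Name.subst (e 1) x a = a := fun x =>
        subst_of_ne x (Ne.symm (h 1).2.2.1)
    have s3 : ∀ (x : Name 0 n), Name.subst (e 1) x (.int k) = .int k := fun x =>
      subst_of_ne x (by simpa using Ne.symm (h 1).2.1)
    have s4 : ∀ (x : Name 0 n), Name.subst (e 1) x (.int (e 0)) = .int (e 0) := fun x =>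
      subst_of_ne x (by simp [he.eq_iff])
    simp only [map_cons, rename_spider, map_singleton, insert_eq_cons, cons_add, singleton_add, s1,
      s2, s3, s4, subst_self, add_zero, map_rename_subst_of_notMem _ (h 1).2.2.2.2,
      subst_of_ne w hk0, map_subst_of_notMem w hA.2] at h1 h2 h3 h4 h5
    refine h1.symm.trans (.trans (.of_eq ?_) (h2.symm.trans (.trans (.of_eq ?_) (h3.trans
      (.trans (.of_eq ?_) (h4.trans (.trans (.of_eq ?_) h5))))))) <;>
    simp only [← singleton_add] <;> ac_rfl

/-- The same for the phases `00` and `11`; read from right to left, it duplicates the linear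
equation that such a spider stands for. -/
lemma sim_split (x : ZMod 2) (w : Name 0 n) (k : ℕ) (A : Multiset (Name 0 n)) (C : Net 0 n)
    (hA : .int k ∉ A) :
    Sim (spider .red (x, x) (w ::ₘ A) ::ₘ spider .red (x, x) (.int k ::ₘ A) ::ₘ C)
      (spider .red (x, x) (w ::ₘ A) ::ₘ C.map (Node.rename (Name.subst k w))) := by
  have hx : x = 0 ∨ x = 1 := by revert x; decide
  rcases hx with rfl | rfl
  · exact sim_split_zero w k A C hA
  obtain ⟨e, he, h⟩ := exists_fresh_seq (w ::ₘ .int k ::ₘ A + allLegs C)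
  simp only [mem_cons, not_or, cons_add, mem_add, Name.int.injEq] at h
  have h1 := sim_fuse .red (1, 1) 0 (e 0) {w} A (spider .red (1, 1) (.int k ::ₘ A) ::ₘ C)
    (by simp [h]) (by simp [h]) (by simp [h])
  have h2 := sim_fuse .red (1, 1) 0 (e 1) {.int k} A
    (spider .red 0 (.int (e 0) ::ₘ A) ::ₘ spider .red (1, 1) (.int (e 0) ::ₘ {w}) ::ₘ C)
    (by simp [h]) (by simp [h]) (by simp [h, he.eq_iff])
  have h3 := sim_split_zero (.int (e 0)) (e 1) A
    (spider .red (1, 1) {.int (e 0), w} ::ₘ spider .red (1, 1) {.int (e 1), .int k} ::ₘ C)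
        (by simp [h])
  have h4 := sim_split_eleven (.int (e 0)) w k (spider .red 0 (.int (e 0) ::ₘ A) ::ₘ C)
    (by simpa using (h 0).2.1)
  have h5 := sim_fuse .red (1, 1) 0 (e 0) {w} A (C.map (Node.rename (Name.subst k w)))
    (by simp [h]) (by simp [h]) (by
      simp only [allLegs_map_rename, mem_map, not_exists, not_and]
      intro x hx hs
      by_cases hxk : x = .int k
      · rw [hxk, subst_self] at hs
        exact (h 0).1 hs.symm
      · rw [subst_of_ne w hxk] at hs
        exact (h 0).2.2.2 (hs ▸ hx))
  have hk0 : (Name.int (e 0) : Name 0 n) ≠ .int k := by simpa using (h 0).2.1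
  have s1 : ∀ (x : Name 0 n), Name.subst (e 1) x w = w := fun x => subst_of_ne x (Ne.symm (h 1).1)
  have s3 : ∀ (x : Name 0 n), Name.subst (e 1) x (.int k) = .int k := fun x =>
    subst_of_ne x (by simpa using Ne.symm (h 1).2.1)
  have s4 : ∀ (x : Name 0 n), Name.subst (e 1) x (.int (e 0)) = .int (e 0) := fun x =>
    subst_of_ne x (by simp [he.eq_iff])
  simp only [map_cons, rename_spider, map_singleton, insert_eq_cons, singleton_add, s1,
    s3, s4, subst_self, add_zero, map_rename_subst_of_notMem _ (h 1).2.2.2,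
    subst_of_ne w hk0, map_subst_of_notMem w hA] at h1 h2 h3 h4 h5
  refine h1.symm.trans (.trans (.of_eq ?_) (h2.symm.trans (.trans (.of_eq ?_) (h3.trans
    (.trans (.of_eq ?_) (h4.trans (.trans (.of_eq ?_) h5))))))) <;>
  simp only [← singleton_add] <;> ac_rfl

end

/-! ### Hopf rule, Euler decomposition and cancellation of edges -/

section

variable {n : ℕ}

lemma mem_or_mem_of_star {a x : Name 0 n} {A : Multiset (Name 0 n)}
    (h : x ∈ allLegs (A.map (had a))) : x = a ∨ x ∈ A := by
  obtain ⟨b, hb, hx⟩ := mem_allLegs.1 h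
  obtain ⟨c, hc, rfl⟩ := mem_map.1 hb
  simp only [had_legs, insert_eq_cons, mem_cons, mem_singleton] at hx
  exact hx.imp_right fun (h : x = c) => h ▸ hc

/-- Hopf rule: two legs of a red spider with the same name cancel. Each of them is split off
together with one end of an added loop. The two spiders obtained in this way have two legs in
common, so that the names of their third legs agree, and the rest of the original spider gets a loop
there. -/
lemma sim_hopf (p : Phase) (w : Name 0 n) (A : Multiset (Name 0 n)) (C : Net 0 n) :
    Sim (spider .red p (w ::ₘ w ::ₘ A) ::ₘ C) (spider .red p A ::ₘ C) := by
  have three : ∀ (z : ℕ) (C : Net 0 n), w ≠ .int z →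
      Sim (spider .red 0 {.int z, w, w} ::ₘ C) (spider .red 0 {.int z} ::ₘ C) := fun z C hz => by
    obtain ⟨e, he, h⟩ := exists_fresh_seq (w ::ₘ .int z ::ₘ allLegs C)
    simp only [mem_cons, not_or, Name.int.injEq] at h
    have h1 := sim_split_two w (.int (e 2)) (.int (e 0)) (e 1)
      (spider .red 0 {.int (e 0), .int (e 1), .int z} ::ₘ C) (Ne.symm (h 1).1) (by simp [he.eq_iff])
    have h2 := sim_fuse .red 0 0 (e 0) {w, .int (e 2)} {.int (e 1), .int z}
      (spider .red 0 {.int (e 1), w, .int (e 2)} ::ₘ C) (by simp [h, he.eq_iff])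
      (by simp [h, he.eq_iff]) (by simp [h, he.eq_iff])
    have h3 := sim_fuse .red 0 0 (e 1) {w, .int (e 2)} {w, .int (e 2), .int z}
      C (by simp [h, he.eq_iff]) (by simp [h, he.eq_iff]) (by simp [h])
    have h4 := sim_loop .red 0 (e 2) {.int z, w, w} C (by simp [h]) (by simp [h])
    have h5 := sim_red_drop 0 (e 2) {.int (e 0), w}
      (spider .red 0 {.int (e 0), .int (e 0), .int z} ::ₘ C)
      (by simp [h, he.eq_iff]) (by simp [h, he.eq_iff])
    have h6 := sim_loop .red 0 (e 0) {.int z} C (by simp [h]) (by simp [h])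
    have s1 : ∀ x : Name 0 n, Name.subst (e 1) x (.int z) = .int z := fun x =>
      subst_of_ne x (by simpa using Ne.symm (h 1).2.1)
    have s2 : ∀ x : Name 0 n, Name.subst (e 1) x (.int (e 0)) = .int (e 0) := fun x =>
      subst_of_ne x (by simp [he.eq_iff])
    simp only [map_cons, rename_spider, map_singleton, insert_eq_cons, cons_add, singleton_add, s1,
      s2, subst_self, add_zero, map_rename_subst_of_notMem _ (h 1).2.2] at h1 h2 h3 h4 h5 h6 ⊢
    refine .trans (.trans (.of_eq ?_) (h4.symm.trans (.trans (.of_eq ?_) (h3.symm.trans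
      (.trans (.of_eq ?_) h2.symm))))) (.trans (.of_eq ?_) (h1.trans (.trans (.of_eq ?_)
        (h5.trans h6)))) <;>
    simp only [← singleton_add] <;> ac_rfl
  obtain ⟨m, hm⟩ := exists_fresh (w ::ₘ A + allLegs C)
  simp only [mem_cons, not_or, cons_add, mem_add] at hm
  have h1 := sim_fuse .red 0 p m {w, w} A C (by simp [hm]) hm.2.1 hm.2.2
  have h2 := three m (spider .red p (.int m ::ₘ A) ::ₘ C) (Ne.symm hm.1)
  have h3 := sim_fuse .red 0 p m 0 A C (by simp) hm.2.1 hm.2.2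
  simp only [insert_eq_cons, cons_add, singleton_add, zero_add, cons_zero] at h1 h2 h3
  exact h1.symm.trans (h2.trans h3)

/-- Two-legged green spiders that lead to nothing are phases. -/
lemma sim_drop_ends (p : Phase) (ends : Multiset (Name 0 n × Name 0 n)) (C : Net 0 n)
    (nd : (ends.map Prod.snd).Nodup)
    (h : ∀ x ∈ ends.map Prod.snd, (∃ m, x = .int m) ∧ x ∉ ends.map Prod.fst ∧ x ∉ allLegs C) :
    Sim ((ends.map fun o => spider .green p {o.2, o.1}) + C)
      (((ends.map Prod.fst).map fun a => spider .green p {a}) + C) := by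
  induction ends using Multiset.induction_on generalizing C with
  | empty => simpa using Sim.refl _
  | cons o ends ih =>
    obtain ⟨a, b⟩ := o
    simp only [map_cons, nodup_cons] at nd
    simp only [map_cons, mem_cons, forall_eq_or_imp, not_or] at h
    obtain ⟨⟨⟨m, rfl⟩, ⟨hba, hbf⟩, hbC⟩, h⟩ := h
    have h1 := sim_green_drop p a m 0 ((ends.map fun o => spider .green p {o.2, o.1}) + C)
      (by simp) (by
      rw [allLegs_add, allLegs_map_spider_pair, mem_add, mem_add]
      tauto)
    have h2 := ih (spider .green p {a} ::ₘ C) nd.2 fun x hx => by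
      obtain ⟨h1, ⟨h2, h3⟩, h4⟩ := h x hx
      exact ⟨h1, h3, by simp [h2, h4]⟩
    simp only [map_cons, cons_zero, insert_eq_cons, cons_add, add_cons] at h1 h2 ⊢
    rw [cons_pair a] at h1
    exact h1.trans h2

/-- A green state with phase `11` is copied through a red spider. -/
lemma sim_eleven_red (x : ZMod 2) (k : ℕ) (A : Multiset (Name 0 n)) (C : Net 0 n) (hA : .int k ∉ A)
    (hC : .int k ∉ allLegs C) :
    Sim (spider .green (1, 1) {.int k} ::ₘ spider .red (x, x) (.int k ::ₘ A) ::ₘ C)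
      ((A.map fun a => spider .green (1, 1) {a}) + C) := by
  have zero : ∀ (k : ℕ) (A : Multiset (Name 0 n)) (C : Net 0 n) (_ : .int k ∉ A)
      (_ : .int k ∉ allLegs C),
      Sim (spider .green (1, 1) {.int k} ::ₘ spider .red 0 (.int k ::ₘ A) ::ₘ C)
      ((A.map fun a => spider .green (1, 1) {a}) + C) := fun k A C hA hC => by
    obtain ⟨m, hm⟩ := exists_fresh (.int k ::ₘ A + allLegs C)
    simp only [mem_cons, not_or, cons_add, mem_add, Name.int.injEq] at hm
    obtain ⟨ends, rfl, nd, h⟩ := exists_fresh_ends A (.int m ::ₘ .int k ::ₘ (A + allLegs C))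
    simp only [mem_cons, not_or, mem_add] at h
    have h1 := sim_green_drop (1, 1) (.int k) m 0
      (spider .red 0 (.int k ::ₘ ends.map Prod.fst) ::ₘ C) (by simp) (by simp [hm])
    have h2 := sim_copy11 .red (.int m) k ends C (by simpa using hm.1) hA hC nd fun x hx => by
      have := h x hx
      tauto
    have h3 := sim_red_drop 0 m (ends.map Prod.snd)
      ((ends.map fun o => spider .green (1, 1) {o.2, o.1}) + C)
      (fun hx => (h _ hx).2.1 rfl) (by
        rw [allLegs_add, allLegs_map_spider_pair, mem_add, mem_add]
        rintro ((hx | hx) | hx)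
        · exact (h _ hx).2.1 rfl
        · exact hm.2.1 hx
        · exact hm.2.2 hx)
    simp only [cons_zero, insert_eq_cons, other_red, cons_add] at h1 h2
    rw [cons_pair] at h1
    refine h1.symm.trans (h2.trans (h3.trans (sim_drop_ends _ _ _ nd fun x hx => ?_)))
    have := h x hx
    tauto
  have hx : x = 0 ∨ x = 1 := by revert x; decide
  rcases hx with rfl | rfl
  · exact zero k A C hA hC
  obtain ⟨m, hm⟩ := exists_fresh (.int k ::ₘ A + allLegs C)
  simp only [mem_cons, not_or, cons_add, mem_add, Name.int.injEq] at hm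
  have h1 := sim_fuse .red (1, 1) 0 m 0 (.int k ::ₘ A) (spider .green (1, 1) {.int k} ::ₘ C)
    (by simp) (by simp [hm]) (by simp [hm])
  have h2 := zero k (.int m ::ₘ A) (spider .red (1, 1) {.int m} ::ₘ C)
    (by simp [hA, Ne.symm hm.1]) (by simp [hC, Ne.symm hm.1])
  have h3 := sim_scalar_pair (1, 1) (1, 1) ⟨(1, 1), by decide⟩ m
    ((A.map fun a => spider .green (1, 1) {a}) + C) (by
      rw [allLegs_add, mem_add, mem_allLegs]
      rintro (⟨a, ha, hx⟩ | hx)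
      · obtain ⟨b, hb, rfl⟩ := mem_map.1 ha
        rw [spider_legs, mem_singleton] at hx
        exact hm.2.1 (hx ▸ hb)
      · exact hm.2.2 hx)
  simp only [add_zero, zero_add, cons_zero, map_cons] at h1 h2 h3
  refine .trans (.of_eq ?_) (h1.symm.trans (.trans (.of_eq ?_) (h2.trans
    (.trans (.of_eq ?_) h3)))) <;>
  simp only [← singleton_add] <;> ac_rfl

/-- Euler decomposition as an equation between nets. -/
lemma sim_had (a b : Name 0 n) (C : Net 0 n) :
    Sim (had a b ::ₘ C) (spider .green (0, 1) {a} ::ₘ spider .green (0, 1) {b} ::ₘ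
      spider .red (0, 1) {a, b} ::ₘ C) := by
  obtain ⟨e, he, h⟩ := exists_fresh_seq (a ::ₘ b ::ₘ allLegs C)
  simp only [mem_cons, not_or] at h
  have h1 := sim_euler .green (e 0) (e 1) (by simp [he.eq_iff]) a b C (Ne.symm (h 0).1)
      (Ne.symm (h 0).2.1)
    (h 0).2.2 (Ne.symm (h 1).1) (Ne.symm (h 1).2.1) (h 1).2.2
  have h2 := sim_merge (0, 1) a (e 0) 0
    (spider .red (0, 1) {.int (e 0), .int (e 1)} ::ₘ spider .green (0, 1) {.int (e 1), b} ::ₘ C)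
  have h3 := sim_merge (0, 1) b (e 1) 0
    (spider .red (0, 1) {a, .int (e 1)} ::ₘ spider .green (0, 1) {a} ::ₘ C)
  have s1 : ∀ x : Name 0 n, Name.subst (e 0) x (.int (e 1)) = .int (e 1) := fun x =>
      subst_of_ne x (by simp [he.eq_iff])
  have s2 : ∀ x : Name 0 n, Name.subst (e 0) x b = b := fun x => subst_of_ne x (Ne.symm (h 0).2.1)
  have s3 : ∀ x : Name 0 n, Name.subst (e 1) x a = a := fun x => subst_of_ne x (Ne.symm (h 1).1)
  simp only [map_cons, rename_spider, map_singleton, insert_eq_cons, s1, s2, s3, cons_zero,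
      subst_self, map_rename_subst_of_notMem _ (h 0).2.2, map_rename_subst_of_notMem _ (h 1).2.2,
      subst_target] at h1 h2 h3 ⊢
  refine h1.trans (h2.trans (.trans (.of_eq ?_) (h3.trans (.of_eq ?_)))) <;>
  simp only [← singleton_add] <;> ac_rfl

/-- A red spider with an edge at one of its legs is a green spider with a colour-changing node on
each of its other legs. -/
lemma sim_had_red (p : Phase) (k : ℕ) (r : Name 0 n) (A : Multiset (Name 0 n)) (C : Net 0 n)
    (hr : r ≠ .int k) (hA : .int k ∉ A) (hC : .int k ∉ allLegs C) :
    Sim (had (.int k) r ::ₘ spider .red p (.int k ::ₘ A) ::ₘ C)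
      (spider .green p {r} ::ₘ A.map (had r) + C) := by
  obtain ⟨m, hm⟩ := exists_fresh (.int k ::ₘ r ::ₘ A + allLegs C)
  simp only [mem_cons, not_or, cons_add, mem_add, Name.int.injEq] at hm
  have hmr : ∀ x ∈ A, Name.subst m r x = x := fun x hx => subst_of_ne r fun h => hm.2.2.1 (h ▸ hx)
  have h1 := sim_red p m (.int k ::ₘ A) (had (.int k) r ::ₘ C) (by simp [hm]) (by simp [hm])
  have h2 := sim_had_had k r (.int m) (spider .green p {.int m} ::ₘ A.map (had (.int m)) + C) hr
    (by simpa using hm.1) (by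
      rw [cons_add, allLegs_cons, allLegs_add, spider_legs, mem_add, mem_add, mem_singleton]
      rintro (hx | hx | hx)
      · exact hm.1 (int_injective hx.symm)
      · rcases mem_or_mem_of_star hx with hx | hx
        · exact hm.1 (int_injective hx.symm)
        · exact hA hx
      · exact hC hx)
  have h3 := sim_wire r m (spider .green p {.int m} ::ₘ A.map (had (.int m)) + C)
  have e1 : (A.map (had (.int m))).map (Node.rename (Name.subst m r)) = A.map (had r) := by
    rw [Multiset.map_map]
    exact Multiset.map_congr rfl fun x hx => by simp [hmr x hx]
  simp only [map_cons, Multiset.map_add, e1, rename_spider, map_singleton, subst_self,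
    map_rename_subst_of_notMem r hm.2.2.2] at h1 h2 h3 ⊢
  rw [had_comm (.int m : Name 0 n) (.int k)] at h1
  refine .trans (.of_eq ?_) (h1.trans (.trans (.of_eq ?_) (h2.trans h3))) <;>
  simp only [← singleton_add] <;> ac_rfl

lemma sim_zeroOne_leaf (y : Name 0 n) (C : Net 0 n) :
    Sim (spider .red (0, 1) {y} ::ₘ C) (spider .green (0, 1) {y} ::ₘ C) := by
  obtain ⟨k, hk⟩ := exists_fresh (y ::ₘ allLegs C)
  simp only [mem_cons, not_or] at hk
  have h1 := sim_red (0, 1) k {y} C (by simp [hk]) hk.2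
  have h2 := sim_had (.int k) y (spider .green (0, 1) {.int k} ::ₘ C)
  have h3 := sim_phase_add (0, 1) (0, 1) (.int k) (spider .green (0, 1) {y} ::ₘ
      spider .red (0, 1) {.int k, y} ::ₘ C)
  have h4 := sim_green_zero (.int k) (spider .green (0, 1) {y} ::ₘ
      spider .red (0, 1) {.int k, y} ::ₘ C)
  have h5 := sim_red_drop (0, 1) k {y} (spider .green (0, 1) {y} ::ₘ C) (by simp [hk])
      (by simp [hk])
  simp only [map_singleton, insert_eq_cons, cons_add, singleton_add] at h1 h2 h3 h4 h5
  rw [show ((0, 1) + (0, 1) : Phase) = 0 by decide] at h3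
  refine h1.trans (.trans (.of_eq ?_) (h2.trans (.trans (.of_eq ?_) (h3.trans (h4.trans
    (.trans (.of_eq ?_) h5)))))) <;>
  simp only [← singleton_add] <;> ac_rfl

/-- The 11-commutation rule as an equation between nets. -/
lemma sim_comm_eleven (x y : ZMod 2) (k : ℕ) (a : Name 0 n) (C : Net 0 n) :
    Sim (spider .red (1, 1) {a, .int k} ::ₘ spider .green (x, y) {.int k} ::ₘ C)
      (spider .red (1, 1) {a, .int k} ::ₘ spider .green (y, x) {a} ::ₘ C) := by
  obtain ⟨e, he, h⟩ := exists_fresh_seq (a ::ₘ .int k ::ₘ allLegs C)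
  simp only [mem_cons, not_or, Name.int.injEq] at h
  have h1 := sim_comm11 .green x y (e 0) (e 1) a (.int k) C (Ne.symm (h 0).1)
    (by simpa using Ne.symm (h 0).2.1) (h 0).2.2 (Ne.symm (h 1).1)
    (by simpa using Ne.symm (h 1).2.1) (h 1).2.2
  have h2 := sim_merge (x, y) (.int k) (e 0) 0 (spider .red (1, 1) {a, .int (e 0)} ::ₘ C)
  have h3 := sim_merge (y, x) a (e 1) 0 (spider .red (1, 1) {.int (e 1), .int k} ::ₘ C)
  have s1 : ∀ i (x : Name 0 n), Name.subst (e i) x (.int k) = .int k := fun i x =>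
      subst_of_ne x (by simpa using Ne.symm (h i).2.1)
  have s2 : ∀ i (x : Name 0 n), Name.subst (e i) x a = a := fun i x =>
      subst_of_ne x (Ne.symm (h i).1)
  simp only [map_cons, rename_spider, map_singleton, insert_eq_cons, s1, s2, cons_zero,
    subst_self, map_rename_subst_of_notMem _ (h 0).2.2, map_rename_subst_of_notMem _ (h 1).2.2]
    at h1 h2 h3 ⊢
  refine .trans (.of_eq ?_) (h2.symm.trans (.trans (.of_eq ?_) (h1.trans (.trans (.of_eq ?_)
    (h3.trans (.of_eq ?_)))))) <;>
  simp only [← singleton_add] <;> ac_rfl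

lemma zmod_two_cases {motive : ZMod 2 → Prop} (x : ZMod 2) (h0 : motive 0) (h1 : motive 1) :
    motive x := by
  have hx : x = 0 ∨ x = 1 := by revert x; decide
  rcases hx with rfl | rfl
  exacts [h0, h1]

/-- A one-legged spider with phase `01` or `10` may be given either colour. -/
lemma sim_leaf (x : ZMod 2) (y : Name 0 n) (C : Net 0 n) :
    Sim (spider .red (x, x + 1) {y} ::ₘ C) (spider .green (x, x + 1) {y} ::ₘ C) := by
  induction x using zmod_two_cases with
  | h0 => exact sim_zeroOne_leaf y C
  | h1 =>
    obtain ⟨m, hm⟩ := exists_fresh (y ::ₘ allLegs C)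
    simp only [mem_cons, not_or] at hm
    have h1 := sim_red_unfuse (1, 1) (0, 1) m y 0 C (Ne.symm hm.1) (by simp) hm.2
    have h2 := sim_zeroOne_leaf (.int m) (spider .red (1, 1) {y, .int m} ::ₘ C)
    have h3 := sim_comm_eleven 0 1 m y C
    have h4 := sim_red_drop (1, 1) m {y} (spider .green (1, 0) {y} ::ₘ C) (by simp [hm])
        (by simp [hm])
    simp only [cons_zero, insert_eq_cons] at h1 h2 h3 h4
    rw [show ((1, 1) + (0, 1) : Phase) = (1, 1 + 1) by decide] at h1
    rw [show ((1, 1 + 1) : Phase) = (1, 0) by decide] at h1 ⊢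
    refine h1.trans (.trans (.of_eq ?_)
        (h2.trans (.trans (.of_eq ?_) (h3.trans (.trans (.of_eq ?_) h4))))) <;>
    simp only [← singleton_add] <;> ac_rfl

/-- Euler decomposition solved for the red phase shift, also for the phase `10`. -/
lemma sim_red_two (x : ZMod 2) (a b : Name 0 n) (C : Net 0 n) :
    Sim (spider .red (x, x + 1) {a, b} ::ₘ C) (spider .green (x, x + 1) {a} ::ₘ had a b ::ₘ
      spider .green (x, x + 1) {b} ::ₘ C) := by
  have cancel : ∀ (p : Phase) (a : Name 0 n) (C : Net 0 n),
      Sim (spider .green p {a} ::ₘ spider .green p {a} ::ₘ C) C := fun p a C => by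
    refine (sim_phase_add p p a C).trans ?_
    rw [show p + p = 0 by revert p; decide]
    exact sim_green_zero a C
  have zero : ∀ (a b : Name 0 n) (C : Net 0 n),
      Sim (spider .red (0, 1) {a, b} ::ₘ C) (spider .green (0, 1) {a} ::ₘ had a b ::ₘ
        spider .green (0, 1) {b} ::ₘ C) := fun a b C => by
    have h1 := sim_had a b (spider .green (0, 1) {a} ::ₘ spider .green (0, 1) {b} ::ₘ C)
    have h2 := cancel (0, 1) a (spider .green (0, 1) {b} ::ₘ spider .green (0, 1) {b} ::ₘ
      spider .red (0, 1) {a, b} ::ₘ C)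
    have h3 := cancel (0, 1) b (spider .red (0, 1) {a, b} ::ₘ C)
    refine .symm (.trans (.of_eq ?_) (h1.trans (.trans (.of_eq ?_) (h2.trans h3)))) <;>
    simp only [← singleton_add] <;> ac_rfl
  induction x using zmod_two_cases with
  | h0 => exact zero a b C
  | h1 =>
    obtain ⟨m, hm⟩ := exists_fresh (a ::ₘ b ::ₘ allLegs C)
    simp only [mem_cons, not_or] at hm
    have h1 := sim_red_unfuse (1, 1) (0, 1) m a {b} C (Ne.symm hm.1) (by simp [hm]) hm.2.2
    have h2 := zero (.int m) b (spider .red (1, 1) {a, .int m} ::ₘ C)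
    have h3 := sim_comm_eleven 0 1 m a (had (.int m) b ::ₘ spider .green (0, 1) {b} ::ₘ C)
    have h4 := sim_had_red (1, 1) m b {a} (spider .green (1, 0) {a} ::ₘ
      spider .green (0, 1) {b} ::ₘ C) (Ne.symm hm.2.1) (by simp [hm]) (by simp [hm])
    have h5 := sim_phase_add (1, 1) (0, 1) b (had b a ::ₘ spider .green (1, 0) {a} ::ₘ C)
    simp only [insert_eq_cons, map_singleton, cons_add, singleton_add] at h1 h2 h3 h4 h5
    rw [show ((1, 1) + (0, 1) : Phase) = (1, 1 + 1) by decide] at h1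
    rw [show ((1, 1) + (0, 1) : Phase) = (1, 0) by decide, had_comm b a] at h5
    rw [had_comm b a] at h4
    rw [show ((1, 1 + 1) : Phase) = (1, 0) by decide] at h1 ⊢
    refine h1.trans (.trans (.of_eq ?_) (h2.trans (.trans (.of_eq ?_) (h3.trans (.trans (.of_eq ?_)
      (h4.trans (.trans (.of_eq ?_) (h5.trans (.of_eq ?_))))))))) <;>
    simp only [← singleton_add] <;> ac_rfl

/-- A loop in a graph can be removed. -/
lemma sim_had_self (z : Name 0 n) (C : Net 0 n) : Sim (had z z ::ₘ C) C := by
  have h1 := sim_red_two 0 z z C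
  have h2 := sim_hopf (0, 0 + 1) z 0 C
  have h3 := sim_scalar_empty (0, 0 + 1) (by decide) C
  have h4 := sim_phase_add (0, 0 + 1) (0, 0 + 1) z (had z z ::ₘ C)
  rw [show ((0, 0 + 1) + (0, 0 + 1) : Phase) = 0 by decide] at h4
  have h5 := sim_green_zero z (had z z ::ₘ C)
  rw [cons_zero] at h2
  refine h5.symm.trans (h4.symm.trans (.trans (.of_eq ?_) (h1.symm.trans (h2.trans h3))))
  simp only [← singleton_add]
  ac_rfl

/-- A double edge in a graph can be removed. -/
lemma sim_had_cancel (a b : Name 0 n) (C : Net 0 n) : Sim (had a b ::ₘ had a b ::ₘ C) C := by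
  obtain ⟨k, hk⟩ := exists_fresh (a ::ₘ b ::ₘ allLegs C)
  simp only [mem_cons, not_or] at hk
  have h1 := sim_had_red 0 k a {b, b} C (Ne.symm hk.1) (by simp [hk]) hk.2.2
  have h2 := sim_had_red 0 k a 0 C (Ne.symm hk.1) (by simp) hk.2.2
  have h3 := sim_hopf 0 b {.int k} (had (.int k) a ::ₘ C)
  have h4 := sim_green_zero a (had a b ::ₘ had a b ::ₘ C)
  have h5 := sim_green_zero a C
  simp only [cons_zero, map_singleton, map_zero, insert_eq_cons, cons_add, singleton_add, map_cons]
    at h1 h2 h3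
  refine h4.symm.trans (h1.symm.trans (.trans (.of_eq ?_) (h3.trans (.trans (.of_eq ?_)
    (h2.trans h5))))) <;>
  simp only [← singleton_add] <;> ac_rfl

end

/-! ### Local complementation and elimination of a name -/

section

variable {n : ℕ}

/-- Nets made of phases at names and colour-changing nodes between names: graph states whose
vertices carry green phases, up to the choice of which names are outputs. -/
def IsGraphlike (K : Net 0 n) : Prop :=
  ∀ f ∈ K, (∃ p a, f = spider .green p {a}) ∨ ∃ a b, f = had a b

lemma IsGraphlike.zero : IsGraphlike (0 : Net 0 n) := fun _ h => absurd h (notMem_zero _)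

lemma IsGraphlike.add {K L : Net 0 n} (hK : IsGraphlike K) (hL : IsGraphlike L) :
    IsGraphlike (K + L) := fun f hf => (mem_add.1 hf).elim (hK f) (hL f)

lemma isGraphlike_cons {f : Node (Name 0 n)} {K : Net 0 n} : IsGraphlike (f ::ₘ K) ↔
    ((∃ p a, f = spider .green p {a}) ∨ ∃ a b, f = had a b) ∧ IsGraphlike K := by
  simp [IsGraphlike]

lemma IsGraphlike.phase {K : Net 0 n} (hK : IsGraphlike K) (p : Phase) (a : Name 0 n) :
    IsGraphlike (spider .green p {a} ::ₘ K) :=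
  isGraphlike_cons.2 ⟨.inl ⟨p, a, rfl⟩, hK⟩

lemma IsGraphlike.star (a : Name 0 n) (A : Multiset (Name 0 n)) : IsGraphlike (A.map (had a)) :=
  fun _ hf => let ⟨b, _, hb⟩ := mem_map.1 hf; .inr ⟨a, b, hb.symm⟩

lemma IsGraphlike.of_le {K L : Net 0 n} (hK : IsGraphlike K) (h : L ≤ K) : IsGraphlike L :=
  fun f hf => hK f (mem_of_le h hf)

/-- A leg of a red spider with phase `01` or `10` can be taken off at the price of edges from it to
the other legs, which is a local complementation. -/
lemma sim_local_complement (x : ZMod 2) (w : Name 0 n) (A : Multiset (Name 0 n)) (C : Net 0 n) :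
    Sim (spider .red (x, x + 1) (w ::ₘ A) ::ₘ C)
      (spider .green (x, x + 1) {w} ::ₘ A.map (had w) + spider .red (x, x + 1) A ::ₘ C) := by
  set p : Phase := (x, x + 1) with hp
  have hpp : p + p = 0 := by rw [hp]; clear hp p; revert x; decide
  obtain ⟨e, he, h⟩ := exists_fresh_seq (w ::ₘ A + allLegs C)
  simp only [mem_cons, not_or, cons_add, mem_add] at h
  have e10 : (Name.int (e 1) : Name 0 n) ≠ .int (e 0) := by simp [he.eq_iff]
  -- `e 0` is the sum of the legs in `A`.
  have h1 := sim_fuse .red p 0 (e 0) {w} A C (by simp [h]) (by simp [h]) (by simp [h])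
  have h2 := sim_red p (e 1) {.int (e 0), w} (spider .red 0 (.int (e 0) ::ₘ A) ::ₘ C)
    (by simp [h, he.eq_iff]) (by simp [h, he.eq_iff])
  have h3 := sim_phase_add p p (.int (e 0)) (spider .green p {.int (e 1)} ::ₘ
    had (.int (e 1)) (.int (e 0)) ::ₘ had (.int (e 1)) w ::ₘ
    spider .red 0 (.int (e 0) ::ₘ A) ::ₘ C)
  have h4 := sim_green_zero (.int (e 0)) (spider .green p {.int (e 1)} ::ₘ
    had (.int (e 1)) (.int (e 0)) ::ₘ had (.int (e 1)) w ::ₘ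
    spider .red 0 (.int (e 0) ::ₘ A) ::ₘ C)
  have h5 := sim_red_two x (.int (e 1)) (.int (e 0)) (spider .green p {.int (e 0)} ::ₘ
    had (.int (e 1)) w ::ₘ spider .red 0 (.int (e 0) ::ₘ A) ::ₘ C)
  have h6 := sim_leaf x (.int (e 0)) (spider .red p {.int (e 1), .int (e 0)} ::ₘ
    had (.int (e 1)) w ::ₘ spider .red 0 (.int (e 0) ::ₘ A) ::ₘ C)
  -- Each of the two red spiders at `e 0` gets the legs in `A` instead.
  have h7 := sim_split_zero (.int (e 0)) (e 2) A (spider .red p {.int (e 0)} ::ₘ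
    spider .red p {.int (e 1), .int (e 2)} ::ₘ had (.int (e 1)) w ::ₘ C) (by simp [h])
  have h8 := sim_fuse .red p 0 (e 0) 0 A (spider .red 0 (.int (e 2) ::ₘ A) ::ₘ
    spider .red p {.int (e 1), .int (e 2)} ::ₘ had (.int (e 1)) w ::ₘ C) (by simp) (by simp [h])
    (by simp [h, he.eq_iff])
  have h9 := sim_fuse .red p 0 (e 2) {.int (e 1)} A (spider .red p A ::ₘ had (.int (e 1)) w ::ₘ C)
    (by simp [he.eq_iff]) (by simp [h]) (by simp [h, he.eq_iff])
  have h10 := sim_had_red p (e 1) w A (spider .red p A ::ₘ C) (Ne.symm (h 1).1) (by simp [h])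
    (by simp [h])
  have s1 : ∀ (x : Name 0 n), Name.subst (e 2) x w = w := fun x => subst_of_ne x (Ne.symm (h 2).1)
  have s2 : ∀ i (x : Name 0 n), i ≠ 2 → Name.subst (e 2) x (.int (e i)) = .int (e i) :=
    fun i x hi => subst_of_ne x (by simpa [he.eq_iff] using hi)
  simp only [map_cons, rename_spider, rename_had, map_singleton, insert_eq_cons, cons_add,
    singleton_add, add_zero, zero_add, cons_zero, s1, s2 0 _ (by decide), s2 1 _ (by decide),
    subst_self, map_rename_subst_of_notMem _ (h 2).2.2, ← hp, hpp]
    at h1 h2 h3 h4 h5 h6 h7 h8 h9 h10 ⊢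
  refine .trans (.of_eq ?_) (h1.symm.trans (.trans (.of_eq ?_) (h2.trans (.trans (.of_eq ?_)
    (h4.symm.trans (.trans (.of_eq ?_) (h3.symm.trans (.trans (.of_eq ?_) (h5.symm.trans
    (.trans (.of_eq ?_) (h6.symm.trans (.trans (.of_eq ?_) (h7.symm.trans (.trans (.of_eq ?_)
    (h8.trans (.trans (.of_eq ?_) (h9.trans (.trans (.of_eq ?_)
        (h10.trans (.of_eq ?_)))))))))))))))))))) <;>
  simp only [← singleton_add] <;> ac_rfl

/-- A red spider with phase `01` or `10` is a complete graph on its legs with the same phase at each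
of them. -/
lemma exists_graphlike_of_mixed (x : ZMod 2) (A : Multiset (Name 0 n)) :
    ∃ K : Net 0 n, IsGraphlike K ∧ (∀ a ∈ allLegs K, a ∈ A) ∧
      ∀ C, Sim (spider .red (x, x + 1) A ::ₘ C) (K + C) := by
  induction A using Multiset.induction_on with
  | empty =>
    refine ⟨0, .zero, by simp, fun C => ?_⟩
    simpa using sim_scalar_empty (x, x + 1) (by revert x; decide) C
  | cons w A ih =>
    obtain ⟨K, hK, hl, h⟩ := ih
    refine ⟨spider .green (x, x + 1) {w} ::ₘ A.map (had w) + K,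
      (IsGraphlike.star _ _ |>.phase _ _).add hK, fun a ha => ?_, fun C => ?_⟩
    · rw [allLegs_add, allLegs_cons, mem_add, mem_add, spider_legs, mem_singleton] at ha
      rw [mem_cons]
      rcases ha with (ha | ha) | ha
      exacts [.inl ha, mem_or_mem_of_star ha, .inr (hl a ha)]
    · refine (sim_local_complement x w A C).trans ?_
      have := h (spider .green (x, x + 1) {w} ::ₘ A.map (had w) + C)
      refine .trans (.of_eq ?_) (this.trans (.of_eq ?_)) <;>
      simp only [← singleton_add] <;> ac_rfl

lemma phase_cases (p : Phase) : p = 0 ∨ p = (1, 1) ∨ ∃ x, p = (x, x + 1) := by revert p; decide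

lemma phase_equal_or_mixed (p : Phase) : (∃ x, p = (x, x)) ∨ ∃ x, p = (x, x + 1) := by
  revert p; decide

/-- A name shared by a red spider with phase `00` or `11`, a green phase and any number of edges can
be eliminated: the spider determines this name by its other legs, and an edge at it is replaced by
edges at the other legs. -/
lemma exists_graphlike_of_eliminate (x : ZMod 2) (q : Phase) (k : ℕ) (A B : Multiset (Name 0 n))
    (hA : .int k ∉ A) (hB : .int k ∉ B) :
    ∃ K : Net 0 n, IsGraphlike K ∧ (∀ a ∈ allLegs K, a ∈ A + B) ∧ ∀ C, .int k ∉ allLegs C →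
      Sim (spider .red (x, x) (.int k ::ₘ A) ::ₘ spider .green q {.int k} ::ₘ
        B.map (had (.int k)) + C) (K + C) := by
  induction B using Multiset.induction_on with
  | empty =>
    rcases phase_cases q with rfl | rfl | ⟨y, rfl⟩
    · refine ⟨0, .zero, by simp, fun C hC => ?_⟩
      rw [cons_swap]
      simpa using (sim_green_zero _ _).trans (sim_red_drop (x, x) k A C hA hC)
    · refine ⟨A.map fun a => spider .green (1, 1) {a}, fun f hf => ?_, fun a ha => ?_,
        fun C hC => ?_⟩
      · obtain ⟨a, -, rfl⟩ := mem_map.1 hf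
        exact .inl ⟨_, _, rfl⟩
      · obtain ⟨b, hb, hx⟩ := mem_allLegs.1 ha
        obtain ⟨c, hc, rfl⟩ := mem_map.1 hb
        rw [spider_legs, mem_singleton] at hx
        simpa [hx] using hc
      · rw [cons_swap]
        simpa using sim_eleven_red x k A C hA hC
    · obtain ⟨K, hK, hl, h⟩ := exists_graphlike_of_mixed (x + y) A
      refine ⟨K, hK, by simpa using hl, fun C hC => ?_⟩
      have h1 := sim_leaf y (.int k) (spider .red (x, x) (.int k ::ₘ A) ::ₘ C)
      have h2 := sim_fuse .red (y, y + 1) (x, x) k 0 A C (by simp) hA hC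
      rw [show ((y, y + 1) + (x, x) : Phase) = (x + y, x + y + 1) from
        Prod.ext (add_comm y x) (by change y + 1 + x = x + y + 1; ring)] at h2
      simp only [cons_zero, zero_add] at h2
      rw [cons_swap]
      simpa using h1.symm.trans (h2.trans (h C))
  | cons r B ih =>
    rw [mem_cons, not_or] at hB
    obtain ⟨K, hK, hl, h⟩ := ih hB.2
    refine ⟨spider .green (x, x) {r} ::ₘ A.map (had r) + K,
      (IsGraphlike.star _ _ |>.phase _ _).add hK, fun a ha => ?_, fun C hC => ?_⟩
    · rw [allLegs_add, allLegs_cons, mem_add, mem_add, spider_legs, mem_singleton] at ha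
      rw [mem_add, mem_cons]
      rcases ha with (rfl | ha) | ha
      · exact .inr (.inl rfl)
      · rcases mem_or_mem_of_star ha with rfl | ha
        exacts [.inr (.inl rfl), .inl ha]
      · rcases mem_add.1 (hl a ha) with ha | ha
        exacts [.inl ha, .inr (.inr ha)]
    · obtain ⟨m, hm⟩ := exists_fresh (.int k ::ₘ r ::ₘ A + B + allLegs C)
      simp only [mem_cons, not_or, cons_add, mem_add, Name.int.injEq] at hm
      have hmB : .int m ∉ allLegs (B.map (had (.int k))) := fun hx =>
        (mem_or_mem_of_star hx).elim (fun h => hm.1 (int_injective h)) hm.2.2.1.2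
      -- The edge to `r` gets its own copy `m` of the leg `k`.
      have h1 := sim_split x (.int k) m A (had (.int m) r ::ₘ (spider .green q {.int k} ::ₘ
        B.map (had (.int k)) + C)) hm.2.2.1.1
      have h2 := sim_had_red (x, x) m r A (spider .red (x, x) (.int k ::ₘ A) ::ₘ
        spider .green q {.int k} ::ₘ B.map (had (.int k)) + C) (Ne.symm hm.2.1) hm.2.2.1.1
        (by simp [hm, hmB])
      have h3 := h (spider .green (x, x) {r} ::ₘ A.map (had r) + C) (by
        rw [cons_add, allLegs_cons, allLegs_add, mem_add, mem_add, spider_legs, mem_singleton]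
        rintro (hx | hx | hx)
        · exact hB.1 hx
        · exact (mem_or_mem_of_star hx).elim hB.1 hA
        · exact hC hx)
      have s1 : ∀ (x : Name 0 n), Name.subst m x (.int k) = .int k := fun x =>
        subst_of_ne x (by simpa using Ne.symm hm.1)
      have s2 : ∀ (x : Name 0 n), Name.subst m x r = r := fun x =>
        subst_of_ne x (Ne.symm hm.2.1)
      simp only [map_cons, Multiset.map_add, rename_spider, rename_had, map_singleton, cons_add,
        s1, s2, subst_self, map_rename_subst_of_notMem _ hmB,
        map_rename_subst_of_notMem _ hm.2.2.2] at h1 h2 h3 ⊢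
      refine .trans (.of_eq ?_) (h1.symm.trans (.trans (.of_eq ?_) (h2.trans (.trans (.of_eq ?_)
        (h3.trans (.of_eq ?_)))))) <;>
      simp only [← singleton_add] <;> ac_rfl

end

/-! ### Local operations on outputs -/

section

section Equivariance

variable {W W' : Type}

lemma holds_rename (σ : W' → Ontic) (f : W → W') (a : Node W) :
    (a.rename f).Holds σ ↔ a.Holds (σ ∘ f) := by
  rcases a with ⟨k, l⟩
  rcases k with ⟨c, p⟩ | _ | _
  · cases c <;> simp [Node.Holds, Node.rename, Multiset.map_map]
  all_goals simp only [Node.Holds, Node.rename, Multiset.map_map]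

/-- The rules do not depend on the names of the wires. -/
lemma Rule.map {φ : W → W'} (hφ : Function.Injective φ) {L R : Multiset (Node W)} (h : Rule L R) :
    Rule (L.map (Node.rename φ)) (R.map (Node.rename φ)) := by
  cases h with
  | fuse c p q e A B => simpa using Rule.fuse c p q (φ e) (A.map φ) (B.map φ)
  | loop c p e A => simpa using Rule.loop c p (φ e) (A.map φ)
  | identity c u v => simpa using Rule.identity c (φ u) (φ v)
  | bialgebra c i₁ i₂ o₁ o₂ e₁₁ e₁₂ e₂₁ e₂₂ e =>
    simpa using Rule.bialgebra c (φ i₁) (φ i₂) (φ o₁) (φ o₂) (φ e₁₁) (φ e₁₂) (φ e₂₁) (φ e₂₂) (φ e)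
  | copy c e o₁ o₂ => simpa using Rule.copy c (φ e) (φ o₁) (φ o₂)
  | copy11 c i e outs =>
    simpa [Multiset.map_map, Function.comp_def] using
      Rule.copy11 c (φ i) (φ e) (outs.map (Prod.map φ φ))
  | comm11 c x y i o e e' => simpa using Rule.comm11 c x y (φ i) (φ o) (φ e) (φ e')
  | colourChange c p ends =>
    simpa [Multiset.map_map, Function.comp_def] using
      Rule.colourChange c p (ends.map (Prod.map φ φ))
  | euler c u v e f => simpa using Rule.euler c (φ u) (φ v) (φ e) (φ f)
  | scalar _ hK hs =>
    obtain ⟨σ, hσ⟩ := hs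
    refine Rule.scalar _ (fun w => ?_) ⟨Function.extend φ σ fun _ => 0, fun a ha => ?_⟩
    · rw [allLegs_map_rename]
      by_cases hw : ∃ v, φ v = w
      · obtain ⟨v, rfl⟩ := hw
        rw [count_map_eq_count' _ _ hφ]
        exact hK v
      · refine .inl (count_eq_zero.2 fun hm => hw ?_)
        obtain ⟨v, -, hv⟩ := mem_map.1 hm
        exact ⟨v, hv⟩
    · obtain ⟨b, hb, rfl⟩ := mem_map.1 ha
      rw [holds_rename, show Function.extend φ σ (fun _ => 0) ∘ φ = σ from
        funext fun x => hφ.extend_apply _ _ _]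
      exact hσ b hb

end Equivariance

variable {n : ℕ}

/-- Making the output `j` internal, under the name `int 0`, while the internal names are shifted. -/
def Name.close (j : Fin n) : Name 0 n → Name 0 n
  | .inp i => i.elim0
  | .out i => if i = j then .int 0 else .out i
  | .int k => .int (k + 1)

@[simp] lemma close_int (j : Fin n) (k : ℕ) : Name.close j (.int k) = .int (k + 1) := rfl
@[simp] lemma close_self (j : Fin n) : Name.close j (.out j) = .int 0 := by simp [Name.close]
lemma close_of_ne {i j : Fin n} (h : i ≠ j) : Name.close j (.out i) = .out i := by
  simp [Name.close, h]

lemma close_injective (j : Fin n) : Function.Injective (Name.close j) := by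
  rintro (a | a | a) (b | b | b) h
  all_goals first | exact a.elim0 | exact b.elim0 | skip
  · simp only [Name.close] at h
    split_ifs at h <;> simp_all
  · simp only [Name.close] at h
    split_ifs at h; simp_all
  · simp only [Name.close] at h
    split_ifs at h; simp_all
  · simpa using h

lemma close_ne_out (j : Fin n) (x : Name 0 n) : Name.close j x ≠ .out j := by
  rcases x with i | i | k
  · exact i.elim0
  · simp only [Name.close]
    split_ifs with h <;> simp [h]
  · simp

/-- The node of a local operation. -/
def LocalOp.node {W : Type} (o : LocalOp) (u v : W) : Node W := ⟨o.kind, {u, v}⟩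

@[simp] lemma node_legs {W : Type} (o : LocalOp) (u v : W) : (o.node u v).legs = {u, v} := rfl
@[simp] lemma rename_node {W W' : Type} (f : W → W') (o : LocalOp) (u v : W) :
    (o.node u v).rename f = o.node (f u) (f v) := by
  simp [LocalOp.node, Node.rename]
lemma arityOK_node {W : Type} (o : LocalOp) (u v : W) : (o.node u v).ArityOK := by
  cases o <;> simp [LocalOp.node, LocalOp.kind, Node.ArityOK]

lemma node_phase {W : Type} (c : Colour) (p : Phase) (u v : W) :
    (LocalOp.phase c p).node u v = spider c p {u, v} := rfl
lemma node_had {W : Type} (u v : W) : LocalOp.had.node u v = had u v := rfl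

/-- Applying the local operation `o` to the output `j`: its node is inserted between the former
output, which is now called `int 0`, and the output. -/
def applyOp (j : Fin n) (o : LocalOp) (F : Net 0 n) : Net 0 n :=
  o.node (.int 0) (.out j) ::ₘ F.map (Node.rename (Name.close j))

lemma exists_full_realization {F : Net 0 n} (h : ∀ a ∈ F, a.ArityOK) :
    ∃ K ℓ, K.map (Node.rename ℓ) = F ∧ (allLegs K).Nodup ∧
      (∀ x ∈ allLegs K, ∃ k, x = .int k) ∧ Realizes F (withHubs K ℓ (hubLabels F)) := by
  obtain ⟨K, ℓ, rfl, nd, int⟩ := exists_exploded F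
  exact ⟨K, ℓ, rfl, nd, int, K, ℓ, _, isSkeleton_of_exploded h nd int subset_rfl, rfl, rfl⟩

/-- Local operations can be applied to a net or to a diagram realizing it. The hub of the output `j`
becomes that of the name `int 0`, and its output leg leads to the new node. -/
lemma realizes_applyOp (j : Fin n) (o : LocalOp) {K : Net 0 n} {ℓ : Name 0 n → Name 0 n}
    (har : ∀ a ∈ K.map (Node.rename ℓ), a.ArityOK)
    (nd : (allLegs K).Nodup) (int : ∀ x ∈ allLegs K, ∃ k, x = .int k) :
    Realizes (applyOp j o (K.map (Node.rename ℓ)))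
      (applyOp j o (withHubs K ℓ (hubLabels (K.map (Node.rename ℓ))))) := by
  set V := hubLabels (K.map (Node.rename ℓ)) with hV
  set φ := Name.close j with hφ
  have iφ : Function.Injective φ := close_injective j
  let ℓ' : Name 0 n → Name 0 n
    | .int 0 => .int 0
    | .int (k + 1) => φ (ℓ (.int k))
    | x => x
  have hℓ : ∀ x ∈ allLegs K, ℓ' (φ x) = φ (ℓ x) := fun x hx => by
    obtain ⟨k, rfl⟩ := int x hx
    rfl
  have hℓV : ∀ x ∈ allLegs K, ℓ x ∈ V := fun x hx =>
    mem_hubLabels (by rw [allLegs_map_rename]; exact mem_map_of_mem _ hx)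
  have nd' : (allLegs (applyOp j o K)).Nodup := by
    simp only [applyOp, allLegs_cons, node_legs, allLegs_map_rename, insert_eq_cons, cons_add,
      singleton_add, nodup_cons, mem_cons, not_or, mem_map, not_exists, not_and]
    refine ⟨⟨by simp, fun x hx h => ?_⟩, fun x _ => close_ne_out j x, nd.map iφ⟩
    obtain ⟨k, rfl⟩ := int x hx
    simp at h
  have cases : ∀ x ∈ allLegs (applyOp j o K), x = .int 0 ∨ x = .out j ∨
      ∃ k, .int k ∈ allLegs K ∧ x = .int (k + 1) := fun x hx => by
    simp only [applyOp, allLegs_cons, node_legs, allLegs_map_rename, insert_eq_cons, cons_add,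
      singleton_add, mem_cons, mem_map] at hx
    rcases hx with rfl | rfl | ⟨y, hy, rfl⟩
    · exact .inl rfl
    · exact .inr (.inl rfl)
    · obtain ⟨k, rfl⟩ := int y hy
      exact .inr (.inr ⟨k, hy, rfl⟩)
  have h0 : (.int 0 : Name 0 n) ∈ V.image φ :=
    Finset.mem_image.2 ⟨.out j, out_mem_hubLabels _ j, close_self j⟩
  have hj : (.out j : Name 0 n) ∉ V.image φ := fun h =>
    let ⟨x, _, hx⟩ := Finset.mem_image.1 h; close_ne_out j x hx
  have hk : ∀ k, .int k ∈ allLegs K → ℓ' (.int (k + 1)) ∈ V.image φ := fun k h =>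
    Finset.mem_image.2 ⟨_, hℓV _ h, rfl⟩
  refine ⟨applyOp j o K, ℓ', V.image φ, ⟨?_, ?_, ?_, ?_, ?_, ?_⟩, ?_, ?_⟩
  · intro a ha
    rcases mem_cons.1 ha with rfl | ha
    · exact arityOK_node _ _ _
    · obtain ⟨b, hb, rfl⟩ := mem_map.1 ha
      rw [arityOK_rename]
      simpa using har _ (mem_map_of_mem _ hb)
  · intro x hx hxV
    rcases cases x hx with rfl | rfl | ⟨k, -, rfl⟩
    exacts [⟨_, rfl⟩, absurd hxV hj, ⟨_, rfl⟩]
  · exact fun x _ => nodup_iff_count_le_one.1 nd' x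
  · intro x hx hxV
    rcases cases x hx with rfl | rfl | ⟨k, hk', rfl⟩
    exacts [absurd h0 hxV, rfl, absurd (hk k hk') hxV]
  · intro k hx hxV
    rcases cases _ hx with h | h | ⟨k, hk', h⟩
    · rw [h] at hxV
      exact absurd h0 hxV
    · cases h
    · rw [h] at hxV
      exact absurd (hk k hk') hxV
  · intro i hi
    have : i = j := by
      by_contra hij
      exact hi (Finset.mem_image.2 ⟨.out i, out_mem_hubLabels _ i, close_of_ne hij⟩)
    subst this
    exact count_eq_one_of_mem nd' (by simp [applyOp])
  · rw [applyOp, map_cons, rename_node, map_rename_rename]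
    refine congrArg₂ cons rfl ?_
    rw [map_rename_rename]
    exact map_rename_congr hℓ
  · have hub_eq : ∀ v ∈ V, hub (applyOp j o K) ℓ' (φ v) = (hub K ℓ v).rename φ := fun v _ => by
      simp only [hub, rename_spider, Multiset.map_add, applyOp, allLegs_cons, node_legs,
        insert_eq_cons, allLegs_map_rename, filter_add]
      have e : filter (fun x => ℓ' x = φ v) ((allLegs K).map φ) =
          (filter (fun x => ℓ x = v) (allLegs K)).map φ := by
        rw [filter_map]
        refine congrArg _ (filter_congr fun x hx => ?_)
        rw [Function.comp_apply, hℓ x hx, iφ.eq_iff]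
      rw [e, ← add_assoc]
      refine congrArg (spider Colour.green 0) (congrArg (· + _) ?_)
      have f0 : ℓ' (.int 0) = .int 0 := rfl
      have fj : ℓ' (.out j) = .out j := rfl
      rcases v with i | i | k
      · exact i.elim0
      · by_cases hij : i = j
        · subst hij
          rw [hφ, close_self, ← hφ]
          simp [outLeg, filter_singleton, f0, fj, hφ]
        · rw [hφ, close_of_ne hij, ← hφ]
          simp [outLeg, filter_singleton, f0, fj, hφ, close_of_ne hij, Ne.symm hij]
      · simp [outLeg, filter_singleton, f0, fj, hφ]
    rw [withHubs, Finset.image_val_of_injOn iφ.injOn, Multiset.map_map]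
    simp only [withHubs, applyOp, Multiset.map_add, cons_add, Multiset.map_map]
    refine congrArg₂ cons rfl (congrArg₂ (· + ·) rfl ?_)
    exact Multiset.map_congr rfl hub_eq

lemma IsDiagram.applyOp {D : Net 0 n} (h : IsDiagram D) (j : Fin n) (o : LocalOp) :
    IsDiagram (applyOp j o D) := by
  have iφ := close_injective j
  have hl : allLegs (ToyCalculus.applyOp j o D) =
      .int 0 ::ₘ .out j ::ₘ (allLegs D).map (Name.close j) := by
    simp [ToyCalculus.applyOp]
  have key : ∀ x, ((allLegs D).map (Name.close j)).count (Name.close j x) = (allLegs D).count x :=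
    fun x => count_map_eq_count' _ _ iφ x
  refine ⟨fun a ha => ?_, fun i => i.elim0, fun i => ?_, fun k => ?_⟩
  · rcases mem_cons.1 ha with rfl | ha
    · exact arityOK_node _ _ _
    · obtain ⟨b, hb, rfl⟩ := mem_map.1 ha
      rw [arityOK_rename]
      exact h.arity b hb
  · rw [hl, count_cons_of_ne (by simp)]
    by_cases hij : i = j
    · subst hij
      rw [count_cons_self, count_eq_zero.2]
      intro hm
      obtain ⟨x, -, hx⟩ := mem_map.1 hm
      exact close_ne_out i x hx
    · rw [count_cons_of_ne (by simpa using hij), ← close_of_ne hij, key]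
      exact h.out i
  · rw [hl]
    cases k with
    | zero =>
      rw [count_cons_self, count_cons_of_ne (by simp), ← close_self j, key, h.out j]
      exact .inr rfl
    | succ k =>
      rw [count_cons_of_ne (by simp), count_cons_of_ne (by simp), ← close_int j, key]
      exact h.int k

lemma IsDiagram.rename {D : Net 0 n} (hD : IsDiagram D) (f : ℕ ≃ ℕ) :
    IsDiagram (D.map (Node.rename (Name.mapInt f))) := by
  have hf : Function.Injective (Name.mapInt f : Name 0 n → Name 0 n) := by
    rintro (a | a | a) (b | b | b) h <;> simp_all [Name.mapInt]
  refine ⟨fun a ha => ?_, fun i => i.elim0, fun i => ?_, fun k => ?_⟩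
  · obtain ⟨b, hb, rfl⟩ := mem_map.1 ha
    rw [arityOK_rename]
    exact hD.arity b hb
  · rw [allLegs_map_rename, ← mapInt_out f i, count_map_eq_count' _ _ hf]
    exact hD.out i
  · obtain ⟨k, rfl⟩ := f.surjective k
    rw [allLegs_map_rename, ← mapInt_int f k, count_map_eq_count' _ _ hf]
    exact hD.int k

/-- Diagrams related by a rewrite step remain equal after a local operation has been applied. -/
lemma Step.applyOp {D E : Net 0 n} (h : Step D E) (j : Fin n) (o : LocalOp) :
    Equal (applyOp j o D) (applyOp j o E) := by
  cases h with
  | rule h C hL hR =>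
    have hL := hL.applyOp j o
    have hR := hR.applyOp j o
    simp only [ToyCalculus.applyOp, Multiset.map_add] at hL hR ⊢
    rw [← add_cons] at hL hR ⊢
    rw [← add_cons]
    exact (Step.rule (h.map (close_injective j)) _ hL hR).equal
  | rename f D hD =>
    let g : ℕ → ℕ
      | 0 => 0
      | k + 1 => f k + 1
    have hg : Function.Injective g := by
      rintro (_ | a) (_ | b) h <;> simp_all [g]
    have hE := hD.rename f
    refine (hD.applyOp j o).equal_of_sim (hE.applyOp j o)
      ((sim_rename _ (f := g) hg.injOn).trans (.of_eq ?_))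
    simp only [ToyCalculus.applyOp, map_cons, rename_node, map_rename_rename]
    refine congrArg₂ cons rfl (map_rename_congr fun x _ => ?_)
    rcases x with i | i | k
    · exact i.elim0
    · simp only [Function.comp_apply, mapInt_out]
      by_cases hij : i = j
      · subst hij
        simp [g]
      · simp [close_of_ne hij]
    · rfl
  | absorb u k hu C hD =>
    have h1 := hD.applyOp j o
    simp only [ToyCalculus.applyOp, map_cons, rename_wire, close_int] at h1 ⊢
    rw [cons_swap] at h1 ⊢
    refine (Step.absorb _ (k + 1) (fun h => hu ?_) _ h1).equal.trans ?_
    · rw [← close_int j] at h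
      exact close_injective j h
    · rw [map_cons, rename_node, map_rename_rename, map_rename_rename,
        Function.update_of_ne (by simp), Function.update_of_ne (by simp)]
      have : ∀ x ∈ allLegs C,
          (Function.update id (.int (k + 1)) (Name.close j u) ∘ Name.close j) x =
          (Name.close j ∘ Function.update id (.int k) u) x := fun x _ => by
        by_cases hx : x = .int k
        · simp [hx]
        · have : Name.close j x ≠ .int (k + 1) := fun h => hx (close_injective j h)
          simp [Function.update_of_ne hx, Function.update_of_ne this]
      rw [map_rename_congr this]
      exact Equal.refl _

lemma Equal.applyOp {D E : Net 0 n} (h : Equal D E) (j : Fin n) (o : LocalOp) :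
    Equal (applyOp j o D) (applyOp j o E) := by
  induction h with
  | rel D E h => exact h.applyOp j o
  | refl D => exact Equal.refl _
  | symm D E _ ih => exact ih.symm
  | trans D E F _ _ ih ih' => exact ih.trans ih'

lemma Sim.arity {F G : Net 0 n} (h : Sim F G) (hF : ∀ a ∈ F, a.ArityOK) : ∀ a ∈ G, a.ArityOK := by
  obtain ⟨K, ℓ, -, -, -, hK⟩ := exists_full_realization hF
  obtain ⟨D, hD, -⟩ := (h _).1 ⟨_, hK, Equal.refl _⟩
  exact hD.arity

lemma arityOK_applyOp {j : Fin n} {o : LocalOp} {F : Net 0 n} :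
    (∀ a ∈ applyOp j o F, a.ArityOK) ↔ ∀ a ∈ F, a.ArityOK := by
  simp [applyOp, arityOK_node]

/-- Similarity is a congruence for the application of local operations to the outputs. -/
lemma Sim.applyOp {F G : Net 0 n} (h : Sim F G) (j : Fin n) (o : LocalOp) :
    Sim (applyOp j o F) (applyOp j o G) := by
  refine .of_arity ?_ fun hF => ?_
  · rw [arityOK_applyOp, arityOK_applyOp]
    exact ⟨h.arity, h.symm.arity⟩
  rw [arityOK_applyOp] at hF
  obtain ⟨K, ℓ, rfl, nd, int, hK⟩ := exists_full_realization hF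
  obtain ⟨L, ℓ', rfl, nd', int', hL⟩ := exists_full_realization (h.arity hF)
  refine (realizes_applyOp j o hF nd int).sim (realizes_applyOp j o (h.arity hF) nd' int')
    (Equal.applyOp ?_ j o)
  obtain ⟨D, hD, hE⟩ := (h _).1 ⟨_, hK, Equal.refl _⟩
  exact hE.symm.trans (hD.equal hL)

end

/-! ### Reduction to graph-like nets with fewer internal names -/

section

variable {n : ℕ}

/-- Applying local operations to outputs, the last one in the list first. -/
def applyOps (l : List (Fin n × LocalOp)) (F : Net 0 n) : Net 0 n :=
  l.foldr (fun x F => applyOp x.1 x.2 F) F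

/-- The net arises by local operations from a graph state, or from a net with an inconsistent
scalar. -/
def IsReduced (F : Net 0 n) : Prop :=
  ∃ l H, Sim F (applyOps l H) ∧
    ((∃ G : SimpleGraph (Fin n), H = graphStateWith G .out) ∨ spider .red (1, 1) 0 ∈ H)

lemma IsReduced.of_sim {F G : Net 0 n} (h : IsReduced G) (hs : Sim F G) : IsReduced F :=
  let ⟨l, H, h1, h2⟩ := h; ⟨l, H, hs.trans h1, h2⟩

lemma IsReduced.applyOp {F : Net 0 n} (h : IsReduced F) (j : Fin n) (o : LocalOp) :
    IsReduced (applyOp j o F) :=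
  let ⟨l, H, h1, h2⟩ := h; ⟨(j, o) :: l, H, h1.applyOp j o, h2⟩

lemma isReduced_scalar (C : Net 0 n) : IsReduced (spider .red (1, 1) 0 ::ₘ C) :=
  ⟨[], _, Sim.refl _, .inr (mem_cons_self _ _)⟩

/-- Once `f` has been applied, it does not matter whether the output `j` was first closed and then
given back its name; only the internal names have been shifted. -/
lemma sim_close (j : Fin n) (f : Net 0 n → Net 0 n)
    (hf : ∀ (g : Name 0 n → Name 0 n) (C : Net 0 n), g (.out j) = .out j →
      (f C).map (Node.rename g) = f (C.map (Node.rename g))) (C : Net 0 n) :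
    Sim (f ((C.map (Node.rename (Name.close j))).map (Node.rename (Name.subst 0 (.out j)))))
      (f C) := by
  refine .symm (.trans (sim_rename (f C) (f := (· + 1)) fun _ _ _ _ => by simp) (.of_eq ?_))
  rw [hf _ _ rfl, map_rename_rename]
  refine congrArg f (map_rename_congr fun x _ => ?_)
  rcases x with i | i | k
  · exact i.elim0
  · by_cases h : i = j
    · subst h
      simp
    · simp [close_of_ne h]
  · exact (subst_of_ne (k := 0) _ (by simp)).symm

lemma sim_applyOp_phase (j : Fin n) (p : Phase) (F : Net 0 n) :
    Sim (applyOp j (.phase .green p) F) (spider .green p {.out j} ::ₘ F) := by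
  rw [applyOp, node_phase, insert_eq_cons, cons_pair]
  refine (sim_merge p (.out j) 0 0 _).trans ?_
  rw [map_cons, rename_spider, cons_zero, map_singleton, subst_target]
  exact sim_close j (spider .green p {.out j} ::ₘ ·) (fun g C h => by simp [h]) F

lemma sim_wire_close (j : Fin n) (F : Net 0 n) :
    Sim (wire (.out j) (.int 0) ::ₘ F.map (Node.rename (Name.close j))) F :=
  (sim_wire _ _ _).trans (sim_close j id (fun _ _ _ => rfl) F)

lemma applyOp_applyOp (j : Fin n) (o o' : LocalOp) (F : Net 0 n) :
    applyOp j o' (applyOp j o F) = o'.node (.int 0) (.out j) ::ₘ o.node (.int 1) (.int 0) ::ₘ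
      F.map (Node.rename (fun x => Name.close j (Name.close j x))) := by
  simp only [applyOp, map_cons, rename_node, close_int, close_self, map_rename_rename]
  rfl

lemma zero_notMem_map_close_close (j : Fin n) (F : Net 0 n) :
    .int 0 ∉ allLegs (F.map (Node.rename (fun x => Name.close j (Name.close j x)))) := by
  rw [allLegs_map_rename]
  intro h
  obtain ⟨x, -, hx⟩ := mem_map.1 h
  rw [← close_self j] at hx
  exact close_ne_out j x (close_injective j hx)

/-- After two operations on the same output, the wire beyond the inner one may be named `int 0`
instead of `int 1`. -/
lemma sim_close_close (j : Fin n) (N : Name 0 n → Net 0 n)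
    (hN : ∀ (g : Name 0 n → Name 0 n) a, g (.out j) = .out j →
      (N a).map (Node.rename g) = N (g a)) (F : Net 0 n) :
    Sim (N (.int 1) + F.map (Node.rename (fun x => Name.close j (Name.close j x))))
      (N (.int 0) + F.map (Node.rename (Name.close j))) := by
  refine .symm (.trans (sim_rename _ (f := (· + 1)) fun _ _ _ _ => by simp) (.of_eq ?_))
  rw [Multiset.map_add, hN _ _ rfl, map_rename_rename]
  refine congrArg₂ (· + ·) rfl (map_rename_congr fun x _ => ?_)
  rcases x with i | i | k
  · exact i.elim0
  · by_cases h : i = j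
    · subst h
      simp
    · simp [close_of_ne h]
  · rfl

lemma sim_applyOp_had_had (j : Fin n) (F : Net 0 n) :
    Sim (applyOp j .had (applyOp j .had F)) F := by
  rw [applyOp_applyOp, node_had, node_had, had_comm (.int 1 : Name 0 n)]
  have h1 := sim_had_had 0 (.out j) (.int 1)
    (F.map (Node.rename (fun x => Name.close j (Name.close j x)))) (by simp) (by simp)
    (zero_notMem_map_close_close j F)
  have h2 := sim_close_close j (fun a => {wire (.out j) a}) (fun g a h => by simp [h]) F
  exact h1.trans (.trans (by simpa using h2) (sim_wire_close j F))

/-- In a graph-like net, the nodes at an internal wire form a phase and a star. -/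
lemma IsGraphlike.exists_star {F : Net 0 n} (hF : IsGraphlike F) (k : ℕ) :
    ∃ q A C, IsGraphlike C ∧ .int k ∉ A ∧ .int k ∉ allLegs C ∧
      (∀ a ∈ A + allLegs C, a ∈ allLegs F) ∧
      ∀ X, Sim (F + X) (spider .green q {.int k} ::ₘ A.map (had (.int k)) + C + X) := by
  induction F using Multiset.induction_on with
  | empty =>
    refine ⟨0, 0, 0, .zero, by simp, by simp, by simp, fun X => ?_⟩
    simpa using (sim_green_zero (.int k) X).symm
  | cons f F ih =>
    rw [isGraphlike_cons] at hF
    obtain ⟨q, A, C, hC, hkA, hkC, hl, h⟩ := ih hF.2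
    have hl' : ∀ a ∈ A + allLegs C, a ∈ allLegs (f ::ₘ F) := fun a ha => by
      rw [allLegs_cons, mem_add]
      exact .inr (hl a ha)
    have edge : ∀ a b, f = had a b → ∃ q A C, IsGraphlike C ∧ .int k ∉ A ∧ .int k ∉ allLegs C ∧
        (∀ a ∈ A + allLegs C, a ∈ allLegs (f ::ₘ F)) ∧
        ∀ X, Sim (f ::ₘ F + X) (spider .green q {.int k} ::ₘ A.map (had (.int k)) + C + X) := by
      -- A graph-like net with one more edge at `k`.
      have at_k : ∀ b, f = had (.int k) b →
          ∃ q A C, IsGraphlike C ∧ .int k ∉ A ∧ .int k ∉ allLegs C ∧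
          (∀ a ∈ A + allLegs C, a ∈ allLegs (f ::ₘ F)) ∧
          ∀ X, Sim (f ::ₘ F + X) (spider .green q {.int k} ::ₘ A.map (had (.int k)) + C + X) := by
        rintro b rfl
        by_cases hb : b = .int k
        · subst hb
          refine ⟨q, A, C, hC, hkA, hkC, hl', fun X => ?_⟩
          rw [cons_add]
          exact (sim_had_self _ _).trans (h X)
        · refine ⟨q, b ::ₘ A, C, hC, by simp [hkA, Ne.symm hb], hkC, fun a ha => ?_, fun X => ?_⟩
          · rw [cons_add, mem_cons] at ha
            rcases ha with rfl | ha
            · simp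
            · exact hl' a ha
          · refine .trans (.of_eq ?_) ((h (had (.int k) b ::ₘ X)).trans (.of_eq ?_))
            · simp
            · rw [map_cons]
              simp only [← singleton_add]
              ac_rfl
      rintro a b rfl
      by_cases ha : a = .int k
      · exact at_k b (by rw [ha])
      by_cases hb : b = .int k
      · exact at_k a (by rw [hb, had_comm])
      refine ⟨q, A, had a b ::ₘ C, isGraphlike_cons.2 ⟨.inr ⟨a, b, rfl⟩, hC⟩, hkA,
        by simp [hkC, Ne.symm ha, Ne.symm hb], fun x hx => ?_, fun X => ?_⟩
      · simp only [allLegs_cons, mem_add] at hx hl ⊢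
        rcases hx with hx | hx | hx
        exacts [.inr (hl _ (.inl hx)), .inl hx, .inr (hl _ (.inr hx))]
      · refine .trans (.of_eq ?_) ((h (had a b ::ₘ X)).trans (.of_eq ?_)) <;>
        simp only [← singleton_add] <;> ac_rfl
    rcases hF.1 with ⟨p, a, rfl⟩ | ⟨a, b, rfl⟩
    · by_cases ha : a = .int k
      · subst ha
        refine ⟨p + q, A, C, hC, hkA, hkC, hl', fun X => ?_⟩
        have h1 := h (spider .green p {.int k} ::ₘ X)
        have h2 := sim_phase_add p q (.int k) (A.map (had (.int k)) + C + X)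
        refine .trans (.of_eq ?_) (h1.trans (.trans (.of_eq ?_) (h2.trans (.of_eq ?_)))) <;>
        simp only [← singleton_add] <;> ac_rfl
      · refine ⟨q, A, spider .green p {a} ::ₘ C, hC.phase p a, hkA, by simp [hkC, Ne.symm ha],
          fun x hx => ?_, fun X => ?_⟩
        · simp only [allLegs_cons, mem_add] at hx hl ⊢
          rcases hx with hx | hx | hx
          exacts [.inr (hl _ (.inl hx)), .inl hx, .inr (hl _ (.inr hx))]
        · refine .trans (.of_eq ?_) ((h (spider .green p {a} ::ₘ X)).trans (.of_eq ?_)) <;>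
          simp only [← singleton_add] <;> ac_rfl
    · exact edge a b rfl

/-- Elimination of an internal wire at a red spider with phase `00` or `11` in an otherwise
graph-like net. -/
lemma exists_graphlike_of_red (x : ZMod 2) (k : ℕ) (A : Multiset (Name 0 n)) {C : Net 0 n}
    (hC : IsGraphlike C) (hA : .int k ∉ A) :
    ∃ K, IsGraphlike K ∧ (∀ a ∈ allLegs K, a ∈ A + allLegs C ∧ a ≠ .int k) ∧
      Sim (spider .red (x, x) (.int k ::ₘ A) ::ₘ C) K := by
  obtain ⟨q, B, C', hC', hB, hkC, hl, h⟩ := hC.exists_star k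
  obtain ⟨K, hK, hlK, h'⟩ := exists_graphlike_of_eliminate x q k A B hA hB
  refine ⟨K + C', hK.add hC', fun a ha => ?_, ?_⟩
  · simp only [allLegs_add, mem_add] at ha hl hlK ⊢
    rcases ha with ha | ha
    · rcases hlK a ha with ha | ha
      · exact ⟨.inl ha, fun he => hA (he ▸ ha)⟩
      · exact ⟨.inr (hl _ (.inl ha)), fun he => hB (he ▸ ha)⟩
    · exact ⟨.inr (hl _ (.inr ha)), fun he => hkC (he ▸ ha)⟩
  · refine .trans (.of_eq ?_) ((h {spider .red (x, x) (.int k ::ₘ A)}).trans (.trans (.of_eq ?_)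
      (h' C' hkC))) <;>
    simp only [← singleton_add] <;> ac_rfl

end

/-! ### Graph-like nets are reduced -/

section

variable {n : ℕ}

/-- The edges of a simple graph, as pairs in increasing order. -/
noncomputable def edgePairs (G : SimpleGraph (Fin n)) : Finset (Fin n × Fin n) :=
  (Finset.univ : Finset (Fin n × Fin n)).filter fun e => e.1 < e.2 ∧ G.Adj e.1 e.2

lemma edgeName_inj {a b c d : Fin n} : edgeName a b = edgeName c d ↔ a = c ∧ b = d := by
  simp only [edgeName, Name.int.injEq, mul_right_inj' (two_ne_zero), Nat.pair_eq_pair,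
    Fin.val_inj]

/-- Each ordered pair of adjacent vertices gives one end of an edge. -/
lemma allLegs_edges (G : SimpleGraph (Fin n)) :
    allLegs ((edgePairs G).val.map fun e => had (edgeName e.1 e.2) (edgeName e.2 e.1)) =
      ((Finset.univ : Finset (Fin n × Fin n)).filter fun e => G.Adj e.1 e.2).val.map
        fun e => edgeName e.1 e.2 := by
  rw [allLegs_map_had]
  have h : ((Finset.univ : Finset (Fin n × Fin n)).filter fun e => G.Adj e.1 e.2).val =
      (edgePairs G).val + (edgePairs G).val.map Prod.swap := by
    refine (Nodup.ext (Finset.nodup _) ?_).2 fun e => ?_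
    · refine Multiset.nodup_add.2 ⟨Finset.nodup _, (Finset.nodup _).map Prod.swap_injective, ?_⟩
      rw [Multiset.disjoint_left]
      rintro ⟨a, b⟩ h hs
      obtain ⟨⟨c, d⟩, h', he⟩ := mem_map.1 hs
      simp only [edgePairs, Finset.mem_val, Finset.mem_filter, Prod.swap_prod_mk, Prod.mk.injEq]
        at h h' he
      obtain ⟨rfl, rfl⟩ := he
      exact lt_asymm h.2.1 h'.2.1
    · obtain ⟨a, b⟩ := e
      simp only [mem_add, mem_map, edgePairs, Finset.mem_val, Finset.mem_filter, Finset.mem_univ,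
        true_and, Prod.exists, Prod.swap_prod_mk, Prod.mk.injEq]
      constructor
      · intro h
        rcases lt_or_gt_of_ne h.ne with hab | hab
        exacts [.inl ⟨hab, h⟩, .inr ⟨b, a, ⟨hab, h.symm⟩, rfl, rfl⟩]
      · rintro (h | ⟨c, d, h, rfl, rfl⟩)
        exacts [h.2, h.2.symm]
  rw [h, Multiset.map_add, Multiset.map_map]
  rfl

/-- A graph state, as a net, consists of the edges between the outputs: the green nodes of its
diagram are the hubs. -/
lemma realizes_graphState (G : SimpleGraph (Fin n)) :
    Realizes ((edgePairs G).val.map fun e => had (.out e.1) (.out e.2))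
      (graphStateWith G .out) := by
  let ℓ : Name 0 n → Name 0 n := fun x =>
    if h : ∃ e : Fin n × Fin n, edgeName e.1 e.2 = x then .out h.choose.1 else x
  have hℓ : ∀ a b, ℓ (edgeName a b) = .out a := fun a b => by
    have h : ∃ e : Fin n × Fin n, edgeName e.1 e.2 = edgeName a b := ⟨(a, b), rfl⟩
    simp only [ℓ, dif_pos h]
    rw [(edgeName_inj.1 h.choose_spec).1]
  set K : Net 0 n := (edgePairs G).val.map fun e => had (edgeName e.1 e.2) (edgeName e.2 e.1)
    with hK
  have hF : K.map (Node.rename ℓ) = (edgePairs G).val.map fun e => had (.out e.1) (.out e.2) := by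
    rw [hK, Multiset.map_map]
    exact Multiset.map_congr rfl fun e _ => by simp [hℓ]
  refine ⟨K, ℓ, Finset.univ.map ⟨Name.out, fun a b h => by simpa using h⟩, ?_, hF, ?_⟩
  · refine isSkeleton_of_exploded ?_ ?_ ?_ ?_
    · rw [hF]
      intro a ha
      obtain ⟨e, -, rfl⟩ := mem_map.1 ha
      exact arityOK_had _ _
    · rw [hK, allLegs_edges]
      refine Nodup.map (fun e e' h => ?_) (Finset.nodup _)
      exact Prod.ext (edgeName_inj.1 h).1 (edgeName_inj.1 h).2
    · intro x hx
      rw [hK, allLegs_edges] at hx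
      obtain ⟨e, -, rfl⟩ := mem_map.1 hx
      exact ⟨_, rfl⟩
    · intro x hx
      rw [hF, hubLabels, Finset.mem_union, mem_toFinset, allLegs_map_had, mem_add, mem_map, mem_map,
        Finset.mem_image] at hx
      rcases hx with (⟨e, -, rfl⟩ | ⟨e, -, rfl⟩) | ⟨j, -, rfl⟩ <;>
      exact Finset.mem_map.2 ⟨_, Finset.mem_univ _, rfl⟩
  · rw [withHubs, graphStateWith, add_comm, Finset.map_val, Multiset.map_map]
    refine congrArg₂ (· + ·) (Multiset.map_congr rfl fun i _ => ?_) rfl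
    simp only [Function.comp_apply, hub]
    refine congrArg (fun s => spider Colour.green 0 (Name.out i ::ₘ s)) ?_
    have inj : Function.Injective fun e : Fin n × Fin n => edgeName e.1 e.2 := fun e e' h =>
      Prod.ext (edgeName_inj.1 h).1 (edgeName_inj.1 h).2
    rw [hK, allLegs_edges]
    refine (Nodup.ext (((Finset.nodup _).map inj).filter _)
      ((Finset.nodup _).map fun a b h => (edgeName_inj.1 h).2)).2 fun x => ?_
    simp only [mem_filter, mem_map, Finset.mem_val, Finset.mem_filter, Finset.mem_univ, true_and,
      Prod.exists]
    constructor
    · rintro ⟨⟨a, b, h, rfl⟩, ha⟩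
      obtain rfl : a = i := Name.out.inj ((hℓ a b).symm.trans ha)
      exact ⟨b, h, rfl⟩
    · rintro ⟨b, h, rfl⟩
      exact ⟨⟨i, b, h, rfl⟩, hℓ i b⟩

lemma had_eq_had {W : Type} {a b c d : W} (h : had a b = had c d) :
    a = c ∧ b = d ∨ a = d ∧ b = c := by
  have h : a ::ₘ {b} = c ::ₘ ({d} : Multiset W) := congrArg Node.legs h
  have ha : a ∈ c ::ₘ ({d} : Multiset W) := h ▸ mem_cons_self _ _
  rw [mem_cons, mem_singleton] at ha
  rcases ha with rfl | rfl
  · exact .inl ⟨rfl, singleton_inj.1 ((cons_inj_right _).1 h)⟩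
  · rw [cons_pair c a] at h
    exact .inr ⟨rfl, singleton_inj.1 ((cons_inj_right _).1 h)⟩

/-- Edges between distinct outputs without repetitions form a graph state. -/
lemma isReduced_of_simple {F : Net 0 n} (nd : F.Nodup)
    (h : ∀ f ∈ F, ∃ a b, a ≠ b ∧ f = had (.out a) (.out b)) : IsReduced F := by
  let G : SimpleGraph (Fin n) :=
    { Adj := fun a b => a ≠ b ∧ had (.out a) (.out b) ∈ F
      symm := ⟨fun a b h => ⟨h.1.symm, by rw [had_comm]; exact h.2⟩⟩
      loopless := ⟨fun a h => h.1 rfl⟩ }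
  have hF : F = (edgePairs G).val.map fun e => had (.out e.1) (.out e.2) := by
    refine (Nodup.ext nd (Nodup.map_on ?_ (Finset.nodup _))).2 fun f => ?_
    · rintro ⟨a, b⟩ h ⟨c, d⟩ h' he
      simp only [edgePairs, Finset.mem_val, Finset.mem_filter] at h h'
      rcases had_eq_had he with ⟨h1, h2⟩ | ⟨h1, h2⟩ <;> rw [Name.out.injEq] at h1 h2
      · exact Prod.ext h1 h2
      · exact absurd h.2.1 (by
          dsimp only at h1 h2
          rw [h1, h2]
          exact lt_asymm h'.2.1)
    · simp only [mem_map, edgePairs, Finset.mem_val, Finset.mem_filter, Finset.mem_univ,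
        true_and, Prod.exists]
      constructor
      · intro hf
        obtain ⟨a, b, hab, rfl⟩ := h f hf
        rcases lt_or_gt_of_ne hab with hlt | hlt
        · exact ⟨a, b, ⟨hlt, hab, hf⟩, rfl⟩
        · rw [had_comm] at hf ⊢
          exact ⟨b, a, ⟨hlt, hab.symm, hf⟩, rfl⟩
      · rintro ⟨a, b, ⟨-, -, hf⟩, rfl⟩
        exact hf
  refine ⟨[], graphStateWith G .out, ?_, .inl ⟨G, rfl⟩⟩
  have hr := realizes_graphState G
  rw [← hF] at hr
  exact hr.sim hr.isDiagram.realizes_self (Equal.refl _)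

/-- A graph-like net without internal wires is a graph state with phases at the outputs, after loops
and double edges have been removed. -/
lemma isReduced_of_outputs {F : Net 0 n} (hF : IsGraphlike F)
    (h : ∀ k, .int k ∉ allLegs F) : IsReduced F := by
  induction hN : F.card using Nat.strong_induction_on generalizing F with
  | h N ih =>
    subst hN
    have out : ∀ x ∈ allLegs F, ∃ j, x = .out j := fun x hx => by
      rcases x with i | j | k
      exacts [i.elim0, ⟨j, rfl⟩, absurd hx (h k)]
    have sub : ∀ {C : Net 0 n}, C < F → IsReduced C := fun {C} hC =>
      ih _ (card_lt_card hC) (hF.of_le hC.le) (fun k hk => h k (by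
        obtain ⟨f, hf, hx⟩ := mem_allLegs.1 hk
        exact mem_allLegs.2 ⟨f, mem_of_le hC.le hf, hx⟩)) rfl
    by_cases h1 : ∃ p a, spider .green p {a} ∈ F
    · obtain ⟨p, a, hm⟩ := h1
      obtain ⟨C, rfl⟩ := exists_cons_of_mem hm
      obtain ⟨j, rfl⟩ := out a (by simp)
      exact ((sub (lt_cons_self _ _)).applyOp j (.phase .green p)).of_sim
        (sim_applyOp_phase j p C).symm
    by_cases h2 : ∃ a, had a a ∈ F
    · obtain ⟨a, hm⟩ := h2
      obtain ⟨C, rfl⟩ := exists_cons_of_mem hm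
      exact (sub (lt_cons_self _ _)).of_sim (sim_had_self a C)
    have edges : ∀ f ∈ F, ∃ a b, f = had a b := fun f hf =>
      (hF f hf).resolve_left fun ⟨p, a, he⟩ => h1 ⟨p, a, he ▸ hf⟩
    by_cases nd : F.Nodup
    · refine isReduced_of_simple nd fun f hf => ?_
      obtain ⟨a, b, rfl⟩ := edges f hf
      obtain ⟨i, rfl⟩ := out a (mem_allLegs.2 ⟨_, hf, by simp⟩)
      obtain ⟨j, rfl⟩ := out b (mem_allLegs.2 ⟨_, hf, by simp⟩)
      exact ⟨i, j, fun he => h2 ⟨.out i, by rw [he] at hf ⊢; exact hf⟩, rfl⟩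
    · rw [nodup_iff_ne_cons_cons] at nd
      push Not at nd
      obtain ⟨f, C, rfl⟩ := nd
      obtain ⟨a, b, rfl⟩ := edges f (mem_cons_self _ _)
      exact (sub ((lt_cons_self _ _).trans (lt_cons_self _ _))).of_sim (sim_had_cancel a b C)

lemma intNames_card_lt {s t : Multiset (Name 0 n)} {k : ℕ} (hk : .int k ∈ t)
    (h : ∀ a ∈ s, a ∈ t ∧ a ≠ .int k) : (intNames s).card < (intNames t).card := by
  refine Finset.card_lt_card ⟨fun m hm => ?_, fun hs => ?_⟩
  · rw [mem_intNames] at hm ⊢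
    exact (h _ hm).1
  · exact (h _ (mem_intNames.1 (hs (mem_intNames.2 hk)))).2 rfl

lemma intNames_card_le {s t : Multiset (Name 0 n)} (h : ∀ a ∈ s, a ∈ t) :
    (intNames s).card ≤ (intNames t).card :=
  Finset.card_le_card fun m hm => by
    rw [mem_intNames] at hm ⊢
    exact h _ hm

/-- A net with fewer than `N` internal names that is graph-like but for one red spider is reduced,
if all graph-like nets with fewer than `N` internal names are. -/
lemma isReduced_red {N : ℕ} (ih : ∀ F : Net 0 n, IsGraphlike F → (intNames (allLegs F)).card < N →
      IsReduced F) (q : Phase) (A : Multiset (Name 0 n)) {C : Net 0 n} (hC : IsGraphlike C)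
    (hN : (intNames (A + allLegs C)).card < N) : IsReduced (spider .red q A ::ₘ C) := by
  rcases phase_equal_or_mixed q with ⟨x, rfl⟩ | ⟨x, rfl⟩
  swap
  · obtain ⟨K, hK, hl, h⟩ := exists_graphlike_of_mixed x A
    refine (ih _ (hK.add hC) ((intNames_card_le fun a ha => ?_).trans_lt hN)).of_sim (h C)
    rw [allLegs_add, mem_add] at ha
    exact mem_add.2 (ha.imp_left (hl a))
  induction hcard : A.card using Nat.strong_induction_on generalizing A with
  | h c ihA =>
    subst hcard
    rcases A.empty_or_exists_mem with rfl | ⟨w, hw⟩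
    · rcases (by clear ihA; revert x; decide : x = 0 ∨ x = 1) with rfl | rfl
      · exact (ih C hC (by simpa using hN)).of_sim (sim_scalar_empty (0, 0) (by decide) C)
      · exact isReduced_scalar C
    obtain ⟨A, rfl⟩ := exists_cons_of_mem hw
    by_cases hwA : w ∈ A
    · obtain ⟨A, rfl⟩ := exists_cons_of_mem hwA
      refine (ihA A.card (by simp) A ((intNames_card_le fun a ha => ?_).trans_lt hN)
        rfl).of_sim (sim_hopf _ _ _ _)
      rw [mem_add] at ha ⊢
      exact ha.imp_left fun h => mem_cons_of_mem (mem_cons_of_mem h)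
    rcases w with i | j | k
    · exact i.elim0
    · -- Exchanging the colours at the output `j` makes the leg `j` internal.
      refine IsReduced.of_sim (.applyOp ?_ j .had) (sim_applyOp_had_had j _).symm
      rw [applyOp, node_had, map_cons, rename_spider, map_cons, close_self, cons_swap]
      have hC' : IsGraphlike (had (.int 0) (.out j) ::ₘ C.map (Node.rename (Name.close j))) := by
        refine isGraphlike_cons.2 ⟨.inr ⟨_, _, rfl⟩, fun f hf => ?_⟩
        obtain ⟨g, hg, rfl⟩ := mem_map.1 hf
        rcases hC g hg with ⟨p, a, rfl⟩ | ⟨a, b, rfl⟩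
        · exact .inl ⟨p, Name.close j a, by simp⟩
        · exact .inr ⟨Name.close j a, Name.close j b, by simp⟩
      have h0 : ∀ y : Name 0 n, Name.close j y = .int 0 → y = .out j := fun y hy =>
        close_injective j (hy.trans (close_self j).symm)
      obtain ⟨K, hK, hl, h⟩ := exists_graphlike_of_red x 0 (A.map (Name.close j)) hC' fun hm => by
        obtain ⟨y, hy, he⟩ := mem_map.1 hm
        exact hwA (h0 y he ▸ hy)
      refine (ih K hK (lt_of_le_of_lt ?_ hN)).of_sim h
      refine (Finset.card_le_card (t := (intNames _).image (· + 1)) fun m hm => ?_).trans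
        Finset.card_image_le
      rw [mem_intNames] at hm
      obtain ⟨hm, hm0⟩ := hl _ hm
      have : .int m ∈ (A + allLegs C).map (Name.close j) := by
        simp only [allLegs_cons, had_legs, allLegs_map_rename, insert_eq_cons, cons_add,
          singleton_add, add_cons, mem_cons, mem_add, Multiset.map_add] at hm ⊢
        rcases hm with hm | hm | hm
        exacts [absurd hm hm0, absurd hm (by simp), hm]
      obtain ⟨y, hy, he⟩ := mem_map.1 this
      rw [Finset.mem_image]
      rcases y with i | i | k
      · exact i.elim0
      · by_cases hij : i = j
        · subst hij
          exact absurd he.symm (by rw [close_self]; exact hm0)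
        · rw [close_of_ne hij] at he
          cases he
      · refine ⟨k, mem_intNames.2 ?_, by simpa using he⟩
        rw [cons_add]
        exact mem_cons_of_mem hy
    · obtain ⟨K, hK, hl, h⟩ := exists_graphlike_of_red x k A hC hwA
      refine (ih K hK (lt_of_lt_of_le ?_ hN.le)).of_sim h
      refine intNames_card_lt (k := k) (by simp) fun a ha => ⟨?_, (hl a ha).2⟩
      rw [cons_add]
      exact mem_cons_of_mem (hl a ha).1

/-- Every graph-like net arises from a graph state by local operations, unless it is inconsistent:
internal wires are eliminated one by one. -/
theorem IsGraphlike.isReduced {F : Net 0 n} (hF : IsGraphlike F) : IsReduced F := by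
  induction hN : (intNames (allLegs F)).card using Nat.strong_induction_on generalizing F with
  | h N ih =>
    subst hN
    by_cases h : ∃ k, .int k ∈ allLegs F
    · obtain ⟨k, hk⟩ := h
      obtain ⟨q, A, C, hC, hA, hkC, hl, h⟩ := hF.exists_star k
      refine (isReduced_red (fun F hF h => ih _ h hF rfl) q A hC (intNames_card_lt hk fun a ha =>
        ⟨hl a ha, ?_⟩)).of_sim ?_
      · rintro rfl
        exact (mem_add.1 ha).elim hA hkC
      · have := h 0
        rw [add_zero, add_zero] at this
        exact this.trans (sim_red q k A C hA hkC).symm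
    · exact isReduced_of_outputs hF fun k hk => h ⟨k, hk⟩

end

/-! ### Chains of local operations and their normal forms -/

section

variable {n : ℕ}

lemma exists_graphlike_red (p : Phase) (A : Multiset (Name 0 n)) {K : Net 0 n}
    (hK : IsGraphlike K) (F : Net 0 n) :
    ∃ K', IsGraphlike K' ∧ Sim (spider .red p A ::ₘ (F + K)) (F + K') := by
  obtain ⟨k, hk⟩ := exists_fresh (A + allLegs (F + K))
  rw [mem_add, not_or] at hk
  refine ⟨spider .green p {.int k} ::ₘ A.map (had (.int k)) + K,
    ((IsGraphlike.star _ _).phase _ _).add hK, (sim_red p k A _ hk.1 hk.2).trans (.of_eq ?_)⟩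
  simp only [← singleton_add]
  ac_rfl

/-- Every net is similar to a graph-like one: green spiders are turned into red ones by colour
change, and these into phased hubs with edges. -/
lemma exists_graphlike_add {F : Net 0 n} (har : ∀ f ∈ F, f.ArityOK) {K : Net 0 n}
    (hK : IsGraphlike K) : ∃ K', IsGraphlike K' ∧ Sim (F + K) K' := by
  induction F using Multiset.induction_on generalizing K with
  | empty => exact ⟨K, hK, by simpa using Sim.refl K⟩
  | cons f F ih =>
    have red : ∀ (p : Phase) (A : Multiset (Name 0 n)) {K : Net 0 n}, IsGraphlike K →
        ∃ K', IsGraphlike K' ∧ Sim (spider .red p A ::ₘ (F + K)) K' := fun p A K hK => by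
      obtain ⟨K₁, hK₁, h₁⟩ := exists_graphlike_red p A hK F
      obtain ⟨K₂, hK₂, h₂⟩ := ih (fun f hf => har f (mem_cons_of_mem hf)) hK₁
      exact ⟨K₂, hK₂, h₁.trans h₂⟩
    have hf := har f (mem_cons_self _ _)
    rw [cons_add]
    rcases f with ⟨⟨c, p⟩ | _ | _, l⟩
    · cases c
      · change ∃ K', IsGraphlike K' ∧ Sim (spider .green p l ::ₘ (F + K)) K'
        obtain ⟨ends, rfl, nd, h⟩ := exists_fresh_ends l (l + allLegs (F + K))
        have hc := sim_colourChange .red p ends (F + K) nd fun x hx => by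
          have := h x hx
          simp only [mem_add, not_or] at this
          tauto
        obtain ⟨K', hK', h'⟩ := red p (ends.map Prod.snd)
          (K := (ends.map fun o => had o.2 o.1) + K) (IsGraphlike.add (fun f hf => by
            obtain ⟨o, -, rfl⟩ := mem_map.1 hf
            exact .inr ⟨_, _, rfl⟩) hK)
        refine ⟨K', hK', hc.symm.trans (.trans (.of_eq ?_) h')⟩
        simp only [← singleton_add]
        ac_rfl
      · exact red p l hK
    · obtain ⟨a, b, rfl⟩ := card_eq_two.1 hf
      obtain ⟨K', hK', h'⟩ := ih (fun f hf => har f (mem_cons_of_mem hf))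
        (isGraphlike_cons.2 ⟨.inr ⟨a, b, rfl⟩, hK⟩)
      rw [add_cons] at h'
      exact ⟨K', hK', h'⟩
    · obtain ⟨a, b, rfl⟩ := card_eq_two.1 hf
      obtain ⟨K', hK', h'⟩ := red 0 {a, b} hK
      exact ⟨K', hK', (sim_identity .red a b _).symm.trans h'⟩

lemma isReduced_of_arity {F : Net 0 n} (har : ∀ f ∈ F, f.ArityOK) : IsReduced F := by
  obtain ⟨K, hK, h⟩ := exists_graphlike_add har IsGraphlike.zero
  rw [add_zero] at h
  exact hK.isReduced.of_sim h

/-- Applying a list of local operations to the output `j`, the first one first. -/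
def applyList (j : Fin n) (l : List LocalOp) (F : Net 0 n) : Net 0 n :=
  l.foldl (fun F o => applyOp j o F) F

lemma applyList_append (j : Fin n) (l l' : List LocalOp) (F : Net 0 n) :
    applyList j (l ++ l') F = applyList j l' (applyList j l F) := List.foldl_append

lemma Sim.applyList {F G : Net 0 n} (h : Sim F G) (j : Fin n) (l : List LocalOp) :
    Sim (applyList j l F) (applyList j l G) := by
  induction l generalizing F G with
  | nil => exact h
  | cons o l ih => exact ih (h.applyOp j o)

/-- Two chains of local operations are equivalent if they have the same effect on every output of
every net. -/
def OpEquiv (n : ℕ) (l l' : List LocalOp) : Prop :=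
  ∀ (j : Fin n) F, Sim (applyList j l F) (applyList j l' F)

lemma OpEquiv.refl (l : List LocalOp) : OpEquiv n l l := fun _ _ => Sim.refl _
lemma OpEquiv.symm {l l' : List LocalOp} (h : OpEquiv n l l') : OpEquiv n l' l :=
  fun j F => (h j F).symm
lemma OpEquiv.trans {l l' l'' : List LocalOp} (h : OpEquiv n l l') (h' : OpEquiv n l' l'') :
    OpEquiv n l l'' := fun j F => (h j F).trans (h' j F)

lemma OpEquiv.inside {l l' : List LocalOp} (h : OpEquiv n l l') (a b : List LocalOp) :
    OpEquiv n (a ++ l ++ b) (a ++ l' ++ b) := fun j F => by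
  simp only [applyList_append]
  exact (h j _).applyList j b

lemma close_close_ne_one (j : Fin n) (F : Net 0 n) : .int 1 ∉ allLegs (F.map (Node.rename
    fun x => Name.close j (Name.close j (Name.close j x)))) ∧ .int 0 ∉ allLegs (F.map (Node.rename
    fun x => Name.close j (Name.close j (Name.close j x)))) := by
  simp only [allLegs_map_rename, mem_map, not_exists, not_and]
  refine ⟨fun x _ hx => ?_, fun x _ hx => ?_⟩
  · rw [← close_int j, ← close_self j] at hx
    exact close_ne_out j x (close_injective j (close_injective j hx))
  · rw [← close_self j] at hx
    exact close_ne_out j _ (close_injective j hx)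

lemma opEquiv_fuse (c : Colour) (p q : Phase) :
    OpEquiv n [.phase c p, .phase c q] [.phase c (p + q)] := fun j F => by
  change Sim (applyOp j _ (applyOp j _ F)) (applyOp j _ F)
  rw [applyOp_applyOp, node_phase, node_phase]
  have h1 := sim_fuse c q p 0 {.out j} {.int 1}
    (F.map (Node.rename (fun x => Name.close j (Name.close j x)))) (by simp) (by simp)
    (zero_notMem_map_close_close j F)
  have h2 := sim_close_close j (fun a => {spider c (p + q) {a, .out j}})
    (fun g a h => by simp [h]) F
  rw [insert_eq_cons, insert_eq_cons, cons_pair (.int 1 : Name 0 n)]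
  refine h1.trans (.trans (.of_eq ?_) h2)
  rw [add_comm q, singleton_add, singleton_add, cons_pair]
  rfl

lemma opEquiv_id (c : Colour) : OpEquiv n [.phase c 0] [] := fun j F => by
  change Sim (applyOp j _ F) F
  rw [applyOp, node_phase, pair_comm]
  exact (sim_identity c _ _ _).trans (sim_wire_close j F)

lemma opEquiv_comm11 (c : Colour) (x y : ZMod 2) :
    OpEquiv n [.phase c.other (1, 1), .phase c (x, y)] [.phase c (y, x), .phase c.other (1, 1)] :=
  fun j F => by
    change Sim (applyOp j _ (applyOp j _ F)) (applyOp j _ (applyOp j _ F))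
    rw [applyOp_applyOp, applyOp_applyOp]
    simp only [node_phase]
    have h0 := zero_notMem_map_close_close j F
    have := sim_comm11 c x y 0 0 (.int 1) (.out j)
      (F.map (Node.rename (fun x => Name.close j (Name.close j x)))) (by simp) (by simp) h0
      (by simp) (by simp) h0
    rw [cons_swap] at this
    exact this.trans (.of_eq (cons_swap _ _ _))

lemma opEquiv_euler (c : Colour) :
    OpEquiv n [.had] [.phase c (0, 1), .phase c.other (0, 1), .phase c (0, 1)] := fun j F => by
  change Sim (applyOp j _ F) (applyOp j _ (applyOp j _ (applyOp j _ F)))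
  obtain ⟨h1, h0⟩ := close_close_ne_one j F
  have h2 := sim_euler c 1 0 (by simp) (.int 2) (.out j) (F.map (Node.rename
    fun x => Name.close j (Name.close j (Name.close j x)))) (by simp) (by simp) h1 (by simp)
    (by simp) h0
  refine .trans (sim_rename _ (f := (· + 2)) fun _ _ _ _ => by simp) (.trans (.of_eq ?_)
    (h2.trans (.of_eq ?_)))
  · rw [applyOp, node_had, map_cons, rename_had, map_rename_rename]
    refine congrArg₂ cons rfl (map_rename_congr fun x _ => ?_)
    rcases x with i | i | k
    · exact i.elim0
    · by_cases h : i = j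
      · subst h
        simp
      · simp [close_of_ne h]
    · rfl
  · rw [applyOp_applyOp, applyOp]
    simp only [map_cons, rename_node, close_int, close_self, map_rename_rename,
      Function.comp_def, zero_add, Nat.reduceAdd]
    simp only [node_phase, ← singleton_add]
    ac_rfl

lemma opEquiv_eleven (c : Colour) (x y : ZMod 2) :
    OpEquiv n [.phase c (x, y), .phase c.other (1, 1)] [.phase c.other (1, 1), .phase c (y, x)] :=
  (opEquiv_comm11 c y x).symm

lemma opEquiv_cancel (c : Colour) (p : Phase) : OpEquiv n [.phase c p, .phase c p] [] := by
  refine (opEquiv_fuse c p p).trans ?_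
  rw [show p + p = 0 by revert p; decide]
  exact opEquiv_id c

/-- The local operation `o` is absorbed by the normal forms: a chain in normal form followed by `o`
is equivalent to a chain in normal form. -/
def Absorbs (n : ℕ) (o : LocalOp) : Prop :=
  ∀ l, IsNormal l → ∃ l', IsNormal l' ∧ OpEquiv n (l ++ [o]) l'

lemma Absorbs.list {l₀ : List LocalOp} (h : ∀ o ∈ l₀, Absorbs n o) {l : List LocalOp}
    (hl : IsNormal l) : ∃ l', IsNormal l' ∧ OpEquiv n (l ++ l₀) l' := by
  induction l₀ generalizing l with
  | nil => exact ⟨l, hl, by simpa using OpEquiv.refl l⟩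
  | cons o l₀ ih =>
    obtain ⟨l₁, hl₁, e₁⟩ := h o List.mem_cons_self l hl
    obtain ⟨l₂, hl₂, e₂⟩ := ih (fun o ho => h o (List.mem_cons_of_mem _ ho)) hl₁
    refine ⟨l₂, hl₂, ?_⟩
    have := e₁.inside [] l₀
    simp only [List.nil_append, List.append_assoc] at this
    exact this.trans e₂

lemma Absorbs.of_equiv {l₀ : List LocalOp} (h : ∀ o ∈ l₀, Absorbs n o) {o : LocalOp}
    (e : OpEquiv n [o] l₀) : Absorbs n o := fun l hl => by
  obtain ⟨l', hl', e'⟩ := Absorbs.list h hl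
  refine ⟨l', hl', ?_⟩
  have := e.inside l []
  simp only [List.append_nil] at this
  exact this.trans e'

lemma absorbs_red_eleven : Absorbs n (.phase .red (1, 1)) := by
  rintro _ (⟨a, b, c, d⟩ | ⟨e, f, g⟩)
  · refine ⟨_, .two b a (c + 1) (d + 1), ?_⟩
    exact .trans ((opEquiv_eleven .green a b).inside [.phase .red (c, d)] [])
      ((opEquiv_fuse .red (c, d) (1, 1)).inside [] [.phase .green (b, a)])
  · refine ⟨_, .three (e + 1) (f + 1) (g + 1), ?_⟩
    have h1 : OpEquiv n [.phase .red (0, 1), .phase .red (1, 1)]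
        [.phase .red (1, 1), .phase .red (0, 1)] := by
      refine (opEquiv_fuse _ _ _).trans ?_
      rw [add_comm]
      exact (opEquiv_fuse _ _ _).symm
    have he : e + 1 + 1 = e := by revert e; decide
    rw [he]
    refine .trans (h1.inside [.phase .red (f, g), .phase .green (e, e + 1)] []) ?_
    refine .trans ((opEquiv_eleven .green e (e + 1)).inside [.phase .red (f, g)]
      [.phase .red (0, 1)]) ?_
    exact (opEquiv_fuse .red (f, g) (1, 1)).inside []
      [.phase .green (e + 1, e), .phase .red (0, 1)]

lemma absorbs_red_zeroOne : Absorbs n (.phase .red (0, 1)) := by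
  rintro _ (⟨a, b, c, d⟩ | ⟨e, f, g⟩)
  · rcases phase_cases (a, b) with h | h | ⟨x, h⟩ <;>
      obtain ⟨rfl, rfl⟩ : a = _ ∧ b = _ := Prod.mk.inj h
    · refine ⟨_, .two 0 0 (c + 0) (d + 1), ?_⟩
      refine .trans ((opEquiv_id .green).inside [.phase .red (c, d)] [.phase .red (0, 1)]) ?_
      refine .trans (opEquiv_fuse .red (c, d) (0, 1)) ?_
      exact (opEquiv_id .green).symm.inside [.phase .red (c + 0, d + 1)] []
    · refine ⟨_, .two 1 1 (c + 1) (d + 0), ?_⟩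
      refine .trans ((opEquiv_comm11 .red 0 1).inside [.phase .red (c, d)] []) ?_
      exact (opEquiv_fuse .red (c, d) (1, 0)).inside [] [.phase .green (1, 1)]
    · exact ⟨_, .three a c d, OpEquiv.refl _⟩
  · refine ⟨_, .two e (e + 1) f g, ?_⟩
    exact (opEquiv_cancel .red (0, 1)).inside [.phase .red (f, g), .phase .green (e, e + 1)] []

lemma absorbs_green_eleven : Absorbs n (.phase .green (1, 1)) := by
  rintro _ (⟨a, b, c, d⟩ | ⟨e, f, g⟩)
  · refine ⟨_, .two (a + 1) (b + 1) c d, ?_⟩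
    exact (opEquiv_fuse .green (a, b) (1, 1)).inside [.phase .red (c, d)] []
  · have he : e + 1 + 1 = e := by revert e; decide
    refine ⟨_, .three e (f + 1) (g + 1), ?_⟩
    -- The new phase passes the last phase shift, which turns into `10 = 11 + 01`.
    refine .trans ((opEquiv_eleven .red 0 1).inside
      [.phase .red (f, g), .phase .green (e, e + 1)] []) ?_
    refine .trans ((opEquiv_fuse .green (e, e + 1) (1, 1)).inside [.phase .red (f, g)]
      [.phase .red (1, 0)]) ?_
    refine .trans ((opEquiv_fuse .red (1, 1) (0, 1)).symm.inside
      [.phase .red (f, g), .phase .green (e + 1, e + 1 + 1)] []) ?_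
    refine .trans ((opEquiv_eleven .green (e + 1) (e + 1 + 1)).inside [.phase .red (f, g)]
      [.phase .red (0, 1)]) ?_
    rw [he]
    exact (opEquiv_fuse .red (f, g) (1, 1)).inside []
      [.phase .green (e, e + 1), .phase .red (0, 1)]

/-- Both sides are Euler decompositions of the colour-changing operation. -/
lemma opEquiv_braid : OpEquiv n
    [.phase .green (0, 1), .phase .red (0, 1), .phase .green (0, 1)]
    [.phase .red (0, 1), .phase .green (0, 1), .phase .red (0, 1)] :=
  (opEquiv_euler .green).symm.trans (opEquiv_euler .red)

lemma absorbs_green_zeroOne : Absorbs n (.phase .green (0, 1)) := by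
  rintro _ (⟨a, b, c, d⟩ | ⟨e, f, g⟩)
  · refine ⟨_, .two (a + 0) (b + 1) c d, ?_⟩
    exact (opEquiv_fuse .green (a, b) (0, 1)).inside [.phase .red (c, d)] []
  · induction e using zmod_two_cases with
    | h0 =>
      refine ⟨_, .three 0 (f + 0) (g + 1), ?_⟩
      refine .trans (opEquiv_braid.inside [.phase .red (f, g)] []) ?_
      exact (opEquiv_fuse .red (f, g) (0, 1)).inside [] [.phase .green (0, 1), .phase .red (0, 1)]
    | h1 =>
      refine ⟨_, .three 1 (f + 1) (g + 0), ?_⟩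
      -- The phase `10` is split into `11` and `01`, to which the braid relation applies.
      refine .trans ((opEquiv_fuse .green (1, 1) (0, 1)).symm.inside [.phase .red (f, g)]
        [.phase .red (0, 1), .phase .green (0, 1)]) ?_
      refine .trans (opEquiv_braid.inside [.phase .red (f, g), .phase .green (1, 1)] []) ?_
      refine .trans ((opEquiv_comm11 .red 0 1).inside [.phase .red (f, g)]
        [.phase .green (0, 1), .phase .red (0, 1)]) ?_
      refine .trans ((opEquiv_fuse .red (f, g) (1, 0)).inside []
        [.phase .green (1, 1), .phase .green (0, 1), .phase .red (0, 1)]) ?_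
      exact (opEquiv_fuse .green (1, 1) (0, 1)).inside [.phase .red (f + 1, g + 0)]
        [.phase .red (0, 1)]

/-- The normal forms are closed under composition with any local operation. -/
lemma absorbs (o : LocalOp) : Absorbs n o := by
  have phase : ∀ c p, Absorbs n (.phase c p) := fun c p => by
    have h1 : Absorbs n (.phase c (1, 1)) := by
      cases c
      exacts [absorbs_green_eleven, absorbs_red_eleven]
    have h2 : Absorbs n (.phase c (0, 1)) := by
      cases c
      exacts [absorbs_green_zeroOne, absorbs_red_zeroOne]
    obtain ⟨x, y⟩ := p
    induction x using zmod_two_cases <;> induction y using zmod_two_cases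
    · exact .of_equiv (l₀ := []) (by simp) (opEquiv_id c)
    · exact h2
    · exact .of_equiv (l₀ := [.phase c (1, 1), .phase c (0, 1)]) (by simp [h1, h2])
        (opEquiv_fuse c (1, 1) (0, 1)).symm
    · exact h1
  cases o with
  | phase c p => exact phase c p
  | had => exact .of_equiv (by simp [phase]) (opEquiv_euler .green)

end

/-! ### GS-LO diagrams -/

section

variable {n : ℕ}

lemma opName_inj {i j : Fin n} {s t : ℕ} : opName i s = opName j t ↔ i = j ∧ s = t := by
  simp only [opName, Name.int.injEq, Nat.add_right_cancel_iff, mul_right_inj' (two_ne_zero),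
    Nat.pair_eq_pair, Fin.val_inj]

lemma opName_ne_edgeName (i j k : Fin n) (t : ℕ) : opName i t ≠ edgeName j k := by
  simp only [opName, edgeName, ne_eq, Name.int.injEq]
  omega

lemma opStart_cases (i : Fin n) (t : ℕ) (l : List LocalOp) :
    opStart i t l = .out i ∧ l = [] ∨ opStart i t l = opName i t ∧ l ≠ [] := by
  cases l <;> simp [opStart]

lemma mem_allLegs_opNodes {i : Fin n} {t : ℕ} {l : List LocalOp} {x : Name 0 n}
    (hx : x ∈ allLegs (opNodes i t l)) :
    x = .out i ∨ ∃ s, s < t + l.length ∧ x = opName i s := by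
  induction l generalizing t with
  | nil => simp [opNodes] at hx
  | cons o l ih =>
    rw [opNodes, allLegs_cons, mem_add, insert_eq_cons, mem_cons, mem_singleton] at hx
    rcases hx with (rfl | rfl) | hx
    · exact .inr ⟨t, by simp, rfl⟩
    · rcases opStart_cases i (t + 1) l with ⟨h, -⟩ | ⟨h, hl⟩
      · exact .inl h
      · have := List.length_pos_iff.2 hl
        exact .inr ⟨t + 1, by simp; omega, h⟩
    · rcases ih hx with h | ⟨s, hs, h⟩
      · exact .inl h
      · exact .inr ⟨s, by simp; omega, h⟩

lemma mem_allLegs_graphStateWith {G : SimpleGraph (Fin n)} {tip : Fin n → Name 0 n}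
    {x : Name 0 n} (hx : x ∈ allLegs (graphStateWith G tip)) :
    (∃ i, x = tip i) ∨ ∃ i j, x = edgeName i j := by
  obtain ⟨a, ha, hx⟩ := mem_allLegs.1 hx
  rw [graphStateWith, mem_add, mem_map, mem_map] at ha
  rcases ha with ⟨i, -, rfl⟩ | ⟨e, -, rfl⟩
  · rw [spider_legs, mem_cons, mem_map] at hx
    rcases hx with rfl | ⟨j, -, rfl⟩
    exacts [.inl ⟨i, rfl⟩, .inr ⟨i, j, rfl⟩]
  · rw [had_legs, insert_eq_cons, mem_cons, mem_singleton] at hx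
    rcases hx with rfl | rfl
    exacts [.inr ⟨_, _, rfl⟩, .inr ⟨_, _, rfl⟩]

lemma mem_allLegs_sum {ι : Type} {s : Finset ι} {f : ι → Net 0 n} {x : Name 0 n}
    (hx : x ∈ allLegs (∑ i ∈ s, f i)) : ∃ i, x ∈ allLegs (f i) := by
  obtain ⟨a, ha, hx⟩ := mem_allLegs.1 hx
  obtain ⟨i, -, hi⟩ := Multiset.mem_sum.1 ha
  exact ⟨i, mem_allLegs.2 ⟨a, hi, hx⟩⟩

/-- The name that a further operation on the output `j` would get is not used. -/
lemma opName_length_notMem (G : SimpleGraph (Fin n)) (ops : Fin n → List LocalOp) (j : Fin n) :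
    opName j (ops j).length ∉ allLegs (gsLO G ops) := by
  rw [gsLO, allLegs_add, mem_add]
  rintro (h | h)
  · rcases mem_allLegs_graphStateWith h with ⟨i, h⟩ | ⟨i, k, h⟩
    · rcases opStart_cases i 0 (ops i) with ⟨h', -⟩ | ⟨h', hl⟩
      · rw [h'] at h
        cases h
      · rw [h', opName_inj] at h
        obtain ⟨rfl, h⟩ := h
        exact hl (List.length_eq_zero_iff.1 h)
    · exact opName_ne_edgeName _ _ _ _ h
  · obtain ⟨i, h⟩ := mem_allLegs_sum h
    rcases mem_allLegs_opNodes h with h | ⟨s, hs, h⟩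
    · cases h
    · rw [opName_inj] at h
      obtain ⟨rfl, rfl⟩ := h
      omega

section Append

variable {g : Name 0 n → Name 0 n} {j : Fin n} {t : ℕ}

lemma map_opStart_of_ne (hi : ∀ i, i ≠ j → g (.out i) = .out i) (hk : ∀ k, g (.int k) = .int k)
    {i : Fin n} (h : i ≠ j) (s : ℕ) (l : List LocalOp) :
    g (opStart i s l) = opStart i s l := by
  cases l
  exacts [hi i h, hk _]

lemma map_opStart_self (hj : g (.out j) = opName j t) (hk : ∀ k, g (.int k) = .int k)
    (o : LocalOp) (s : ℕ) (l : List LocalOp)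
    (h : s + l.length = t) : g (opStart j s l) = opStart j s (l ++ [o]) := by
  cases l
  · subst h
    exact hj
  · exact hk _

lemma map_opNodes_of_ne (hi : ∀ i, i ≠ j → g (.out i) = .out i) (hk : ∀ k, g (.int k) = .int k)
    {i : Fin n} (h : i ≠ j) (s : ℕ) (l : List LocalOp) :
    (opNodes i s l).map (Node.rename g) = opNodes i s l := by
  induction l generalizing s with
  | nil => rfl
  | cons o l ih =>
    rw [opNodes, map_cons, ih]
    change (LocalOp.node o _ _).rename g ::ₘ _ = _
    rw [rename_node, map_opStart_of_ne hi hk h, opName, hk]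
    rfl

lemma map_opNodes_self (hj : g (.out j) = opName j t) (hk : ∀ k, g (.int k) = .int k)
    (o : LocalOp) (s : ℕ) (l : List LocalOp)
    (h : s + l.length = t) :
    o.node (opName j t) (.out j) ::ₘ (opNodes j s l).map (Node.rename g) =
      opNodes j s (l ++ [o]) := by
  induction l generalizing s with
  | nil =>
    subst h
    rfl
  | cons o' l ih =>
    have h' : s + 1 + l.length = t := by simpa [add_assoc, add_comm 1] using h
    rw [List.cons_append, opNodes, opNodes, map_cons, cons_swap, ih _ h']
    change (LocalOp.node o' _ _).rename g ::ₘ _ = _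
    rw [rename_node, map_opStart_self hj hk o _ _ h', opName, hk]
    rfl

end Append

/-- Up to the names of the internal wires, applying a local operation to a GS-LO diagram amounts to
appending it to the chain of operations at that output. -/
lemma applyOp_gsLO (G : SimpleGraph (Fin n)) (ops : Fin n → List LocalOp) (j : Fin n)
    (o : LocalOp) :
    ∃ f : ℕ → ℕ, Set.InjOn f (intNames (allLegs (applyOp j o (gsLO G ops)))) ∧
      (applyOp j o (gsLO G ops)).map (Node.rename (Name.mapInt f)) =
        gsLO G (Function.update ops j (ops j ++ [o])) := by
  set t := (ops j).length with ht
  let f : ℕ → ℕ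
    | 0 => 2 * Nat.pair j t + 1
    | k + 1 => k
  have key : ∀ k, k + 1 ∈ intNames (allLegs (applyOp j o (gsLO G ops))) →
      k ≠ 2 * Nat.pair j t + 1 := by
    rintro k hk rfl
    rw [mem_intNames, applyOp, allLegs_cons, allLegs_map_rename, mem_add, node_legs,
      ← close_int j] at hk
    rcases hk with hk | hk
    · simp at hk
    · obtain ⟨x, hx, he⟩ := mem_map.1 hk
      rw [close_injective j he] at hx
      exact opName_length_notMem G ops j hx
  refine ⟨f, ?_, ?_⟩
  · rintro (_ | a) ha (_ | b) hb h
    · rfl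
    · exact absurd h.symm (key b hb)
    · exact absurd h (key a ha)
    · exact congrArg (· + 1) h
  · set g : Name 0 n → Name 0 n := Name.mapInt f ∘ Name.close j with hg
    have hj : g (.out j) = opName j t := by simp [hg, f, opName]
    have hi : ∀ i, i ≠ j → g (.out i) = .out i := fun i h => by simp [hg, close_of_ne h]
    have hk : ∀ k, g (.int k) = .int k := fun k => rfl
    have ops' : ∀ i, (if i = j then {o.node (opName j t) (.out j)} else 0) +
        (opNodes i 0 (ops i)).map (Node.rename g) =
        opNodes i 0 (Function.update ops j (ops j ++ [o]) i) := fun i => by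
      split_ifs with h
      · subst h
        rw [Function.update_self, singleton_add]
        exact map_opNodes_self hj hk o 0 _ (by simp [ht])
      · rw [Function.update_of_ne h, zero_add]
        exact map_opNodes_of_ne hi hk h 0 _
    have tips : ∀ i, g (opStart i 0 (ops i)) =
        opStart i 0 (Function.update ops j (ops j ++ [o]) i) := fun i => by
      by_cases h : i = j
      · subst h
        rw [Function.update_self]
        exact map_opStart_self hj hk o 0 _ (by simp [ht])
      · rw [Function.update_of_ne h]
        exact map_opStart_of_ne hi hk h 0 _
    rw [applyOp, map_cons, map_rename_rename, ← hg, rename_node, mapInt_int, mapInt_out, gsLO,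
      Multiset.map_add, gsLO]
    change o.node (opName j t) (.out j) ::ₘ _ = _
    rw [← Multiset.coe_mapAddMonoidHom, map_sum, ← singleton_add]
    simp only [Multiset.coe_mapAddMonoidHom]
    rw [← Finset.sum_congr rfl fun i _ => ops' i, Finset.sum_add_distrib,
      Finset.sum_ite_eq' Finset.univ j, if_pos (Finset.mem_univ _), add_left_comm]
    refine congrArg₂ (· + ·) ?_ rfl
    rw [graphStateWith, graphStateWith, Multiset.map_add, Multiset.map_map, Multiset.map_map]
    refine congrArg₂ (· + ·) (Multiset.map_congr rfl fun i _ => ?_)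
      (Multiset.map_congr rfl fun e _ => ?_)
    · simp only [Function.comp_apply, rename_spider, map_cons, tips, Multiset.map_map]
      refine congrArg (fun s => spider Colour.green 0 (_ ::ₘ s))
          (Multiset.map_congr rfl fun k _ => ?_)
      simp only [edgeName, hk]
    · simp only [Function.comp_apply, rename_had, edgeName, hk]

lemma gsLO_nil (G : SimpleGraph (Fin n)) : gsLO G (fun _ => []) = graphStateWith G .out := by
  simp only [gsLO, opNodes, Finset.sum_const_zero, add_zero]
  rfl

lemma sim_gsLO (G : SimpleGraph (Fin n)) (ops : Fin n → List LocalOp) (j : Fin n) (o : LocalOp) :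
    Sim (applyOp j o (gsLO G ops)) (gsLO G (Function.update ops j (ops j ++ [o]))) := by
  obtain ⟨f, hf, h⟩ := applyOp_gsLO G ops j o
  exact (sim_rename _ hf).trans (.of_eq h)

lemma sim_gsLO_list (G : SimpleGraph (Fin n)) (ops : Fin n → List LocalOp) (j : Fin n)
    (l : List LocalOp) :
    Sim (applyList j l (gsLO G ops)) (gsLO G (Function.update ops j (ops j ++ l))) := by
  induction l generalizing ops with
  | nil =>
    rw [List.append_nil, Function.update_eq_self]
    exact Sim.refl _
  | cons o l ih =>
    refine ((sim_gsLO G ops j o).applyList j l).trans ((ih _).trans (.of_eq ?_))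
    rw [Function.update_self, Function.update_idem, List.append_assoc, List.singleton_append]

/-- A GS-LO diagram arises from the diagram of a graph state by local operations, up to the names of
the internal wires. -/
lemma isDiagram_gsLO (G : SimpleGraph (Fin n)) (ops : Fin n → List LocalOp) :
    IsDiagram (gsLO G ops) := by
  induction hN : ∑ i, (ops i).length generalizing ops with
  | zero =>
    have : ops = fun _ => [] := funext fun i =>
      List.length_eq_zero_iff.1 ((Finset.sum_eq_zero_iff.1 hN) i (Finset.mem_univ i))
    rw [this, gsLO_nil]
    exact (realizes_graphState G).isDiagram
  | succ N ih =>
    obtain ⟨j, hj⟩ : ∃ j, ops j ≠ [] := by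
      by_contra h
      push Not at h
      simp [h] at hN
    rcases List.eq_nil_or_concat (ops j) with h | ⟨l, o, h⟩
    · exact absurd h hj
    rw [List.concat_eq_append] at h
    set ops' := Function.update ops j l with hops'
    have he : ops = Function.update ops' j (ops' j ++ [o]) := by
      rw [hops', Function.update_self, Function.update_idem, ← h, Function.update_eq_self]
    have hN' : ∑ i, (ops' i).length = N := by
      rw [← Finset.add_sum_erase _ _ (Finset.mem_univ j)] at hN ⊢
      rw [h, List.length_append] at hN
      have : ∑ i ∈ Finset.univ.erase j, (ops' i).length =
          ∑ i ∈ Finset.univ.erase j, (ops i).length :=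
        Finset.sum_congr rfl fun i hi => by rw [hops', Function.update_of_ne
            (Finset.ne_of_mem_erase hi)]
      rw [this, hops', Function.update_self]
      simp only [List.length_singleton] at hN
      omega
    have hD := (ih ops' hN').applyOp j o
    obtain ⟨f, hf, hfe⟩ := applyOp_gsLO G ops' j o
    obtain ⟨σ, hσ⟩ := exists_perm_extending hf
    rw [he, ← hfe]
    have := hD.rename σ
    rwa [map_rename_congr (g := Name.mapInt f)] at this
    rintro (i | i | k) hx
    · rfl
    · rfl
    · exact congrArg Name.int (hσ k (mem_intNames.2 hx))

/-- A local operation applied to a GS-LO diagram in normal form is absorbed. -/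
lemma exists_normal_applyOp (G : SimpleGraph (Fin n)) {ops : Fin n → List LocalOp}
    (h : ∀ i, IsNormal (ops i)) (j : Fin n) (o : LocalOp) :
    ∃ ops' : Fin n → List LocalOp, (∀ i, IsNormal (ops' i)) ∧
      Sim (applyOp j o (gsLO G ops)) (gsLO G ops') := by
  obtain ⟨l', hl', e⟩ := absorbs (n := n) o (ops j) (h j)
  refine ⟨Function.update ops j l', fun i => ?_, ?_⟩
  · by_cases hij : i = j
    · subst hij
      rwa [Function.update_self]
    · rw [Function.update_of_ne hij]
      exact h i
  · have h1 := sim_gsLO_list G (Function.update ops j []) j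
    simp only [Function.update_self, List.nil_append, Function.update_idem] at h1
    exact (sim_gsLO G ops j o).trans ((h1 _).symm.trans ((e j _).trans (h1 _)))

/-- The trivial normal form may be put at every output. -/
lemma exists_normal_graphState (G : SimpleGraph (Fin n)) :
    ∃ ops : Fin n → List LocalOp, (∀ i, IsNormal (ops i)) ∧
      Sim (graphStateWith G .out) (gsLO G ops) := by
  have triv : OpEquiv n [] [.phase .red 0, .phase .green 0] :=
    ((opEquiv_id .red).inside [] [.phase .green 0] |>.trans (opEquiv_id .green)).symm
  have key : ∀ s : Finset (Fin n), Sim (graphStateWith G .out)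
      (gsLO G fun i => if i ∈ s then [.phase .red 0, .phase .green 0] else []) := fun s => by
    induction s using Finset.induction_on with
    | empty => simpa [gsLO_nil] using Sim.refl _
    | insert j s hj ih =>
      refine ih.trans ((triv j _).trans ((sim_gsLO_list G _ j _).trans (.of_eq ?_)))
      refine congrArg (gsLO G) (funext fun i => ?_)
      by_cases hij : i = j
      · subst hij
        simp [hj]
      · simp [hij]
  exact ⟨_, fun i => by
    rw [if_pos (Finset.mem_univ i)]
    exact IsNormal.two 0 0 0 0, key Finset.univ⟩

lemma exists_normal_applyOps (G : SimpleGraph (Fin n)) (l : List (Fin n × LocalOp)) :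
    ∃ ops : Fin n → List LocalOp, (∀ i, IsNormal (ops i)) ∧
      Sim (applyOps l (graphStateWith G .out)) (gsLO G ops) := by
  induction l with
  | nil => exact exists_normal_graphState G
  | cons x l ih =>
    obtain ⟨ops, h, hs⟩ := ih
    obtain ⟨ops', h', hs'⟩ := exists_normal_applyOp G h x.1 x.2
    exact ⟨ops', h', (hs.applyOp x.1 x.2).trans hs'⟩

end

/-! ### Soundness of the rules -/

section

section Soundness

variable {W : Type}

/-- The variable whose values agree on the legs of a spider of the given colour. -/
def Colour.agreed : Colour → Ontic → ZMod 2
  | .green, s => s.1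
  | .red, s => s.2

/-- The variable whose values are added up by a spider of the given colour. -/
def Colour.added : Colour → Ontic → ZMod 2
  | .green, s => s.2
  | .red, s => s.1

/-- The ontic state with given values of the two variables. -/
def Colour.state : Colour → ZMod 2 → ZMod 2 → Ontic
  | .green, x, y => (x, y)
  | .red, x, y => (y, x)

@[simp] lemma agreed_state (c : Colour) (x y : ZMod 2) : c.agreed (c.state x y) = x := by
  cases c <;> rfl
@[simp] lemma added_state (c : Colour) (x y : ZMod 2) : c.added (c.state x y) = y := by
  cases c <;> rfl
@[simp] lemma agreed_other (c : Colour) (s : Ontic) : c.other.agreed s = c.added s := by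
  cases c <;> rfl
@[simp] lemma added_other (c : Colour) (s : Ontic) : c.other.added s = c.agreed s := by
  cases c <;> rfl
@[simp] lemma agreed_swap (c : Colour) (s : Ontic) : c.agreed s.swap = c.added s := by
  cases c <;> rfl
@[simp] lemma added_swap (c : Colour) (s : Ontic) : c.added s.swap = c.agreed s := by
  cases c <;> rfl

lemma ontic_ext (c : Colour) {s t : Ontic} (h : c.agreed s = c.agreed t)
    (h' : c.added s = c.added t) : s = t := by
  cases c
  exacts [Prod.ext h h', Prod.ext h' h]

lemma holds_spider {σ : W → Ontic} {c : Colour} {p : Phase} {A : Multiset W} :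
    (spider c p A).Holds σ ↔ ∃ b, (∀ w ∈ A, c.agreed (σ w) = b) ∧
      (A.map fun w => c.added (σ w)).sum = p.bit b := by
  cases c <;> rfl

lemma holds_spider_cons {σ : W → Ontic} {c : Colour} {p : Phase} {w : W} {A : Multiset W} :
    (spider c p (w ::ₘ A)).Holds σ ↔ (∀ x ∈ A, c.agreed (σ x) = c.agreed (σ w)) ∧
      c.added (σ w) + (A.map fun w => c.added (σ w)).sum = p.bit (c.agreed (σ w)) := by
  rw [holds_spider]
  constructor
  · rintro ⟨b, h, hs⟩
    obtain rfl := h w (mem_cons_self _ _)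
    exact ⟨fun x hx => h x (mem_cons_of_mem hx), by simpa using hs⟩
  · rintro ⟨h, hs⟩
    exact ⟨_, forall_mem_cons.2 ⟨rfl, h⟩, by simpa using hs⟩

lemma holds_had {σ : W → Ontic} {u v : W} : (had u v).Holds σ ↔ σ v = (σ u).swap := by
  simp only [Node.Holds, had, insert_eq_cons, map_cons, map_singleton]
  constructor
  · rintro ⟨s, h⟩
    rcases had_eq_had (congrArg (Node.mk Kind.had) h : had (σ u) (σ v) = had s s.swap) with
      ⟨h1, h2⟩ | ⟨h1, h2⟩
    · rw [h1, h2]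
    · rw [h1, h2, Prod.swap_swap]
  · exact fun h => ⟨σ u, by rw [h]⟩

lemma holds_wire {σ : W → Ontic} {u v : W} : (wire u v).Holds σ ↔ σ v = σ u := by
  simp only [Node.Holds, wire, insert_eq_cons, map_cons, map_singleton]
  constructor
  · rintro ⟨s, h⟩
    rcases had_eq_had (congrArg (Node.mk Kind.had) h : had (σ u) (σ v) = had s s) with
      ⟨h1, h2⟩ | ⟨h1, h2⟩ <;> rw [h1, h2]
  · exact fun h => ⟨σ u, by rw [h]⟩

lemma bit_zero (b : ZMod 2) : Phase.bit 0 b = 0 := by simp [Phase.bit]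
lemma bit_add (p q : Phase) (b : ZMod 2) : Phase.bit (p + q) b = p.bit b + q.bit b := by
  unfold Phase.bit
  split_ifs <;> rfl
lemma bit_eleven (b : ZMod 2) : Phase.bit (1, 1) b = 1 := by simp [Phase.bit]

/-- All nodes hold. -/
def Models (σ : W → Ontic) (K : Multiset (Node W)) : Prop := ∀ a ∈ K, a.Holds σ

@[simp] lemma models_zero {σ : W → Ontic} : Models σ 0 := fun _ h => absurd h (notMem_zero _)
@[simp] lemma models_cons {σ : W → Ontic} {a : Node W} {K : Multiset (Node W)} :
    Models σ (a ::ₘ K) ↔ a.Holds σ ∧ Models σ K := by simp [Models]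
@[simp] lemma models_singleton {σ : W → Ontic} {a : Node W} :
    Models σ {a} ↔ a.Holds σ := by simp [Models]
@[simp] lemma models_add {σ : W → Ontic} {K L : Multiset (Node W)} :
    Models σ (K + L) ↔ Models σ K ∧ Models σ L := by
  simp [Models, or_imp, forall_and]

/-- Every assignment that satisfies `L` satisfies `R` after a change of the values at the wires
that are internal to `R`. -/
def Entails (L R : Multiset (Node W)) : Prop :=
  ∀ σ : W → Ontic, Models σ L →
    ∃ σ' : W → Ontic, Models σ' R ∧ ∀ w, (allLegs R).count w < 2 → σ' w = σ w

lemma entails_of_models {L R : Multiset (Node W)} (h : ∀ σ, Models σ L → Models σ R) :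
    Entails L R := fun σ hσ => ⟨σ, h σ hσ, fun _ _ => rfl⟩

lemma inner_of_count {I X : Multiset W} (h : ∀ w, (X + (I + I)).count w ≤ 2) :
    I.Nodup ∧ ∀ e ∈ I, e ∉ X := by
  refine ⟨nodup_iff_count_le_one.2 fun e => ?_, fun e he hX => ?_⟩
  · have := h e
    simp only [count_add] at this
    omega
  · have := h e
    have h1 := count_pos.2 he
    have h2 := count_pos.2 hX
    simp only [count_add] at this
    omega

/-- The internal wires of `R` are those that occur twice, so that an assignment may be changed
there. -/
lemma entails_of_inner {L R : Multiset (Node W)} {I X : Multiset W}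
    (hR : allLegs R = X + (I + I)) (h : ∀ σ, Models σ L →
      ∃ σ' : W → Ontic, Models σ' R ∧ ∀ w, w ∉ I → σ' w = σ w) : Entails L R := fun σ hσ => by
  obtain ⟨σ', h1, h2⟩ := h σ hσ
  refine ⟨σ', h1, fun w hw => h2 w fun hI => ?_⟩
  have := count_pos.2 hI
  rw [hR, count_add, count_add] at hw
  omega

lemma zmod_two_add_self (x : ZMod 2) : x + x = 0 := by revert x; decide

/-- The case where the internal wires of `R` are the second components of `ends`, and the value at
each of them is obtained by `v` from the value at the corresponding first component. -/
lemma entails_ends {L R : Multiset (Node W)} {ends : Multiset (W × W)} {X : Multiset W}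
    (hR : allLegs R = X + (ends.map Prod.snd + ends.map Prod.snd))
    (hc : ∀ w, (allLegs R).count w ≤ 2) (v : Ontic → Ontic)
    (h : ∀ σ σ' : W → Ontic, (∀ w, w ∈ X → σ' w = σ w) →
      (∀ o ∈ ends, σ' o.2 = v (σ o.1)) → Models σ L → Models σ' R) : Entails L R := by
  rw [hR] at hc
  obtain ⟨nd, hX⟩ := inner_of_count hc
  refine entails_of_inner hR fun σ hσ => ?_
  let σ' : W → Ontic := fun w => if h : ∃ o ∈ ends, o.2 = w then v (σ h.choose.1) else σ w
  have hend : ∀ o ∈ ends, σ' o.2 = v (σ o.1) := fun o ho => by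
    have h : ∃ o' ∈ ends, o'.2 = o.2 := ⟨o, ho, rfl⟩
    simp only [σ', dif_pos h]
    rw [inj_on_of_nodup_map nd _ h.choose_spec.1 _ ho h.choose_spec.2]
  have hout : ∀ w, w ∉ ends.map Prod.snd → σ' w = σ w := fun w hw =>
    dif_neg fun ⟨o, ho, he⟩ => hw (he ▸ mem_map_of_mem _ ho)
  exact ⟨σ', h σ σ' (fun w hw => hout w fun hI => hX w hI hw) hend hσ, hout⟩

lemma bit_swap (x y b : ZMod 2) : Phase.bit (y, x) b = Phase.bit (x, y) (b + 1) := by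
  revert x y b
  decide

lemma bit_zeroOne (b : ZMod 2) : Phase.bit (0, 1) b = b := by
  revert b
  decide

lemma Node.Holds.congr {σ σ' : W → Ontic} {a : Node W} (h : a.Holds σ)
    (he : ∀ w ∈ a.legs, σ w = σ' w) : a.Holds σ' := by
  rcases a with ⟨⟨c, p⟩ | _ | _, A⟩
  · obtain ⟨b, h1, h2⟩ := holds_spider.1 (h : (spider c p A).Holds σ)
    refine holds_spider.2 ⟨b, fun w hw => by rw [← he w hw, h1 w hw], ?_⟩
    rw [← h2]
    exact congrArg sum (Multiset.map_congr rfl fun w hw => by rw [he w hw])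
  all_goals
    obtain ⟨s, hs⟩ := h
    exact ⟨s, hs ▸ Multiset.map_congr rfl fun w hw => (he w hw).symm⟩

lemma entails_fuse (c : Colour) (p q : Phase) (e : W) (A B : Multiset W)
    (hL : ∀ w, (allLegs ({spider c p (e ::ₘ A), spider c q (e ::ₘ B)} :
      Multiset (Node W))).count w ≤ 2) :
    Entails {spider c p (e ::ₘ A), spider c q (e ::ₘ B)} {spider c (p + q) (A + B)} ∧
      Entails {spider c (p + q) (A + B)} {spider c p (e ::ₘ A), spider c q (e ::ₘ B)} := by
  have hl : allLegs ({spider c p (e ::ₘ A), spider c q (e ::ₘ B)} : Multiset (Node W)) =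
      (A + B) + ({e} + {e}) := by
    simp only [insert_eq_cons, allLegs_cons, allLegs_singleton, spider_legs]
    simp only [← singleton_add]
    ac_rfl
  rw [hl] at hL
  have he := (inner_of_count hL).2 e (by simp)
  rw [mem_add, not_or] at he
  refine ⟨entails_of_models fun σ hσ => ?_, entails_of_inner hl fun σ hσ => ?_⟩
  · simp only [insert_eq_cons, models_cons, models_singleton, holds_spider_cons] at hσ
    obtain ⟨⟨hA, sA⟩, hB, sB⟩ := hσ
    rw [models_singleton, holds_spider]
    refine ⟨c.agreed (σ e), fun w hw => (mem_add.1 hw).elim (hA w) (hB w), ?_⟩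
    rw [bit_add, ← sA, ← sB, Multiset.map_add, sum_add]
    linear_combination -zmod_two_add_self (c.added (σ e))
  · rw [models_singleton, holds_spider] at hσ
    obtain ⟨b, h, hs⟩ := hσ
    set σ' := Function.update σ e
      (c.state b (p.bit b + (A.map fun w => c.added (σ w)).sum)) with hσ'
    have hw : ∀ w, w ≠ e → σ' w = σ w := fun w hw => Function.update_of_ne hw _ _
    have ne : ∀ {C : Multiset W}, e ∉ C → ∀ w ∈ C, w ≠ e := fun h w hw he => h (he ▸ hw)
    refine ⟨σ', ?_, fun w h => hw w (by simpa using h)⟩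
    have mA : (A.map fun w => c.added (σ' w)) = A.map fun w => c.added (σ w) :=
      Multiset.map_congr rfl fun w h => by rw [hw w (ne he.1 w h)]
    have mB : (B.map fun w => c.added (σ' w)) = B.map fun w => c.added (σ w) :=
      Multiset.map_congr rfl fun w h => by rw [hw w (ne he.2 w h)]
    have h0 : σ' e = c.state b (p.bit b + (A.map fun w => c.added (σ w)).sum) :=
      Function.update_self _ _ _
    rw [Multiset.map_add, sum_add, bit_add] at hs
    simp only [insert_eq_cons, models_cons, models_singleton, holds_spider_cons, mA, mB, h0,
      agreed_state, added_state]
    refine ⟨⟨fun w hA => ?_, ?_⟩, fun w hB => ?_, ?_⟩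
    · rw [hw w (ne he.1 w hA)]
      exact h w (mem_add.2 (.inl hA))
    · linear_combination zmod_two_add_self (A.map fun w => c.added (σ w)).sum
    · rw [hw w (ne he.2 w hB)]
      exact h w (mem_add.2 (.inr hB))
    · linear_combination hs + zmod_two_add_self (p.bit b)

lemma entails_loop (c : Colour) (p : Phase) (e : W) (A : Multiset W)
    (hL : ∀ w, (allLegs ({spider c p (e ::ₘ e ::ₘ A)} : Multiset (Node W))).count w ≤ 2) :
    Entails {spider c p (e ::ₘ e ::ₘ A)} {spider c p A} ∧
      Entails {spider c p A} {spider c p (e ::ₘ e ::ₘ A)} := by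
  have hl : allLegs ({spider c p (e ::ₘ e ::ₘ A)} : Multiset (Node W)) = A + ({e} + {e}) := by
    simp only [allLegs_singleton, spider_legs]
    simp only [← singleton_add]
    ac_rfl
  rw [hl] at hL
  have he := (inner_of_count hL).2 e (by simp)
  refine ⟨entails_of_models fun σ hσ => ?_, entails_of_inner hl fun σ hσ => ?_⟩
  · rw [models_singleton, holds_spider_cons] at hσ
    rw [models_singleton, holds_spider]
    refine ⟨_, fun w hw => hσ.1 w (mem_cons_of_mem hw), ?_⟩
    rw [← hσ.2, map_cons, sum_cons]
    linear_combination -zmod_two_add_self (c.added (σ e))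
  · rw [models_singleton, holds_spider] at hσ
    obtain ⟨b, h, hs⟩ := hσ
    set σ' := Function.update σ e (c.state b 0) with hσ'
    have hw : ∀ w, w ≠ e → σ' w = σ w := fun w hw => Function.update_of_ne hw _ _
    have ne : ∀ w ∈ A, w ≠ e := fun w hw h => he (h ▸ hw)
    have h0 : σ' e = c.state b 0 := Function.update_self _ _ _
    refine ⟨σ', ?_, fun w h => hw w (by simpa using h)⟩
    have mA : (A.map fun w => c.added (σ' w)) = A.map fun w => c.added (σ w) :=
      Multiset.map_congr rfl fun w h => by rw [hw w (ne w h)]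
    rw [models_singleton, holds_spider_cons, map_cons, sum_cons, mA, hs, h0, agreed_state,
      added_state, zero_add, zero_add]
    refine ⟨fun w hw' => ?_, rfl⟩
    rcases mem_cons.1 hw' with rfl | hw'
    · rw [h0, agreed_state]
    · rw [hw w (ne w hw'), h w hw']

lemma entails_identity (c : Colour) (u v : W) :
    Entails {spider c 0 {u, v}} {wire u v} ∧ Entails {wire u v} {spider c 0 {u, v}} := by
  have key : ∀ σ : W → Ontic, Models σ {spider c 0 {u, v}} ↔ Models σ {wire u v} := fun σ => by
    simp only [models_singleton, insert_eq_cons, holds_spider_cons, holds_wire, mem_singleton,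
      forall_eq, map_singleton, sum_singleton, bit_zero]
    refine ⟨fun h => ontic_ext c h.1 ?_, fun h => by rw [h]; exact ⟨rfl, zmod_two_add_self _⟩⟩
    linear_combination h.2 - zmod_two_add_self (c.added (σ u))
  exact ⟨entails_of_models fun σ => (key σ).1, entails_of_models fun σ => (key σ).2⟩

lemma entails_bialgebra (c : Colour) (i₁ i₂ o₁ o₂ e₁₁ e₁₂ e₂₁ e₂₂ e : W)
    (hL : ∀ w, (allLegs ({spider c 0 {i₁, e₁₁, e₁₂}, spider c 0 {i₂, e₂₁, e₂₂},
      spider c.other 0 {e₁₁, e₂₁, o₁}, spider c.other 0 {e₁₂, e₂₂, o₂}} :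
        Multiset (Node W))).count w ≤ 2)
    (hR : ∀ w, (allLegs ({spider c.other 0 {i₁, i₂, e}, spider c 0 {e, o₁, o₂}} :
      Multiset (Node W))).count w ≤ 2) :
    Entails {spider c 0 {i₁, e₁₁, e₁₂}, spider c 0 {i₂, e₂₁, e₂₂},
        spider c.other 0 {e₁₁, e₂₁, o₁}, spider c.other 0 {e₁₂, e₂₂, o₂}}
      {spider c.other 0 {i₁, i₂, e}, spider c 0 {e, o₁, o₂}} ∧
    Entails {spider c.other 0 {i₁, i₂, e}, spider c 0 {e, o₁, o₂}}
      {spider c 0 {i₁, e₁₁, e₁₂}, spider c 0 {i₂, e₂₁, e₂₂},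
        spider c.other 0 {e₁₁, e₂₁, o₁}, spider c.other 0 {e₁₂, e₂₂, o₂}} := by
  have hl : allLegs ({spider c 0 {i₁, e₁₁, e₁₂}, spider c 0 {i₂, e₂₁, e₂₂},
      spider c.other 0 {e₁₁, e₂₁, o₁}, spider c.other 0 {e₁₂, e₂₂, o₂}} : Multiset (Node W)) =
      {i₁, i₂, o₁, o₂} + ({e₁₁, e₁₂, e₂₁, e₂₂} + {e₁₁, e₁₂, e₂₁, e₂₂}) := by
    simp only [insert_eq_cons, allLegs_cons, allLegs_singleton, spider_legs]
    simp only [← singleton_add]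
    ac_rfl
  have hr : allLegs ({spider c.other 0 {i₁, i₂, e}, spider c 0 {e, o₁, o₂}} :
      Multiset (Node W)) = {i₁, i₂, o₁, o₂} + ({e} + {e}) := by
    simp only [insert_eq_cons, allLegs_cons, allLegs_singleton, spider_legs]
    simp only [← singleton_add]
    ac_rfl
  rw [hl] at hL
  rw [hr] at hR
  obtain ⟨nd, hX⟩ := inner_of_count hL
  have he := (inner_of_count hR).2 e (by simp)
  simp only [insert_eq_cons, mem_cons, mem_singleton, not_or, nodup_cons, nodup_singleton,
    forall_eq_or_imp, forall_eq] at nd hX he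
  refine ⟨entails_of_inner hr fun σ hσ => ?_, entails_of_inner hl fun σ hσ => ?_⟩
  · refine ⟨Function.update σ e (c.state (c.agreed (σ i₁) + c.agreed (σ i₂)) (c.added (σ i₁))), ?_,
      fun w h => Function.update_of_ne (by simpa using h) _ _⟩
    simp only [insert_eq_cons, models_cons, models_singleton, holds_spider_cons, mem_cons,
      mem_singleton, forall_eq_or_imp, forall_eq, map_cons, map_singleton, sum_cons, sum_singleton,
      bit_zero, agreed_other, added_other, Function.update_self, agreed_state, added_state,
      Function.update_of_ne (Ne.symm he.1), Function.update_of_ne (Ne.symm he.2.1),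
      Function.update_of_ne (Ne.symm he.2.2.1), Function.update_of_ne (Ne.symm he.2.2.2)] at hσ ⊢
    grind
  · let σ' : W → Ontic := fun w =>
      if w = e₁₁ then c.state (c.agreed (σ i₁)) (c.added (σ o₁)) else
      if w = e₁₂ then c.state (c.agreed (σ i₁)) (c.added (σ o₂)) else
      if w = e₂₁ then c.state (c.agreed (σ i₂)) (c.added (σ o₁)) else
      if w = e₂₂ then c.state (c.agreed (σ i₂)) (c.added (σ o₂)) else σ w
    have hw : ∀ w, w ≠ e₁₁ ∧ w ≠ e₁₂ ∧ w ≠ e₂₁ ∧ w ≠ e₂₂ → σ' w = σ w := fun w h => by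
      simp [σ', h]
    have h1 : σ' e₁₁ = c.state (c.agreed (σ i₁)) (c.added (σ o₁)) := by simp [σ']
    have h2 : σ' e₁₂ = c.state (c.agreed (σ i₁)) (c.added (σ o₂)) := by
      simp [σ', Ne.symm nd.1.1]
    have h3 : σ' e₂₁ = c.state (c.agreed (σ i₂)) (c.added (σ o₁)) := by
      simp [σ', Ne.symm nd.1.2.1, Ne.symm nd.2.1.1]
    have h4 : σ' e₂₂ = c.state (c.agreed (σ i₂)) (c.added (σ o₂)) := by
      simp [σ', Ne.symm nd.1.2.2, Ne.symm nd.2.1.2, Ne.symm nd.2.2.1]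
    refine ⟨σ', ?_, fun w h => hw w (by simpa using h)⟩
    simp only [insert_eq_cons, models_cons, models_singleton, holds_spider_cons, mem_cons,
      mem_singleton, forall_eq_or_imp, forall_eq, map_cons, map_singleton, sum_cons, sum_singleton,
      bit_zero, agreed_other, added_other, agreed_state, added_state, h1, h2, h3, h4,
      hw i₁ (by grind), hw i₂ (by grind), hw o₁ (by grind), hw o₂ (by grind)] at hσ ⊢
    grind

lemma entails_copy (c : Colour) (e o₁ o₂ : W)
    (hL : ∀ w, (allLegs ({spider c.other 0 {e}, spider c 0 {e, o₁, o₂}} :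
      Multiset (Node W))).count w ≤ 2) :
    Entails {spider c.other 0 {e}, spider c 0 {e, o₁, o₂}}
      {spider c.other 0 {o₁}, spider c.other 0 {o₂}} ∧
    Entails {spider c.other 0 {o₁}, spider c.other 0 {o₂}}
      {spider c.other 0 {e}, spider c 0 {e, o₁, o₂}} := by
  have hl : allLegs ({spider c.other 0 {e}, spider c 0 {e, o₁, o₂}} : Multiset (Node W)) =
      {o₁, o₂} + ({e} + {e}) := by
    simp only [insert_eq_cons, allLegs_cons, allLegs_singleton, spider_legs]
    simp only [← singleton_add]
    ac_rfl
  rw [hl] at hL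
  have he := (inner_of_count hL).2 e (by simp)
  simp only [insert_eq_cons, mem_cons, mem_singleton, not_or] at he
  refine ⟨entails_of_models fun σ hσ => ?_, entails_of_inner hl fun σ hσ => ?_⟩
  · simp only [insert_eq_cons, models_cons, models_singleton, ← cons_zero (_ : W),
      holds_spider_cons] at hσ ⊢
    simp [bit_zero] at hσ ⊢
    rw [hσ.2.1.1, hσ.2.1.2]
    exact ⟨hσ.1, hσ.1⟩
  · refine ⟨Function.update σ e (c.state 0 (c.added (σ o₁) + c.added (σ o₂))), ?_,
      fun w h => Function.update_of_ne (by simpa using h) _ _⟩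
    simp only [insert_eq_cons, models_cons, models_singleton, ← cons_zero (_ : W),
      holds_spider_cons] at hσ ⊢
    simp [bit_zero, Function.update_of_ne (Ne.symm he.1), Function.update_of_ne (Ne.symm he.2)]
      at hσ ⊢
    exact ⟨hσ, zmod_two_add_self _⟩

lemma entails_copy11 (c : Colour) (i e : W) (outs : Multiset (W × W))
    (hL : ∀ w, (allLegs ({spider c.other (1, 1) {i, e}, spider c 0 (e ::ₘ outs.map Prod.fst)} :
      Multiset (Node W))).count w ≤ 2)
    (hR : ∀ w, (allLegs (spider c 0 (i ::ₘ outs.map Prod.snd) ::ₘ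
      outs.map fun o => spider c.other (1, 1) {o.2, o.1})).count w ≤ 2) :
    Entails {spider c.other (1, 1) {i, e}, spider c 0 (e ::ₘ outs.map Prod.fst)}
      (spider c 0 (i ::ₘ outs.map Prod.snd) ::ₘ
        outs.map fun o => spider c.other (1, 1) {o.2, o.1}) ∧
    Entails (spider c 0 (i ::ₘ outs.map Prod.snd) ::ₘ
        outs.map fun o => spider c.other (1, 1) {o.2, o.1})
      {spider c.other (1, 1) {i, e}, spider c 0 (e ::ₘ outs.map Prod.fst)} := by
  have hl : allLegs ({spider c.other (1, 1) {i, e}, spider c 0 (e ::ₘ outs.map Prod.fst)} :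
      Multiset (Node W)) = (i ::ₘ outs.map Prod.fst) + ({e} + {e}) := by
    simp only [insert_eq_cons, allLegs_cons, allLegs_singleton, spider_legs]
    simp only [← singleton_add]
    ac_rfl
  have hr : allLegs (spider c 0 (i ::ₘ outs.map Prod.snd) ::ₘ
      outs.map fun o => spider c.other (1, 1) {o.2, o.1}) =
      (i ::ₘ outs.map Prod.fst) + (outs.map Prod.snd + outs.map Prod.snd) := by
    rw [allLegs_cons, allLegs_map_spider_pair, spider_legs]
    simp only [← singleton_add]
    ac_rfl
  have hpair : ∀ {σ : W → Ontic} {u v : W}, (spider c.other (1, 1) {u, v}).Holds σ ↔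
      c.added (σ v) = c.added (σ u) ∧ c.agreed (σ u) + c.agreed (σ v) = 1 := fun {σ u v} => by
    simp [holds_spider_cons, bit_eleven]
  have houts : ∀ σ : W → Ontic, Models σ (outs.map fun o => spider c.other (1, 1) {o.2, o.1}) ↔
      ∀ o ∈ outs, c.added (σ o.1) = c.added (σ o.2) ∧ c.agreed (σ o.2) + c.agreed (σ o.1) = 1 :=
    fun σ => by
      refine ⟨fun h o ho => hpair.1 (h _ (mem_map_of_mem _ ho)), fun h a ha => ?_⟩
      obtain ⟨o, ho, rfl⟩ := mem_map.1 ha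
      exact hpair.2 (h o ho)
  refine ⟨entails_ends hr hR (fun s => c.state (c.agreed s + 1) (c.added s))
    fun σ σ' hX hE hσ => ?_, ?_⟩
  · rw [insert_eq_cons, models_cons, models_singleton, hpair, holds_spider_cons, forall_mem_map_iff,
      Multiset.map_map] at hσ
    obtain ⟨⟨h1, h2⟩, h3, h4⟩ := hσ
    rw [models_cons, houts, holds_spider_cons, forall_mem_map_iff, Multiset.map_map]
    have hi : σ' i = σ i := hX i (mem_cons_self _ _)
    have ho : ∀ o ∈ outs, σ' o.1 = σ o.1 := fun o ho =>
      hX _ (mem_cons_of_mem (mem_map_of_mem _ ho))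
    have hs : (outs.map ((fun w => c.added (σ' w)) ∘ Prod.snd)) =
        outs.map ((fun w => c.added (σ w)) ∘ Prod.fst) :=
      Multiset.map_congr rfl fun o ho => by simp [hE o ho]
    rw [hs, hi, bit_zero]
    rw [bit_zero, h1] at h4
    refine ⟨⟨fun o h => ?_, h4⟩, fun o h => ?_⟩
    · rw [hE o h, agreed_state, h3 o h]
      linear_combination h2 - zmod_two_add_self (c.agreed (σ i)) + zmod_two_add_self 1
    · rw [hE o h, ho o h, agreed_state, added_state]
      exact ⟨rfl, by linear_combination zmod_two_add_self (c.agreed (σ o.1))⟩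
  · rw [hl] at hL
    have he := (inner_of_count hL).2 e (by simp)
    rw [mem_cons, not_or] at he
    refine entails_of_inner hl fun σ hσ => ?_
    rw [models_cons, houts, holds_spider_cons, forall_mem_map_iff, Multiset.map_map] at hσ
    obtain ⟨⟨h1, h2⟩, h3⟩ := hσ
    set σ' := Function.update σ e (c.state (c.agreed (σ i) + 1) (c.added (σ i))) with hσ'
    have hw : ∀ w, w ≠ e → σ' w = σ w := fun w hw => Function.update_of_ne hw _ _
    have h0 : σ' e = c.state (c.agreed (σ i) + 1) (c.added (σ i)) := Function.update_self _ _ _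
    have ho : ∀ o ∈ outs, σ' o.1 = σ o.1 := fun o ho =>
      hw _ fun h => he.2 (h ▸ mem_map_of_mem _ ho)
    refine ⟨σ', ?_, fun w h => hw w (by simpa using h)⟩
    have hs : (outs.map ((fun w => c.added (σ' w)) ∘ Prod.fst)) =
        outs.map ((fun w => c.added (σ w)) ∘ Prod.snd) :=
      Multiset.map_congr rfl fun o h => by simp [ho o h, (h3 o h).1]
    rw [insert_eq_cons, models_cons, models_singleton, hpair, holds_spider_cons, forall_mem_map_iff,
      Multiset.map_map, hs, h0, hw i (Ne.symm he.1), agreed_state, added_state, bit_zero]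
    rw [bit_zero] at h2
    refine ⟨⟨rfl, ?_⟩, fun o h => ?_, h2⟩
    · linear_combination zmod_two_add_self (c.agreed (σ i))
    · rw [ho o h]
      linear_combination (h3 o h).2 - h1 o h - zmod_two_add_self (c.agreed (σ i))

lemma entails_comm11 (c : Colour) (x y : ZMod 2) (i o e e' : W)
    (hR : ∀ w, (allLegs ({spider c (y, x) {i, e'}, spider c.other (1, 1) {e', o}} :
      Multiset (Node W))).count w ≤ 2) :
    Entails {spider c.other (1, 1) {i, e}, spider c (x, y) {e, o}}
      {spider c (y, x) {i, e'}, spider c.other (1, 1) {e', o}} := by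
  have hr : allLegs ({spider c (y, x) {i, e'}, spider c.other (1, 1) {e', o}} :
      Multiset (Node W)) = {i, o} + ({e'} + {e'}) := by
    simp only [insert_eq_cons, allLegs_cons, allLegs_singleton, spider_legs]
    simp only [← singleton_add]
    ac_rfl
  rw [hr] at hR
  have he := (inner_of_count hR).2 e' (by simp)
  simp only [insert_eq_cons, mem_cons, mem_singleton, not_or] at he
  refine entails_of_inner hr fun σ hσ => ?_
  refine ⟨Function.update σ e' (c.state (c.agreed (σ i)) (c.added (σ o))), ?_,
    fun w h => Function.update_of_ne (by simpa using h) _ _⟩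
  simp only [insert_eq_cons, models_cons, models_singleton, holds_spider_cons,
    mem_singleton, forall_eq, map_singleton, sum_singleton,
    bit_eleven, agreed_other, added_other, Function.update_self, agreed_state, added_state,
    Function.update_of_ne (Ne.symm he.1), Function.update_of_ne (Ne.symm he.2)] at hσ ⊢
  obtain ⟨⟨h1, h2⟩, h3, h4⟩ := hσ
  have h5 : c.agreed (σ e) = c.agreed (σ i) + 1 := by
    linear_combination h2 - zmod_two_add_self (c.agreed (σ i))
  rw [h1, h5, ← bit_swap] at h4
  exact ⟨⟨trivial, h4⟩, trivial, by rw [h3, h2]⟩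

lemma entails_euler (c : Colour) (u v e f : W)
    (hR : ∀ w, (allLegs ({spider c (0, 1) {u, e}, spider c.other (0, 1) {e, f},
      spider c (0, 1) {f, v}} : Multiset (Node W))).count w ≤ 2) :
    Entails {had u v} {spider c (0, 1) {u, e}, spider c.other (0, 1) {e, f},
      spider c (0, 1) {f, v}} ∧
    Entails {spider c (0, 1) {u, e}, spider c.other (0, 1) {e, f}, spider c (0, 1) {f, v}}
      {had u v} := by
  have hr : allLegs ({spider c (0, 1) {u, e}, spider c.other (0, 1) {e, f},
      spider c (0, 1) {f, v}} : Multiset (Node W)) = {u, v} + ({e, f} + {e, f}) := by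
    simp only [insert_eq_cons, allLegs_cons, allLegs_singleton, spider_legs]
    simp only [← singleton_add]
    ac_rfl
  rw [hr] at hR
  obtain ⟨nd, hX⟩ := inner_of_count hR
  simp only [insert_eq_cons, mem_cons, mem_singleton, not_or, nodup_cons, nodup_singleton,
    forall_eq_or_imp, forall_eq] at nd hX
  refine ⟨entails_of_inner hr fun σ hσ => ?_, entails_of_models fun σ hσ => ?_⟩
  · rw [models_singleton, holds_had] at hσ
    let σ' : W → Ontic := fun w =>
      if w = e then c.state (c.agreed (σ u)) (c.added (σ u) + c.agreed (σ u)) else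
      if w = f then c.state (c.added (σ u)) (c.added (σ u) + c.agreed (σ u)) else σ w
    have hw : ∀ w, w ≠ e ∧ w ≠ f → σ' w = σ w := fun w h => by simp [σ', h]
    have h1 : σ' e = c.state (c.agreed (σ u)) (c.added (σ u) + c.agreed (σ u)) := by simp [σ']
    have h2 : σ' f = c.state (c.added (σ u)) (c.added (σ u) + c.agreed (σ u)) := by
      simp [σ', Ne.symm nd.1]
    refine ⟨σ', ?_, fun w h => hw w (by simpa using h)⟩
    simp only [insert_eq_cons, models_cons, models_singleton, holds_spider_cons,
      mem_singleton, forall_eq, map_singleton, sum_singleton, bit_zeroOne, agreed_other,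
      added_other, agreed_state, added_state, h1, h2,
      hw u (by grind), hw v (by grind), hσ, agreed_swap, added_swap]
    grind
  · simp only [insert_eq_cons, models_cons, models_singleton, holds_spider_cons,
      mem_singleton, forall_eq, map_singleton, sum_singleton, bit_zeroOne, agreed_other,
      added_other, holds_had] at hσ ⊢
    refine ontic_ext c ?_ ?_ <;> simp only [agreed_swap, added_swap] <;> grind

lemma entails_colourChange (c : Colour) (p : Phase) (ends : Multiset (W × W))
    (hL : ∀ w, (allLegs (spider c p (ends.map Prod.snd) ::ₘ
      ends.map fun o => had o.2 o.1)).count w ≤ 2) :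
    Entails (spider c p (ends.map Prod.snd) ::ₘ ends.map fun o => had o.2 o.1)
      {spider c.other p (ends.map Prod.fst)} ∧
    Entails {spider c.other p (ends.map Prod.fst)}
      (spider c p (ends.map Prod.snd) ::ₘ ends.map fun o => had o.2 o.1) := by
  have hl : allLegs (spider c p (ends.map Prod.snd) ::ₘ ends.map fun o => had o.2 o.1) =
      ends.map Prod.fst + (ends.map Prod.snd + ends.map Prod.snd) := by
    rw [allLegs_cons, allLegs_map_had, spider_legs]
    ac_rfl
  have hhad : ∀ σ : W → Ontic, Models σ (ends.map fun o => had o.2 o.1) ↔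
      ∀ o ∈ ends, σ o.1 = (σ o.2).swap := fun σ => by
    refine ⟨fun h o ho => holds_had.1 (h _ (mem_map_of_mem _ ho)), fun h a ha => ?_⟩
    obtain ⟨o, ho, rfl⟩ := mem_map.1 ha
    exact holds_had.2 (h o ho)
  have key : ∀ σ : W → Ontic, (∀ o ∈ ends, σ o.1 = (σ o.2).swap) →
      ((spider c p (ends.map Prod.snd)).Holds σ ↔
        (spider c.other p (ends.map Prod.fst)).Holds σ) := fun σ h => by
    rw [holds_spider, holds_spider]
    simp only [mem_map, forall_exists_index, and_imp, forall_apply_eq_imp_iff₂, Multiset.map_map,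
      Function.comp_apply, agreed_other, added_other]
    have hs : (ends.map fun o => c.agreed (σ o.1)) = ends.map fun o => c.added (σ o.2) :=
      Multiset.map_congr rfl fun o ho => by rw [h o ho, agreed_swap]
    rw [hs]
    refine exists_congr fun b => and_congr_left fun _ => forall₂_congr fun o ho => ?_
    rw [h o ho, added_swap]
  refine ⟨entails_of_models fun σ hσ => ?_, entails_ends hl hL Prod.swap fun σ σ' hX hE hσ => ?_⟩
  · rw [models_cons, hhad] at hσ
    rw [models_singleton]
    exact (key σ hσ.2).1 hσ.1
  · have h1 : ∀ o ∈ ends, σ' o.1 = (σ' o.2).swap := fun o ho => by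
      rw [hE o ho, hX _ (mem_map_of_mem _ ho), Prod.swap_swap]
    rw [models_cons, hhad, key σ' h1]
    refine ⟨?_, h1⟩
    rw [models_singleton, holds_spider] at hσ
    obtain ⟨b, h, hs⟩ := hσ
    refine holds_spider.2 ⟨b, fun w hw => by rw [hX w hw, h w hw], hs ▸ congrArg sum ?_⟩
    exact Multiset.map_congr rfl fun w hw => by rw [hX w hw]

lemma entails_scalar (K : Multiset (Node W)) (hK : IsClosed K)
    (h : ∃ σ : W → Ontic, ∀ a ∈ K, a.Holds σ) : Entails K 0 ∧ Entails 0 K := by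
  refine ⟨entails_of_models fun σ _ => models_zero, ?_⟩
  obtain ⟨σ₀, h₀⟩ := h
  refine fun σ _ => ⟨fun w => if w ∈ allLegs K then σ₀ w else σ w, fun a ha =>
    (h₀ a ha).congr fun w hw => (if_pos (mem_allLegs.2 ⟨a, ha, hw⟩)).symm, fun w hw => ?_⟩
  rcases hK w with h | h
  · exact if_neg (count_eq_zero.1 h)
  · omega

/-- The rules are sound for the relational semantics. The bounds hold for parts of diagrams and
guarantee that the internal wires of a rule occur nowhere else in it. -/
lemma Rule.entails {L R : Multiset (Node W)} (h : Rule L R)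
    (hL : ∀ w, (allLegs L).count w ≤ 2) (hR : ∀ w, (allLegs R).count w ≤ 2) :
    Entails L R ∧ Entails R L := by
  cases h with
  | fuse c p q e A B => exact entails_fuse c p q e A B hL
  | loop c p e A => exact entails_loop c p e A hL
  | identity c u v => exact entails_identity c u v
  | bialgebra c i₁ i₂ o₁ o₂ e₁₁ e₁₂ e₂₁ e₂₂ e =>
    exact entails_bialgebra c i₁ i₂ o₁ o₂ e₁₁ e₁₂ e₂₁ e₂₂ e hL hR
  | copy c e o₁ o₂ => exact entails_copy c e o₁ o₂ hL
  | copy11 c i e outs => exact entails_copy11 c i e outs hL hR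
  | comm11 c x y i o e e' =>
    have e1 : ({spider c.other (1, 1) {i, e}, spider c (x, y) {e, o}} : Multiset (Node W)) =
        {spider c (x, y) {o, e}, spider c.other (1, 1) {e, i}} := by
      rw [pair_comm (spider _ _ _), pair_comm o e, pair_comm e i]
    have e2 : ({spider c (y, x) {i, e'}, spider c.other (1, 1) {e', o}} : Multiset (Node W)) =
        {spider c.other (1, 1) {o, e'}, spider c (y, x) {e', i}} := by
      rw [pair_comm (spider _ _ _), pair_comm o e', pair_comm e' i]
    refine ⟨entails_comm11 c x y i o e e' hR, ?_⟩
    rw [e1] at hL ⊢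
    rw [e2]
    exact entails_comm11 c y x o i e' e hL
  | colourChange c p ends => exact entails_colourChange c p ends hL
  | euler c u v e f => exact entails_euler c u v e f hR
  | scalar _ hK hs => exact entails_scalar _ hK hs

end Soundness

end

/-! ### Consistency, and the normal form of a diagram -/

section

section Consistency

variable {m n : ℕ}

lemma IsDiagram.count_le {D : Net m n} (h : IsDiagram D) (x : Name m n) :
    (allLegs D).count x ≤ 2 := by
  rcases x with i | j | k
  · rw [h.inp i]
    omega
  · rw [h.out j]
    omega
  · rcases h.int k with h | h <;> rw [h]
    omega

lemma Entails.exists_models {L R C : Net m n} (h : Entails L R) (hR : IsDiagram (R + C))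
    (hs : ∃ σ, Models σ (L + C)) : ∃ σ, Models σ (R + C) := by
  obtain ⟨σ, hσ⟩ := hs
  rw [models_add] at hσ
  obtain ⟨σ', h1, h2⟩ := h σ hσ.1
  refine ⟨σ', models_add.2 ⟨h1, fun a ha => (hσ.2 a ha).congr fun w hw => (h2 w ?_).symm⟩⟩
  have := hR.count_le w
  have := count_pos.2 (mem_allLegs.2 ⟨a, ha, hw⟩)
  rw [allLegs_add, count_add] at *
  omega

lemma models_map_rename {W W' : Type} {σ : W' → Ontic} {f : W → W'} {K : Multiset (Node W)} :
    Models σ (K.map (Node.rename f)) ↔ Models (σ ∘ f) K := by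
  refine ⟨fun h a ha => (holds_rename σ f a).1 (h _ (mem_map_of_mem _ ha)), fun h a ha => ?_⟩
  obtain ⟨b, hb, rfl⟩ := mem_map.1 ha
  exact (holds_rename σ f b).2 (h b hb)

lemma Step.exists_models_iff {D E : Net m n} (h : Step D E) :
    (∃ σ, Models σ D) ↔ ∃ σ, Models σ E := by
  cases h with
  | @rule L R h C hL hR =>
    have cL : ∀ w, (allLegs L).count w ≤ 2 := fun w => by
      have := hL.count_le w
      rw [allLegs_add, count_add] at this
      omega
    have cR : ∀ w, (allLegs R).count w ≤ 2 := fun w => by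
      have := hR.count_le w
      rw [allLegs_add, count_add] at this
      omega
    obtain ⟨h1, h2⟩ := h.entails cL cR
    exact ⟨h1.exists_models hR, h2.exists_models hL⟩
  | rename f D hD =>
    have inv : (Name.mapInt f ∘ Name.mapInt f.symm : Name m n → Name m n) = id := by
      funext x
      rcases x with i | j | k <;> simp [Name.mapInt]
    simp only [models_map_rename]
    have inv' : (Name.mapInt f.symm ∘ Name.mapInt f : Name m n → Name m n) = id := by
      funext x
      rcases x with i | j | k <;> simp [Name.mapInt]
    exact ⟨fun ⟨σ, h⟩ => ⟨σ ∘ Name.mapInt f.symm, by rwa [Function.comp_assoc, inv']⟩,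
      fun ⟨σ, h⟩ => ⟨_, h⟩⟩
  | absorb u k hu C hD =>
    simp only [models_map_rename, models_cons, holds_wire]
    constructor
    · rintro ⟨σ, hw, h⟩
      refine ⟨σ, ?_⟩
      convert h using 1
      funext x
      by_cases hx : x = .int k
      · simp [hx, hw]
      · simp [Function.update_of_ne hx]
    · rintro ⟨σ, h⟩
      exact ⟨_, by simp [Function.update_of_ne hu], h⟩

/-- Equality according to the rewrite rules does not change whether a diagram denotes the empty
relation. -/
lemma Equal.exists_models_iff {D E : Net m n} (h : Equal D E) :
    (∃ σ, Models σ D) ↔ ∃ σ, Models σ E := by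
  induction h with
  | rel D E h => exact h.exists_models_iff
  | refl D => rfl
  | symm D E _ ih => exact ih.symm
  | trans D E F _ _ ih ih' => exact ih.trans ih'

end Consistency

variable {n : ℕ}

lemma scalar_mem_applyOps {H : Net 0 n} (h : spider .red (1, 1) 0 ∈ H)
    (l : List (Fin n × LocalOp)) : spider .red (1, 1) 0 ∈ applyOps l H := by
  induction l with
  | nil => exact h
  | cons x l ih => exact mem_cons_of_mem (mem_map.2 ⟨_, ih, rfl⟩)

/-- A diagram realizing a net with a red scalar of phase `11` denotes the empty relation. -/
lemma Realizes.not_models {F D : Net 0 n} (h : Realizes F D) (hF : spider .red (1, 1) 0 ∈ F)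
    (σ : Name 0 n → Ontic) : ¬ Models σ D := by
  obtain ⟨K, ℓ, V, -, rfl, rfl⟩ := h
  obtain ⟨⟨k, A⟩, hm, he⟩ := mem_map.1 hF
  simp only [Node.rename, spider, Node.mk.injEq, map_eq_zero] at he
  obtain ⟨rfl, rfl⟩ := he
  intro hσ
  have : (spider .red (1, 1) 0).Holds σ := hσ _ (mem_add.2 (.inl hm))
  obtain ⟨b, -, hb⟩ := holds_spider.1 this
  rw [bit_eleven] at hb
  simp at hb

end

end ToyCalculus

theorem mainTheorem3 (n : ℕ) (D : ToyCalculus.Net 0 n) (hD : ToyCalculus.IsDiagram D)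
    (hne : (ToyCalculus.interp D).Nonempty) :
    ∃ (G : SimpleGraph (Fin n)) (ops : Fin n → List ToyCalculus.LocalOp),
      (∀ i, ToyCalculus.IsNormal (ops i)) ∧
      ToyCalculus.Equal D (ToyCalculus.gsLO G ops) := by
  obtain ⟨l, H, hs, ⟨G, rfl⟩ | hbad⟩ := ToyCalculus.isReduced_of_arity hD.arity
  · obtain ⟨ops, hops, hs'⟩ := ToyCalculus.exists_normal_applyOps G l
    exact ⟨G, ops, hops, hD.equal_of_sim (ToyCalculus.isDiagram_gsLO G ops) (hs.trans hs')⟩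
  · obtain ⟨⟨_, _⟩, σ, -, -, hσ⟩ := hne
    obtain ⟨E, hE, he⟩ := (hs D).1 ⟨D, hD.realizes_self, ToyCalculus.Equal.refl D⟩
    obtain ⟨τ, hτ⟩ := he.symm.exists_models_iff.1 ⟨σ, hσ⟩
    exact absurd hτ (hE.not_models (ToyCalculus.scalar_mem_applyOps hbad l) τ)
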